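/- For integers $k\ge 1$, $n\ge 0$, a $k$-ary constraint over variables $x_1,\dots,x_n$ is a pair $(c,S)$ with negation pattern $c\in\{-1,1\}^k$ and scope $S\in[n]^k$ (repeated variables are allowed); for a predicate $P:\{-1,1\}^k\to\{0,1\}$ it represents the constraint $P(c\circ x_S)=1$, where $x_S=(x_{S_1},\dots,x_{S_k})$ and $\circ$ is the entrywise product. An instance $\mathcal I$ of $\mathrm{CSP}(P)$ is a finite multiset of constraints. A nonempty instance and an assignment $x\in\{-1,1\}^n$ induce the distribution $$\mathcal D_{\mathcal I,x}(\alpha)=\frac{1}{|\mathcal I|}\,\#\{(c,S)\in\mathcal I : c\circ x_S=\alpha\},\qquad \alpha\in\{-1,1\}^k .$$ $\mathcal I$ is $\gamma$-quasirandom if it is nonempty and for every $x\in\{-1,1\}^n$ the total variation distance $\frac12\sum_{\alpha}|\mathcal D_{\mathcal I,x}(\alpha)-2^{-k}|$ is at most $\gamma$. For $p\in[0,1]$ let $\mathcal F(n,p)$ be the random instance that contains each of the $2^kn^k$ possible constraints independently with probability $p$, and let $\overline m=2^kn^kp$ be the expected number of constraints. (None of this depends on $P$ beyond its arity $k$.)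 **Theorem.** There is an absolute constant $C$ such that for every $k\ge 2$ there is a deterministic algorithm $\mathcal A$ with the following properties. It takes as input $n$, an instance $\mathcal I$ of $k$-ary constraints over $n$ variables, and a rational number $\gamma$. 1. (Efficiency) $\mathcal A$ runs in time polynomial in the bit length of its input (for fixed $k$), and outputs either "$\mathcal I$ is $\gamma$-quasirandom" or "fail"; the answer does not depend on the order in which the constraints of $\mathcal I$ are listed. 2. (No errors) For all $n$, $\mathcal I$, $\gamma$: if $\mathcal A$ outputs "$\mathcal I$ is $\gamma$-quasirandom", then $\mathcal I$ is $\gamma$-quasirandom. 3. (Success with high probability) There is a function $\delta(n)\to0$ as $n\to\infty$ (depending on $k$ only) such that for all $n$, all $p\in[0,1]$ and all rational $0<\gamma\le1$ with $$\overline m\ \ge\ \frac{2^{Ck}\,n^{k/2}\,(\log n)^5}{\gamma^2}$$ one has $\Pr_{\mathcal I\sim\mathcal F(n,p)}[\mathcal A(n,\mathcal I,\gamma)=\text{"fail"}]\le\delta(n)$. -/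

import Mathlib

/-! ## The machine model: a random access machine with logarithmic cost

Memory consists of integer-valued arrays; a program mentions finitely many of them and can address
their cells indirectly.  Every evaluated (sub)expression is charged the bit length of its value. -/

namespace RAM

/-- Bit length of an integer, with one bit for the sign (so it is at least `1`). -/
def bitLength (z : ℤ) : ℕ := Nat.size z.natAbs + 1

/-- Memory: `s a i` is the content of cell `i` of array `a`. -/
abbrev Memory := ℕ → ℤ → ℤ

/-- Integer expressions. `get a i` reads cell `i` of array `a`, `div` is integer division. -/
inductive Expr where
  | lit (z : ℤ)
  | get (a : ℕ) (i : Expr)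
  | add (e f : Expr)
  | sub (e f : Expr)
  | mul (e f : Expr)
  | div (e f : Expr)

/-- The value of an expression. -/
def Expr.eval (s : Memory) : Expr → ℤ
  | .lit z => z
  | .get a i => s a (i.eval s)
  | .add e f => e.eval s + f.eval s
  | .sub e f => e.eval s - f.eval s
  | .mul e f => e.eval s * f.eval s
  | .div e f => e.eval s / f.eval s

/-- The cost of evaluating an expression: the total bit length of all values that occur. -/
def Expr.cost (s : Memory) : Expr → ℕ
  | .lit z => bitLength z
  | .get a i => i.cost s + bitLength (s a (i.eval s))
  | .add e f => e.cost s + f.cost s + bitLength (e.eval s + f.eval s)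
  | .sub e f => e.cost s + f.cost s + bitLength (e.eval s - f.eval s)
  | .mul e f => e.cost s + f.cost s + bitLength (e.eval s * f.eval s)
  | .div e f => e.cost s + f.cost s + bitLength (e.eval s / f.eval s)

/-- Programs. `set a i e` stores the value of `e` in cell `i` of array `a`;
tests are of the form `0 < e`. -/
inductive Program where
  | skip
  | set (a : ℕ) (i e : Expr)
  | seq (c d : Program)
  | ite (e : Expr) (c d : Program)
  | while (e : Expr) (c : Program)

/-- The memory `s` with cell `i` of array `a` overwritten by `z`. -/
def Memory.write (s : Memory) (a : ℕ) (i z : ℤ) : Memory :=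
  fun b j => if b = a ∧ j = i then z else s b j

/-- `Exec c s t s'`: started in memory `s`, the program `c` halts after time `t` in memory `s'`. -/
inductive Exec : Program → Memory → ℕ → Memory → Prop
  | skip (s : Memory) : Exec .skip s 1 s
  | set (a : ℕ) (i e : Expr) (s : Memory) :
      Exec (.set a i e) s (i.cost s + e.cost s + 1) (s.write a (i.eval s) (e.eval s))
  | seq {c d : Program} {s s' s'' : Memory} {t t' : ℕ} :
      Exec c s t s' → Exec d s' t' s'' → Exec (.seq c d) s (t + t' + 1) s''
  | ite_true {e : Expr} {c d : Program} {s s' : Memory} {t : ℕ} :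
      0 < e.eval s → Exec c s t s' → Exec (.ite e c d) s (e.cost s + t + 1) s'
  | ite_false {e : Expr} {c d : Program} {s s' : Memory} {t : ℕ} :
      ¬ 0 < e.eval s → Exec d s t s' → Exec (.ite e c d) s (e.cost s + t + 1) s'
  | while_true {e : Expr} {c : Program} {s s' s'' : Memory} {t t' : ℕ} :
      0 < e.eval s → Exec c s t s' → Exec (.while e c) s' t' s'' →
      Exec (.while e c) s (e.cost s + t + t' + 1) s''
  | while_false {e : Expr} {c : Program} {s : Memory} :
      ¬ 0 < e.eval s → Exec (.while e c) s (e.cost s + 1) s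

/-- The initial memory: the input is written in the cells `0, 1, 2, …` of array `0`; all other
cells contain `0`. -/
def initialMemory (input : List ℤ) : Memory :=
  fun a i => if a = 0 ∧ 0 ≤ i then input.getD i.toNat 0 else 0

/-- On the given input, `c` halts after time `t` with output `b`. The output is read off
from cell `0` of array `1`: it is `1` for `true` and `0` for `false`. -/
def Outputs (c : Program) (input : List ℤ) (t : ℕ) (b : Bool) : Prop :=
  ∃ s : Memory, Exec c (initialMemory input) t s ∧ s 1 0 = if b then 1 else 0

/-- The bit length of an input. -/
def inputSize (input : List ℤ) : ℕ := (input.map bitLength).sum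

/-- With respect to the encoding `enc` of its arguments, `f` is computed by a (deterministic)
program whose running time is at most a polynomial in the bit length of the input. -/
def PolyTimeComputable {α : Type*} (enc : α → List ℤ) (f : α → Bool) : Prop :=
  ∃ (c : Program) (q : Polynomial ℕ), ∀ x : α,
    ∃ t : ℕ, t ≤ q.eval (inputSize (enc x)) ∧ Outputs c (enc x) t (f x)

end RAM

/-! ## Constraint satisfaction problems -/

namespace CSP

open scoped unitInterval

/-- A `k`-ary constraint over `n` variables: a negation pattern `c ∈ {-1,1}^k` and a scope
`S ∈ [n]^k` (repeated variables are allowed). Here `ℤˣ = {1, -1}`. The constraint stands for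
`P (c ∘ x_S) = 1`, but nothing below depends on the predicate `P`. -/
abbrev Constraint (k n : ℕ) := (Fin k → ℤˣ) × (Fin k → Fin n)

/-- An instance is a multiset of constraints. -/
abbrev Instance (k n : ℕ) := Multiset (Constraint k n)

/-- The probability mass function of the distribution on `{-1,1}^k` that is induced by an instance
(with at least one constraint) and an assignment `x`. -/
noncomputable def inducedDist {k n : ℕ} (J : Instance k n) (x : Fin n → ℤˣ)
    (α : Fin k → ℤˣ) : ℝ :=
  (J.countP (fun cS => (fun i => cS.1 i * x (cS.2 i)) = α) : ℝ) / (Multiset.card J : ℝ)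

/-- The probability mass function of the uniform distribution on `{-1,1}^k`. -/
noncomputable def uniformDist (k : ℕ) (_α : Fin k → ℤˣ) : ℝ := 1 / 2 ^ k

/-- Total variation distance of two probability mass functions on a finite set. -/
noncomputable def tvDist {A : Type*} [Fintype A] (D D' : A → ℝ) : ℝ :=
  (1 / 2) * ∑ a, |D a - D' a|

/-- An instance is `ε`-quasirandom if for every assignment the induced distribution is `ε`-close to
uniform. The induced distributions exist only if there is at least one constraint; the empty
instance is not quasirandom. -/
def IsQuasirandom {k n : ℕ} (ε : ℝ) (J : Instance k n) : Prop :=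
  J ≠ 0 ∧ ∀ x : Fin n → ℤˣ, tvDist (inducedDist J x) (uniformDist k) ≤ ε

/-- The instance in which every constraint of a set of constraints occurs exactly once. -/
noncomputable def Instance.ofSet {k n : ℕ} (B : Set (Constraint k n)) : Instance k n :=
  B.toFinite.toFinset.val

/-- The probability that the random instance, which contains each of the `2^k n^k` possible
constraints independently with probability `p`, has the property `E`. -/
noncomputable def prob {k n : ℕ} (p : I) (E : Instance k n → Prop) : ℝ :=
  (ProbabilityTheory.setBernoulli (Set.univ : Set (Constraint k n)) p).real
    {B | E (Instance.ofSet B)}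

/-- The expected number `2^k n^k p` of constraints. -/
noncomputable def expectedNumConstraints (k n : ℕ) (p : I) : ℝ := 2 ^ k * (n : ℝ) ^ k * (p : ℝ)

/-- What a certification algorithm for `k`-ary instances receives: the number of variables, the
constraints, listed in some order, and the required accuracy `γ`. -/
structure AlgInput (k : ℕ) where
  n : ℕ
  constraints : List (Constraint k n)
  γ : ℚ

/-- The input as a list of integers: the number of variables, the number of constraints, numerator
and denominator of `γ`, then the negation pattern and the scope of each constraint. -/
def AlgInput.encode {k : ℕ} (x : AlgInput k) : List ℤ :=
  [(x.n : ℤ), (x.constraints.length : ℤ), x.γ.num, (x.γ.den : ℤ)] ++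
    x.constraints.flatMap fun cS =>
      List.ofFn (fun i => ((cS.1 i : ℤˣ) : ℤ)) ++ List.ofFn (fun i => (((cS.2 i : Fin x.n) : ℕ) : ℤ))

/-- `A n J γ = true` means that `A` outputs the statement that `J` is `γ`-quasirandom, and
`A n J γ = false` means that it outputs `fail`. The algorithm is efficient if it runs in polynomial
time, whatever the order in which the constraints of the instance are listed. -/
def IsEfficient {k : ℕ} (A : (n : ℕ) → Instance k n → ℚ → Bool) : Prop :=
  RAM.PolyTimeComputable AlgInput.encode
    (fun x : AlgInput k => A x.n (x.constraints : Multiset (Constraint k x.n)) x.γ)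

end CSP

/-! By Fourier inversion on {-1,1}^k, an instance with m constraints is γ-quasirandom as soon as 2^k
|`charSum T J x`| ≤ γ m for all nonempty T and all x. For fixed T the coefficients of this
polynomial in x, indexed by scopes, form an array w(i,u,v): u and v encode ⌊k/2⌋ variables each, and
i encodes the remaining variable if k is odd. On ±1 assignments the monomials factor as A(i)B(u)C(v)
(`exists_char_factorization`). Cauchy–Schwarz over i removes A and leaves the form of ∑ w_i ⊗ w_i at
B ⊗ B and C ⊗ C. Products of an entry with itself only contribute the sum of squares; the rest is at
most N²‖`offDiag w`‖ with N = n^⌊k/2⌋ (`sum_signs_sq_le`). The norm is bounded by the integer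
tr((XXᵀ)^(2^L)), where L is least with n ≤ 2^(2^L). So the certificate is an exact integer
inequality, and soundness (`isQuasirandom_of_certifier`) needs no randomness. As 2^L is of order log
n, the loss from norm to trace is a constant factor per power, and all integers have polynomial bit
length; iterated squaring on the RAM evaluates the test (`isEfficient_certifier`).

Success on random instances rests on symmetrization. If j ∈ T, then flipping c_j in all constraints
on an arbitrary set of scopes preserves the distribution and the number of constraints on each
scope, but negates exactly those coefficients. Hence the trace may be averaged over independent
signs of the entries of w (`bernoulliProb_trace_le`). For fixed counts this average is bounded by
decoupling the two factors of w_i ⊗ w_i (`sum_decoupled`), which turns `offDiag` into a Rademacher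
sum over slices, and by the noncommutative Khintchine inequality
(`sum_trace_signedSum_mul_transpose_pow_le`). The latter is an induction on the exponent: flip one
sign, telescope the difference of powers, and compare traces.

Let q = n^(k mod 2) and let μ be the expected number of constraints in a row of a slice. If μ ≥ 1,
the variance in Khintchine comes from the norms of the slices, themselves controlled by Khintchine
(`sum_trace_offDiag_le_of_degree`); if μ < 1, it comes from counting nonzero entries
(`sum_trace_offDiag_le_of_sparse`). Chernoff bounds supply the degrees and pair counts
(`bernoulliProb_not_regular_le`). Up to factors depending on k and powers of log n, both give
‖`offDiag w`‖² ≲ qμ², while the certificate tolerates a norm of order γ²qμ². The hypothesis on the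
expected number of constraints, squared and divided by n^k, is γ⁴qμ² ≥ 2^(40k) (log n)^10, which is
enough. -/

set_option linter.unusedSectionVars false

/-! ### Noncommutative Khintchine inequality for symmetric matrices -/

/-- Non-commutative telescoping of a difference of powers. -/
theorem pow_sub_pow_eq_sum_mul {R : Type*} [Ring R] (x y : R) (m : ℕ) :
    x ^ m - y ^ m = ∑ j ∈ Finset.range m, x ^ j * (x - y) * y ^ (m - 1 - j) := by
  induction m with
  | zero => simp
  | succ m ih =>
    rw [Finset.sum_range_succ]
    have h : ∑ j ∈ Finset.range m, x ^ j * (x - y) * y ^ (m + 1 - 1 - j)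
        = (∑ j ∈ Finset.range m, x ^ j * (x - y) * y ^ (m - 1 - j)) * y := by
      rw [Finset.sum_mul]
      refine Finset.sum_congr rfl fun j hj => ?_
      have : m + 1 - 1 - j = m - 1 - j + 1 := by have := Finset.mem_range.1 hj; omega
      rw [this, pow_succ, ← mul_assoc]
    rw [h, ← ih]
    simp only [Nat.add_sub_cancel, Nat.sub_self, pow_zero, mul_one]
    rw [pow_succ, pow_succ]
    noncomm_ring

theorem pow_mul_pow_le_add_of_even {a b : ℝ} {j l : ℕ} (h : Even (j + l)) :
    a ^ j * b ^ l ≤ a ^ (j + l) + b ^ (j + l) := by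
  have h1 : a ^ j * b ^ l ≤ |a| ^ j * |b| ^ l := by
    rw [← abs_pow, ← abs_pow, ← abs_mul]; exact le_abs_self _
  rw [← h.pow_abs a, ← h.pow_abs b]
  refine h1.trans ?_
  rcases le_total |a| |b| with hab | hab
  · calc |a| ^ j * |b| ^ l ≤ |b| ^ j * |b| ^ l := by gcongr
      _ = |b| ^ (j + l) := (pow_add _ _ _).symm
      _ ≤ _ := le_add_of_nonneg_left (by positivity)
  · calc |a| ^ j * |b| ^ l ≤ |a| ^ j * |a| ^ l := by gcongr
      _ = |a| ^ (j + l) := (pow_add _ _ _).symm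
      _ ≤ _ := le_add_of_nonneg_right (by positivity)

namespace Matrix

section Spectral
variable {n : Type*} [Fintype n] [DecidableEq n]

theorem IsHermitian.exists_pow_eq {W : Matrix n n ℝ} (hW : W.IsHermitian) :
    ∃ (U : Matrix n n ℝ) (d : n → ℝ), ∀ j : ℕ, W ^ j = U * diagonal (fun a => d a ^ j) * Uᵀ := by
  refine ⟨hW.eigenvectorUnitary, hW.eigenvalues, fun j => ?_⟩
  conv_lhs => rw [hW.spectral_theorem]
  rw [← map_pow, Unitary.conjStarAlgAut_apply, diagonal_pow]
  congr 1

/-- The squares on the right are what makes scalar inequalities between the eigenvalues d and e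
transfer to traces. -/
theorem trace_mul_diagonal_conj (A U V : Matrix n n ℝ) (hA : Aᵀ = A) (d e : n → ℝ) :
    trace (A * (U * diagonal d * Uᵀ) * A * (V * diagonal e * Vᵀ))
      = ∑ a, ∑ b, d a * e b * (Uᵀ * A * V) a b ^ 2 := by
  have h1 : trace (A * (U * diagonal d * Uᵀ) * A * (V * diagonal e * Vᵀ))
      = trace (diagonal d * (Uᵀ * A * V) * (diagonal e * (Uᵀ * A * V)ᵀ)) := by
    have : (Uᵀ * A * V)ᵀ = Vᵀ * A * U := by
      rw [transpose_mul, transpose_mul, transpose_transpose, hA, Matrix.mul_assoc]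
    rw [this, show A * (U * diagonal d * Uᵀ) * A * (V * diagonal e * Vᵀ)
      = (A * U) * (diagonal d * (Uᵀ * A * V) * (diagonal e * Vᵀ)) by simp only [Matrix.mul_assoc],
      trace_mul_comm]
    simp only [Matrix.mul_assoc]
  rw [h1, trace]
  refine Finset.sum_congr rfl fun a _ => ?_
  rw [diag_apply, mul_apply]
  refine Finset.sum_congr rfl fun b _ => ?_
  rw [diagonal_mul, diagonal_mul, transpose_apply]
  ring

/-- A trace inequality for words in three symmetric matrices. -/
theorem trace_mul_pow_mul_pow_le {A W Y : Matrix n n ℝ} (hA : Aᵀ = A) (hW : W.IsHermitian)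
    (hY : Y.IsHermitian) {j l : ℕ} (h : Even (j + l)) :
    trace (A * W ^ j * A * Y ^ l) ≤
      trace (A * W ^ (j + l) * A) + trace (A * Y ^ (j + l) * A) := by
  obtain ⟨U, d, hU⟩ := hW.exists_pow_eq
  obtain ⟨V, e, hV⟩ := hY.exists_pow_eq
  have key : ∀ j l : ℕ, trace (A * W ^ j * A * Y ^ l)
      = ∑ a, ∑ b, d a ^ j * e b ^ l * (Uᵀ * A * V) a b ^ 2 := fun j l => by
    rw [hU, hV, trace_mul_diagonal_conj A U V hA]
  have k1 := key (j + l) 0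
  have k2 := key 0 (j + l)
  simp only [pow_zero, mul_one, one_mul] at k1 k2
  have k3 : trace (A * Y ^ (j + l) * A) = trace (A * A * Y ^ (j + l)) := by
    rw [trace_mul_comm, Matrix.mul_assoc]
  rw [key, k1, k3, k2, ← Finset.sum_add_distrib]
  refine Finset.sum_le_sum fun a _ => ?_
  rw [← Finset.sum_add_distrib]
  refine Finset.sum_le_sum fun b _ => ?_
  rw [← add_mul]
  exact mul_le_mul_of_nonneg_right (pow_mul_pow_le_add_of_even h) (sq_nonneg _)

end Spectral

section Khintchine
variable {ι n : Type*} [Fintype ι] [DecidableEq ι] [Fintype n] [DecidableEq n]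

/-- A Rademacher sum with matrix coefficients. -/
def signedSum {m : Type*} (A : ι → Matrix m n ℝ) (ε : ι → ℤˣ) : Matrix m n ℝ :=
  ∑ i, ((ε i : ℤ) : ℝ) • A i

/-- The involution that changes the `i`-th sign. -/
def flipSign (i : ι) : (ι → ℤˣ) ≃ (ι → ℤˣ) := Equiv.mulLeft (Pi.mulSingle i (-1))

omit [Fintype ι] in
theorem flipSign_same (i : ι) (ε : ι → ℤˣ) : flipSign i ε i = - ε i := by
  simp [flipSign]

omit [Fintype ι] in
theorem flipSign_of_ne {i j : ι} (h : j ≠ i) (ε : ι → ℤˣ) : flipSign i ε j = ε j := by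
  simp [flipSign, h]

omit [Fintype n] [DecidableEq n] in
theorem signedSum_sub_flipSign (A : ι → Matrix n n ℝ) (i : ι) (ε : ι → ℤˣ) :
    signedSum A ε - signedSum A (flipSign i ε) = (2 * ((ε i : ℤ) : ℝ)) • A i := by
  rw [signedSum, signedSum, ← Finset.sum_sub_distrib, Finset.sum_eq_single i]
  · rw [flipSign_same, ← sub_smul]
    congr 1
    push_cast
    ring
  · intro j _ hj
    rw [flipSign_of_ne hj, sub_self]
  · simp

theorem units_int_cast_mul_self (u : ℤˣ) : ((u : ℤ) : ℝ) * ((u : ℤ) : ℝ) = 1 := by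
  rw [← Int.cast_mul, ← Units.val_mul, Int.units_mul_self]; simp

omit [Fintype n] [DecidableEq n] in
theorem signedSum_transpose {A : ι → Matrix n n ℝ} (hA : ∀ i, (A i)ᵀ = A i) (ε : ι → ℤˣ) :
    (signedSum A ε)ᵀ = signedSum A ε := by
  simp [signedSum, transpose_sum, transpose_smul, hA]

/-- A discrete integration by parts. Pairing ε with its flip at i produces the difference of the odd
powers of X and X'; since X - X' = 2 ε_i A_i, telescoping turns it into 2r + 1 words with two
factors A_i. Each word is bounded by `trace_mul_pow_mul_pow_le`, and summing over all ε makes X and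
X' indistinguishable. -/
theorem sum_sign_mul_trace_le {A : ι → Matrix n n ℝ} (hA : ∀ i, (A i)ᵀ = A i) (i : ι) (r : ℕ) :
    ∑ ε : ι → ℤˣ, ((ε i : ℤ) : ℝ) * trace (A i * signedSum A ε ^ (2 * r + 1)) ≤
      (4 * r + 2) * ∑ ε : ι → ℤˣ, trace (A i * signedSum A ε ^ (2 * r) * A i) := by
  set X := signedSum A with hX
  have hH : ∀ ε, (X ε).IsHermitian := fun ε => by
    rw [IsHermitian, conjTranspose_eq_transpose_of_trivial]; exact signedSum_transpose hA ε
  have hflip : ∀ f : (ι → ℤˣ) → ℝ, ∑ ε, f (flipSign i ε) = ∑ ε, f ε := fun f =>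
    Equiv.sum_comp (flipSign i) f
  have h2 : 2 * ∑ ε : ι → ℤˣ, ((ε i : ℤ) : ℝ) * trace (A i * X ε ^ (2 * r + 1))
      = ∑ ε : ι → ℤˣ, 2 * ∑ j ∈ Finset.range (2 * r + 1),
          trace (A i * X ε ^ j * A i * X (flipSign i ε) ^ (2 * r - j)) := by
    rw [two_mul]
    nth_rewrite 2 [← hflip]
    rw [← Finset.sum_add_distrib]
    refine Finset.sum_congr rfl fun ε _ => ?_
    rw [flipSign_same]
    have : ((ε i : ℤ) : ℝ) * trace (A i * X ε ^ (2 * r + 1))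
        + (((-ε i : ℤˣ) : ℤ) : ℝ) * trace (A i * X (flipSign i ε) ^ (2 * r + 1))
        = ((ε i : ℤ) : ℝ) * trace (A i * (X ε ^ (2 * r + 1) - X (flipSign i ε) ^ (2 * r + 1))) := by
      rw [Matrix.mul_sub, trace_sub]; push_cast; ring
    rw [this, pow_sub_pow_eq_sum_mul, Finset.mul_sum, trace_sum, Finset.mul_sum, Finset.mul_sum]
    refine Finset.sum_congr rfl fun j _ => ?_
    rw [hX, signedSum_sub_flipSign, Matrix.mul_smul, Matrix.smul_mul, Matrix.mul_smul, trace_smul,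
      smul_eq_mul, ← mul_assoc, show ((ε i : ℤ) : ℝ) * (2 * ((ε i : ℤ) : ℝ)) = 2 by
        linear_combination 2 * units_int_cast_mul_self (ε i)]
    simp only [Matrix.mul_assoc, Nat.add_sub_cancel]
  have h3 : ∑ ε : ι → ℤˣ, 2 * ∑ j ∈ Finset.range (2 * r + 1),
          trace (A i * X ε ^ j * A i * X (flipSign i ε) ^ (2 * r - j))
      ≤ ∑ ε : ι → ℤˣ, 2 * ((2 * r + 1) * (trace (A i * X ε ^ (2 * r) * A i)
          + trace (A i * X (flipSign i ε) ^ (2 * r) * A i))) := by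
    refine Finset.sum_le_sum fun ε _ => ?_
    refine mul_le_mul_of_nonneg_left ?_ zero_le_two
    have : ∀ j ∈ Finset.range (2 * r + 1),
        trace (A i * X ε ^ j * A i * X (flipSign i ε) ^ (2 * r - j)) ≤
        trace (A i * X ε ^ (2 * r) * A i) + trace (A i * X (flipSign i ε) ^ (2 * r) * A i) := by
      intro j hj
      have hj' : j + (2 * r - j) = 2 * r := by have := Finset.mem_range.1 hj; omega
      have := trace_mul_pow_mul_pow_le (hA i) (hH ε) (hH (flipSign i ε))
        (j := j) (l := 2 * r - j) (by rw [hj']; exact even_two_mul r)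
      rwa [hj'] at this
    refine (Finset.sum_le_sum this).trans ?_
    rw [Finset.sum_const, Finset.card_range, nsmul_eq_mul]
    push_cast
    exact le_rfl
  have h4 : ∑ ε : ι → ℤˣ, 2 * ((2 * (r : ℝ) + 1) * (trace (A i * X ε ^ (2 * r) * A i)
          + trace (A i * X (flipSign i ε) ^ (2 * r) * A i)))
      = 2 * ((4 * r + 2) * ∑ ε : ι → ℤˣ, trace (A i * X ε ^ (2 * r) * A i)) := by
    rw [← Finset.mul_sum, ← Finset.mul_sum, Finset.sum_add_distrib,
      hflip (fun ε => trace (A i * X ε ^ (2 * r) * A i))]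
    ring
  linarith

/-- By symmetry the trace of A_i X^(2r) A_i is the squared Frobenius norm of A_i X^r, so the
variance bound can be applied to each column of X^r. -/
theorem sum_trace_conj_le {A : ι → Matrix n n ℝ} (hA : ∀ i, (A i)ᵀ = A i) {s : ℝ}
    (hs : ∀ v : n → ℝ, ∑ i, ∑ a, (A i *ᵥ v) a ^ 2 ≤ s * ∑ a, v a ^ 2) {X : Matrix n n ℝ}
    (hX : Xᵀ = X) (r : ℕ) :
    ∑ i, trace (A i * X ^ (2 * r) * A i) ≤ s * trace (X ^ (2 * r)) := by
  have h0 : (X ^ r)ᵀ = X ^ r := by rw [transpose_pow, hX]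
  have h1 : ∀ Y : Matrix n n ℝ, trace (Y * Yᵀ) = ∑ b, ∑ a, Y a b ^ 2 := fun Y => by
    rw [trace, Finset.sum_comm]
    refine Finset.sum_congr rfl fun a _ => ?_
    rw [diag_apply, mul_apply]
    exact Finset.sum_congr rfl fun b _ => by rw [transpose_apply, sq]
  have h2 : ∀ i, trace (A i * X ^ (2 * r) * A i) = ∑ b, ∑ a, (A i *ᵥ fun c => (X ^ r) c b) a ^ 2 := by
    intro i
    have : A i * X ^ (2 * r) * A i = (A i * X ^ r) * (A i * X ^ r)ᵀ := by
      rw [transpose_mul, h0, hA, two_mul, pow_add]; simp only [Matrix.mul_assoc]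
    rw [this, h1]
    rfl
  have h3 : trace (X ^ (2 * r)) = ∑ b, ∑ a, (X ^ r) a b ^ 2 := by
    rw [two_mul, pow_add, ← h1, h0]
  simp_rw [h2]
  rw [Finset.sum_comm, h3, Finset.mul_sum]
  exact Finset.sum_le_sum fun b _ => hs _

/-- **Non-commutative Khintchine inequality** (trace moments, symmetric coefficients). -/
theorem sum_trace_signedSum_pow_le {A : ι → Matrix n n ℝ} (hA : ∀ i, (A i)ᵀ = A i) {s : ℝ}
    (hs0 : 0 ≤ s)
    (hs : ∀ v : n → ℝ, ∑ i, ∑ a, (A i *ᵥ v) a ^ 2 ≤ s * ∑ a, v a ^ 2) {p : ℕ} :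
    ∀ r ≤ p, ∑ ε : ι → ℤˣ, trace (signedSum A ε ^ (2 * r)) ≤
      Fintype.card (ι → ℤˣ) * (Fintype.card n * (4 * p * s) ^ r) := by
  intro r
  induction r with
  | zero => intro _; simp [mul_comm]
  | succ r ih =>
    intro hr
    have h1 : ∑ ε : ι → ℤˣ, trace (signedSum A ε ^ (2 * (r + 1)))
        = ∑ i, ∑ ε : ι → ℤˣ, ((ε i : ℤ) : ℝ) * trace (A i * signedSum A ε ^ (2 * r + 1)) := by
      rw [Finset.sum_comm]
      refine Finset.sum_congr rfl fun ε _ => ?_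
      rw [show 2 * (r + 1) = (2 * r + 1) + 1 by ring, pow_succ' (signedSum A ε) (2 * r + 1)]
      conv_lhs => rw [signedSum, Finset.sum_mul]
      rw [trace_sum]
      refine Finset.sum_congr rfl fun i _ => ?_
      rw [Matrix.smul_mul, trace_smul, smul_eq_mul]
      rfl
    rw [h1]
    calc _ ≤ ∑ i, (4 * (r : ℝ) + 2) * ∑ ε : ι → ℤˣ, trace (A i * signedSum A ε ^ (2 * r) * A i) :=
          Finset.sum_le_sum fun i _ => sum_sign_mul_trace_le hA i r
      _ = (4 * (r : ℝ) + 2) * ∑ ε : ι → ℤˣ, ∑ i, trace (A i * signedSum A ε ^ (2 * r) * A i) := by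
          rw [← Finset.mul_sum, Finset.sum_comm]
      _ ≤ (4 * (r : ℝ) + 2) * ∑ ε : ι → ℤˣ, s * trace (signedSum A ε ^ (2 * r)) := by
          gcongr with ε
          exact sum_trace_conj_le hA hs (signedSum_transpose hA ε) r
      _ = ((4 * (r : ℝ) + 2) * s) * ∑ ε : ι → ℤˣ, trace (signedSum A ε ^ (2 * r)) := by
          rw [← Finset.mul_sum]; ring
      _ ≤ ((4 * (r : ℝ) + 2) * s) *
            (Fintype.card (ι → ℤˣ) * (Fintype.card n * (4 * p * s) ^ r)) := by
          gcongr
          exact ih (by omega)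
      -- As r + 1 ≤ p, the factor 4r + 2 is at most 4p, so one constant serves for every r of the
      -- induction.
      _ ≤ (4 * p * s) * (Fintype.card (ι → ℤˣ) * (Fintype.card n * (4 * p * s) ^ r)) := by
          have : ((r : ℝ) + 1) ≤ p := by exact_mod_cast hr
          gcongr
          linarith
      _ = _ := by rw [pow_succ]; ring

end Khintchine

end Matrix

/-! ### Operator norm versus trace moments; the rectangular Khintchine inequality -/

namespace Matrix

section OpNorm
open scoped Matrix.Norms.L2Operator
variable {m n : Type*} [Fintype m] [Fintype n] [DecidableEq m] [DecidableEq n]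

theorem sum_mulVec_sq_le (A : Matrix m n ℝ) (v : n → ℝ) :
    ∑ a, (A *ᵥ v) a ^ 2 ≤ ‖A‖ ^ 2 * ∑ b, v b ^ 2 := by
  have h := A.l2_opNorm_mulVec (WithLp.toLp 2 v)
  have h2 := pow_le_pow_left₀ (norm_nonneg _) h 2
  rw [mul_pow, EuclideanSpace.norm_sq_eq, EuclideanSpace.norm_sq_eq] at h2
  simpa using h2

theorem norm_sq_le_of_sum_mulVec_sq_le {A : Matrix m n ℝ} {s : ℝ} (hs : 0 ≤ s)
    (h : ∀ v : n → ℝ, ∑ a, (A *ᵥ v) a ^ 2 ≤ s * ∑ b, v b ^ 2) : ‖A‖ ^ 2 ≤ s := by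
  have h1 : ‖A‖ ≤ √s := by
    rw [l2_opNorm_def]
    refine ContinuousLinearMap.opNorm_le_bound _ (Real.sqrt_nonneg _) fun x => ?_
    rw [← sq_le_sq₀ (norm_nonneg _) (by positivity), mul_pow, Real.sq_sqrt hs,
      EuclideanSpace.norm_sq_eq, EuclideanSpace.norm_sq_eq]
    simpa using h x.ofLp
  calc ‖A‖ ^ 2 ≤ √s ^ 2 := by gcongr
    _ = s := Real.sq_sqrt hs

theorem norm_transpose_eq (A : Matrix m n ℝ) : ‖Aᵀ‖ = ‖A‖ := by
  rw [← conjTranspose_eq_transpose_of_trivial, l2_opNorm_conjTranspose]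

theorem norm_mul_transpose_self (A : Matrix m n ℝ) : ‖A * Aᵀ‖ = ‖A‖ ^ 2 := by
  have := l2_opNorm_conjTranspose_mul_self Aᵀ
  rw [conjTranspose_eq_transpose_of_trivial, transpose_transpose, norm_transpose_eq] at this
  rw [this, sq]

omit [DecidableEq m] [DecidableEq n] in
theorem trace_mul_transpose_self (A : Matrix m n ℝ) : trace (A * Aᵀ) = ∑ a, ∑ b, A a b ^ 2 := by
  rw [trace]
  refine Finset.sum_congr rfl fun a _ => ?_
  rw [diag_apply, mul_apply]
  exact Finset.sum_congr rfl fun b _ => by rw [transpose_apply, sq]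

theorem norm_sq_le_trace (A : Matrix m n ℝ) : ‖A‖ ^ 2 ≤ trace (A * Aᵀ) := by
  rw [trace_mul_transpose_self]
  refine norm_sq_le_of_sum_mulVec_sq_le (by positivity) fun v => ?_
  rw [Finset.sum_mul]
  exact Finset.sum_le_sum fun a _ => Finset.sum_mul_sq_le_sq_mul_sq _ _ _

/-- A Aᵀ is self-adjoint, so the C*-identity makes the norm multiplicative under repeated squaring.
This is the reason for exponents of the form 2 ^ L. -/
theorem norm_mul_transpose_self_pow (A : Matrix m n ℝ) (L : ℕ) :
    ‖(A * Aᵀ) ^ 2 ^ L‖ = ‖A‖ ^ (2 * 2 ^ L) := by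
  have h : IsSelfAdjoint (A * Aᵀ) := by
    rw [IsSelfAdjoint, star_eq_conjTranspose, conjTranspose_eq_transpose_of_trivial, transpose_mul,
      transpose_transpose]
  rw [h.norm_pow_two_pow, norm_mul_transpose_self, pow_mul]

/-- For L + 1, the Frobenius bound is applied to P = (A Aᵀ)^(2^L): P is symmetric, so P Pᵀ is the
next square. -/
theorem norm_pow_le_trace (A : Matrix m n ℝ) (L : ℕ) :
    ‖A‖ ^ (2 * 2 ^ L) ≤ trace ((A * Aᵀ) ^ 2 ^ L) := by
  cases L with
  | zero => simpa using norm_sq_le_trace A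
  | succ L =>
    have h := norm_sq_le_trace ((A * Aᵀ) ^ 2 ^ L)
    rw [norm_mul_transpose_self_pow, transpose_pow, transpose_mul, transpose_transpose, ← pow_mul,
      ← pow_add, ← two_mul] at h
    rw [pow_succ', ← mul_assoc, mul_comm (2 * 2) , mul_comm 2 (2 ^ L : ℕ)]
    rw [mul_comm 2 (2 ^ L : ℕ)] at h
    convert h using 2
    ring

theorem trace_le_card_mul_norm (P : Matrix m m ℝ) : trace P ≤ Fintype.card m * ‖P‖ := by
  have h : ∀ a, P a a ≤ ‖P‖ := fun a => by
    refine le_of_abs_le (abs_le_of_sq_le_sq ?_ (norm_nonneg _))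
    have h := sum_mulVec_sq_le P (Pi.single a 1)
    have h2 : (P *ᵥ Pi.single a 1) a ^ 2 ≤ ∑ b, (P *ᵥ Pi.single a 1) b ^ 2 :=
      Finset.single_le_sum (f := fun b => (P *ᵥ Pi.single a 1) b ^ 2)
        (fun b _ => sq_nonneg _) (Finset.mem_univ a)
    have h3 : ∑ b, (Pi.single a (1 : ℝ) : m → ℝ) b ^ 2 = 1 := by
      rw [Finset.sum_eq_single a] <;> simp +contextual
    rw [h3, mul_one] at h
    have h4 := h2.trans h
    simpa using h4
  rw [trace]
  refine (Finset.sum_le_sum fun a _ => h a).trans ?_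
  simp

theorem trace_pow_le (A : Matrix m n ℝ) (L : ℕ) :
    trace ((A * Aᵀ) ^ 2 ^ L) ≤ Fintype.card m * ‖A‖ ^ (2 * 2 ^ L) := by
  rw [← norm_mul_transpose_self_pow]
  exact trace_le_card_mul_norm _

omit [DecidableEq n] in
theorem posSemidef_mul_transpose_self (A : Matrix m n ℝ) : (A * Aᵀ).PosSemidef := by
  have := posSemidef_self_mul_conjTranspose A
  rwa [conjTranspose_eq_transpose_of_trivial] at this

omit [DecidableEq n] in
theorem trace_mul_transpose_pow_nonneg (A : Matrix m n ℝ) (r : ℕ) :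
    0 ≤ trace ((A * Aᵀ) ^ r) := ((posSemidef_mul_transpose_self A).pow r).trace_nonneg

end OpNorm

section RectKhintchine
variable {ι m n : Type*} [Fintype ι] [DecidableEq ι] [Fintype m] [Fintype n] [DecidableEq m]
  [DecidableEq n]

/-- The square of the symmetric dilation is block diagonal with blocks Z Zᵀ and Zᵀ Z. This transfers
the symmetric inequality to rectangular matrices. -/
theorem trace_dilation_pow (Z : Matrix m n ℝ) (r : ℕ) :
    trace (fromBlocks 0 Z Zᵀ 0 ^ (2 * r)) = trace ((Z * Zᵀ) ^ r) + trace ((Zᵀ * Z) ^ r) := by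
  rw [pow_mul, sq, fromBlocks_multiply]
  simp only [Matrix.zero_mul, Matrix.mul_zero, zero_add, add_zero]
  rw [fromBlocks_diagonal_pow]
  simp [trace, Fintype.sum_sum_type]

/-- **Non-commutative Khintchine inequality** (trace moments, rectangular coefficients). -/
theorem sum_trace_signedSum_mul_transpose_pow_le (Z : ι → Matrix m n ℝ) {s : ℝ} (hs0 : 0 ≤ s)
    (h₁ : ∀ v : n → ℝ, ∑ i, ∑ a, (Z i *ᵥ v) a ^ 2 ≤ s * ∑ b, v b ^ 2)
    (h₂ : ∀ u : m → ℝ, ∑ i, ∑ b, ((Z i)ᵀ *ᵥ u) b ^ 2 ≤ s * ∑ a, u a ^ 2) (p : ℕ) :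
    ∑ ε : ι → ℤˣ, trace ((signedSum Z ε * (signedSum Z ε)ᵀ) ^ p) ≤
      Fintype.card (ι → ℤˣ) * ((Fintype.card m + Fintype.card n) * (4 * p * s) ^ p) := by
  set A : ι → Matrix (m ⊕ n) (m ⊕ n) ℝ := fun i => fromBlocks 0 (Z i) (Z i)ᵀ 0 with hA
  have hsum : ∀ ε, signedSum A ε = fromBlocks 0 (signedSum Z ε) (signedSum Z ε)ᵀ 0 := by
    intro ε
    ext (a | a) (b | b) <;>
      simp [signedSum, hA, Matrix.sum_apply]
  have hAt : ∀ i, (A i)ᵀ = A i := fun i => by simp [hA, fromBlocks_transpose]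
  have hAs : ∀ v : m ⊕ n → ℝ, ∑ i, ∑ a, (A i *ᵥ v) a ^ 2 ≤ s * ∑ a, v a ^ 2 := by
    intro v
    have h : ∀ i, ∑ a, (A i *ᵥ v) a ^ 2 = (∑ a, (Z i *ᵥ (v ∘ Sum.inr)) a ^ 2)
        + ∑ b, ((Z i)ᵀ *ᵥ (v ∘ Sum.inl)) b ^ 2 := by
      intro i
      rw [Fintype.sum_sum_type]
      simp [hA, fromBlocks_mulVec]
    simp_rw [h]
    rw [Finset.sum_add_distrib, Fintype.sum_sum_type, mul_add]
    have e1 := h₁ (v ∘ Sum.inr)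
    have e2 := h₂ (v ∘ Sum.inl)
    simp only [Function.comp_apply] at e1 e2
    linarith
  have key := sum_trace_signedSum_pow_le hAt hs0 hAs p le_rfl
  rw [Fintype.card_sum] at key
  push_cast at key ⊢
  -- The trace belonging to Zᵀ Z is nonnegative and may be discarded.
  refine le_trans (Finset.sum_le_sum fun ε _ => ?_) key
  rw [hsum, trace_dilation_pow]
  have := trace_mul_transpose_pow_nonneg (signedSum Z ε)ᵀ p
  rw [transpose_transpose] at this
  linarith

end RectKhintchine

end Matrix

/-! ### Decoupling, and trace moments of `offDiag` under random signs -/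

namespace Matrix

section Decoupling
open scoped Matrix.Norms.L2Operator Kronecker
variable {ι α β : Type*} [Fintype ι] [Fintype α] [Fintype β] [DecidableEq ι] [DecidableEq α]
  [DecidableEq β]

/-- The matrix `∑ i, w i ⊗ w i` without the products of an entry with itself. -/
def offDiag {R : Type*} [CommRing R] (w : ι → α → β → R) : Matrix (α × α) (β × β) R :=
  of fun r c => ∑ i, if r.1 = r.2 ∧ c.1 = c.2 then 0 else w i r.1 c.1 * w i r.2 c.2

/-- The entries of `W` at the positions with `χ = u`; the others are replaced by `0`. -/
noncomputable def signHalf (u : ℤˣ) (χ : α × β → ℤˣ) (W : α → β → ℝ) : Matrix α β ℝ :=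
  of fun a b => if χ (a, b) = u then W a b else 0

/-- The decoupled version of `offDiag w`. -/
noncomputable def decoupled (χ : α × β → ℤˣ) (w : ι → α → β → ℝ) : Matrix (α × α) (β × β) ℝ :=
  ∑ i, signHalf 1 χ (w i) ⊗ₖ signHalf (-1) χ (w i)

theorem sum_sign_eq_zero {κ : Type*} [Fintype κ] [DecidableEq κ] (x : κ) :
    ∑ χ : κ → ℤˣ, ((χ x : ℤ) : ℝ) = 0 := by
  have h := Equiv.sum_comp (flipSign x) fun χ : κ → ℤˣ => ((χ x : ℤ) : ℝ)
  simp only [flipSign_same, Units.val_neg, Int.cast_neg, Finset.sum_neg_distrib] at h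
  linarith

theorem sum_sign_mul_sign_eq_zero {κ : Type*} [Fintype κ] [DecidableEq κ] {x y : κ} (hxy : x ≠ y) :
    ∑ χ : κ → ℤˣ, ((χ x : ℤ) : ℝ) * ((χ y : ℤ) : ℝ) = 0 := by
  have h := Equiv.sum_comp (flipSign x) fun χ : κ → ℤˣ => ((χ x : ℤ) : ℝ) * ((χ y : ℤ) : ℝ)
  simp only [flipSign_same, flipSign_of_ne hxy.symm, Units.val_neg, Int.cast_neg, neg_mul,
    Finset.sum_neg_distrib] at h
  linarith

theorem sum_ite_sign {κ : Type*} [Fintype κ] [DecidableEq κ] (x y : κ) :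
    ∑ χ : κ → ℤˣ, (if χ x = 1 then (1 : ℝ) else 0) * (if χ y = -1 then 1 else 0)
      = if x = y then 0 else (Fintype.card (κ → ℤˣ) : ℝ) / 4 := by
  have h1 : ∀ u : ℤˣ, (if u = 1 then (1 : ℝ) else 0) = (1 + ((u : ℤ) : ℝ)) / 2 := fun u => by
    rcases Int.units_eq_one_or u with rfl | rfl <;> simp
  have h2 : ∀ u : ℤˣ, (if u = -1 then (1 : ℝ) else 0) = (1 - ((u : ℤ) : ℝ)) / 2 := fun u => by
    rcases Int.units_eq_one_or u with rfl | rfl <;> norm_num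
  split_ifs with hxy
  · subst hxy
    refine Finset.sum_eq_zero fun χ _ => ?_
    rcases Int.units_eq_one_or (χ x) with h | h <;> simp [h]
  · simp_rw [h1, h2]
    have : ∀ χ : κ → ℤˣ, (1 + ((χ x : ℤ) : ℝ)) / 2 * ((1 - ((χ y : ℤ) : ℝ)) / 2)
        = 1 / 4 + 1 / 4 * ((χ x : ℤ) : ℝ) - 1 / 4 * ((χ y : ℤ) : ℝ)
          - 1 / 4 * (((χ x : ℤ) : ℝ) * ((χ y : ℤ) : ℝ)) := fun χ => by ring
    simp_rw [this, Finset.sum_sub_distrib, Finset.sum_add_distrib, ← Finset.mul_sum,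
      sum_sign_eq_zero, sum_sign_mul_sign_eq_zero hxy]
    simp [div_eq_mul_inv]

/-- A random χ sends two different positions to the two halves in the prescribed order with
probability 1/4, but never separates a position from itself. This is why self-products have to be
removed in `offDiag`. -/
theorem sum_decoupled (w : ι → α → β → ℝ) :
    ∑ χ : α × β → ℤˣ, decoupled χ w = ((Fintype.card (α × β → ℤˣ) : ℝ) / 4) • offDiag w := by
  ext ⟨a, a'⟩ ⟨b, b'⟩
  simp only [Matrix.sum_apply, decoupled, signHalf, kronecker_apply, of_apply, smul_apply, offDiag,
    smul_eq_mul]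
  rw [Finset.sum_comm, Finset.mul_sum]
  refine Finset.sum_congr rfl fun i _ => ?_
  have : ∀ χ : α × β → ℤˣ, ((if χ (a, b) = 1 then w i a b else 0)
      * if χ (a', b') = -1 then w i a' b' else 0)
      = ((if χ (a, b) = 1 then (1 : ℝ) else 0) * if χ (a', b') = -1 then 1 else 0)
        * (w i a b * w i a' b') := fun χ => by split_ifs <;> simp
  simp_rw [this]
  rw [← Finset.sum_mul, sum_ite_sign]
  simp only [Prod.mk.injEq]
  split_ifs <;> simp

/-- Triangle inequality for the average over χ, then convexity of the d-th power; the 4 is the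
inverse of the probability 1/4. -/
theorem norm_offDiag_pow_le (w : ι → α → β → ℝ) {d : ℕ} (hd : d ≠ 0) :
    Fintype.card (α × β → ℤˣ) * ‖offDiag w‖ ^ d ≤ 4 ^ d * ∑ χ : α × β → ℤˣ, ‖decoupled χ w‖ ^ d := by
  obtain ⟨d, rfl⟩ := Nat.exists_eq_succ_of_ne_zero hd
  set c : ℝ := (Fintype.card (α × β → ℤˣ) : ℝ) with hc
  have hc0 : 0 < c := by rw [hc]; exact_mod_cast Fintype.card_pos
  have h1 : c / 4 * ‖offDiag w‖ ≤ ∑ χ : α × β → ℤˣ, ‖decoupled χ w‖ := by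
    have := norm_sum_le Finset.univ fun χ : α × β → ℤˣ => decoupled χ w
    rw [sum_decoupled, norm_smul, Real.norm_of_nonneg (by positivity)] at this
    exact this
  have h2 := pow_sum_div_card_le_sum_pow (s := Finset.univ)
    (f := fun χ : α × β → ℤˣ => ‖decoupled χ w‖) (fun _ _ => norm_nonneg _) d
  rw [Finset.card_univ, ← hc] at h2
  have h3 : (c / 4 * ‖offDiag w‖) ^ (d + 1) / c ^ d ≤ ∑ χ : α × β → ℤˣ, ‖decoupled χ w‖ ^ (d + 1) :=
    le_trans (by gcongr) h2
  calc c * ‖offDiag w‖ ^ (d + 1)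
      = 4 ^ (d + 1) * ((c / 4 * ‖offDiag w‖) ^ (d + 1) / c ^ d) := by
        rw [mul_pow, div_pow, pow_succ c]; field_simp
    _ ≤ _ := by gcongr

/-- Convexity is used for the norm, so the trace is replaced by the norm and back. This costs the
dimension (card α)², which is harmless after taking roots of order 2^L. -/
theorem trace_offDiag_pow_le (w : ι → α → β → ℝ) (L : ℕ) :
    (Fintype.card (α × β → ℤˣ) : ℝ) * trace ((offDiag w * (offDiag w)ᵀ) ^ 2 ^ L) ≤
      (Fintype.card α : ℝ) ^ 2 * 16 ^ 2 ^ L *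
        ∑ χ : α × β → ℤˣ, trace ((decoupled χ w * (decoupled χ w)ᵀ) ^ 2 ^ L) := by
  have h1 := trace_pow_le (offDiag w) L
  have h2 := norm_offDiag_pow_le w (d := 2 * 2 ^ L) (by positivity)
  have h3 : ∑ χ : α × β → ℤˣ, ‖decoupled χ w‖ ^ (2 * 2 ^ L)
      ≤ ∑ χ : α × β → ℤˣ, trace ((decoupled χ w * (decoupled χ w)ᵀ) ^ 2 ^ L) :=
    Finset.sum_le_sum fun χ _ => norm_pow_le_trace _ L
  rw [Fintype.card_prod, Nat.cast_mul] at h1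
  rw [show (4 : ℝ) ^ (2 * 2 ^ L) = 16 ^ 2 ^ L by rw [pow_mul]; norm_num] at h2
  calc (Fintype.card (α × β → ℤˣ) : ℝ) * trace ((offDiag w * (offDiag w)ᵀ) ^ 2 ^ L)
      ≤ Fintype.card (α × β → ℤˣ)
          * (Fintype.card α * Fintype.card α * ‖offDiag w‖ ^ (2 * 2 ^ L)) := by gcongr
    _ = Fintype.card α ^ 2 * (Fintype.card (α × β → ℤˣ) * ‖offDiag w‖ ^ (2 * 2 ^ L)) := by ring
    _ ≤ Fintype.card α ^ 2 * (16 ^ 2 ^ L *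
        ∑ χ : α × β → ℤˣ, trace ((decoupled χ w * (decoupled χ w)ᵀ) ^ 2 ^ L)) := by
        exact mul_le_mul_of_nonneg_left
          (h2.trans (mul_le_mul_of_nonneg_left h3 (by positivity))) (by positivity)
    _ = _ := by ring

/-- The array `w` with the signs of its entries changed by `ε`. -/
def applySigns (ε : ι × α × β → ℤˣ) (w : ι → α → β → ℝ) : ι → α → β → ℝ :=
  fun i a b => ((ε (i, a, b) : ℤ) : ℝ) * w i a b

theorem applySigns_sq (ε : ι × α × β → ℤˣ) (w : ι → α → β → ℝ) (i : ι) (a : α) (b : β) :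
    applySigns ε w i a b ^ 2 = w i a b ^ 2 := by
  rw [applySigns, mul_pow, sq (((ε (i, a, b) : ℤˣ) : ℤ) : ℝ), units_int_cast_mul_self, one_mul]

/-- The coefficients of the signs of the first factor in `decoupled`. -/
noncomputable def kronHalves (χ : α × β → ℤˣ) (w : ι → α → β → ℝ) (i : ι) :
    Matrix (α × α) (β × β) ℝ :=
  signHalf 1 χ (w i) ⊗ₖ signHalf (-1) χ (w i)

/-- After decoupling, only the first tensor factor sees the entries with χ = 1. Multiplying these
entries in slice i by η_i therefore multiplies the whole i-th summand by η_i. -/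
theorem decoupled_applySigns_mul (χ : α × β → ℤˣ) (w : ι → α → β → ℝ) (η : ι → ℤˣ)
    (ε : ι × α × β → ℤˣ) :
    decoupled χ (applySigns ((fun x => if χ x.2 = 1 then η x.1 else 1) * ε) w)
      = signedSum (kronHalves χ (applySigns ε w)) η := by
  ext ⟨a, a'⟩ ⟨b, b'⟩
  simp only [decoupled, signedSum, Matrix.sum_apply, kronHalves, kronecker_apply, signHalf,
    of_apply, smul_apply, smul_eq_mul, applySigns, Pi.mul_apply]
  refine Finset.sum_congr rfl fun i _ => ?_
  by_cases h1 : χ (a, b) = 1 <;> by_cases h2 : χ (a', b') = -1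
  · have h3 : (-1 : ℤˣ) ≠ 1 := by decide
    simp [h1, h2, h3]; ring
  all_goals simp [h1, h2]

theorem sum_trace_offDiag_le {w : ι → α → β → ℝ} {L : ℕ} {B : ℝ}
    (h : ∀ χ : α × β → ℤˣ, ∑ ε : ι × α × β → ℤˣ, trace ((decoupled χ (applySigns ε w)
        * (decoupled χ (applySigns ε w))ᵀ) ^ 2 ^ L) ≤ B) :
    ∑ ε : ι × α × β → ℤˣ, trace ((offDiag (applySigns ε w) * (offDiag (applySigns ε w))ᵀ) ^ 2 ^ L)
      ≤ (Fintype.card α : ℝ) ^ 2 * 16 ^ 2 ^ L * B := by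
  have hc : (0 : ℝ) < Fintype.card (α × β → ℤˣ) := by exact_mod_cast Fintype.card_pos
  refine le_of_mul_le_mul_left ?_ hc
  rw [Finset.mul_sum]
  refine (Finset.sum_le_sum fun ε _ => trace_offDiag_pow_le (applySigns ε w) L).trans ?_
  rw [← Finset.mul_sum, Finset.sum_comm]
  calc _ ≤ (Fintype.card α : ℝ) ^ 2 * 16 ^ 2 ^ L * ∑ χ : α × β → ℤˣ, B := by
        gcongr with χ
        exact h χ
    _ = _ := by
      rw [Finset.sum_const, nsmul_eq_mul, Finset.card_univ]; ring

/-- Averaging over all signs, `decoupled` may be replaced by Rademacher sums. -/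
theorem sum_trace_decoupled_le (χ : α × β → ℤˣ) (w : ι → α → β → ℝ) (p : ℕ)
    (s : (ι × α × β → ℤˣ) → ℝ) (hs0 : ∀ ε, 0 ≤ s ε)
    (h₁ : ∀ ε (v : β × β → ℝ), ∑ i, ∑ r, (kronHalves χ (applySigns ε w) i *ᵥ v) r ^ 2
      ≤ s ε * ∑ c, v c ^ 2)
    (h₂ : ∀ ε (u : α × α → ℝ), ∑ i, ∑ c, ((kronHalves χ (applySigns ε w) i)ᵀ *ᵥ u) c ^ 2
      ≤ s ε * ∑ r, u r ^ 2) :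
    ∑ ε : ι × α × β → ℤˣ, trace ((decoupled χ (applySigns ε w)
        * (decoupled χ (applySigns ε w))ᵀ) ^ p) ≤
      ∑ ε, (Fintype.card α ^ 2 + Fintype.card β ^ 2) * (4 * p * s ε) ^ p := by
  set F : (ι × α × β → ℤˣ) → ℝ := fun ε => trace ((decoupled χ (applySigns ε w)
        * (decoupled χ (applySigns ε w))ᵀ) ^ p) with hF
  -- Multiplication by the signs η on one half permutes the arrays ε, so the extra average over η is
  -- free.
  have h3 : ∀ η : ι → ℤˣ, ∑ ε, F ε
      = ∑ ε, F ((fun x => if χ x.2 = 1 then η x.1 else 1) * ε) := fun η =>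
    (Equiv.sum_comp (Equiv.mulLeft (fun x : ι × α × β => if χ x.2 = 1 then η x.1 else 1)) F).symm
  have h4 : Fintype.card (ι → ℤˣ) * ∑ ε, F ε
      = ∑ ε, ∑ η : ι → ℤˣ, F ((fun x => if χ x.2 = 1 then η x.1 else 1) * ε) := by
    rw [Finset.sum_comm, ← Finset.sum_congr rfl fun η _ => h3 η]
    simp
  have hc : (0 : ℝ) < Fintype.card (ι → ℤˣ) := by exact_mod_cast Fintype.card_pos
  refine le_of_mul_le_mul_left ?_ hc
  rw [h4, Finset.mul_sum]
  refine Finset.sum_le_sum fun ε _ => ?_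
  simp only [hF, decoupled_applySigns_mul]
  have := sum_trace_signedSum_mul_transpose_pow_le _ (hs0 ε) (h₁ ε) (h₂ ε) p
  rw [Fintype.card_prod, Fintype.card_prod] at this
  push_cast at this ⊢
  rw [sq, sq]
  exact this

theorem norm_sq_kronecker_le (A B : Matrix α β ℝ) : ‖A ⊗ₖ B‖ ^ 2 ≤ ‖A‖ ^ 2 * ‖B‖ ^ 2 := by
  refine norm_sq_le_of_sum_mulVec_sq_le (by positivity) fun v => ?_
  have h1 : ∀ a a', ((A ⊗ₖ B) *ᵥ v) (a, a') = (A *ᵥ fun b => (B *ᵥ fun b' => v (b, b')) a') a := by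
    intro a a'
    simp only [mulVec, dotProduct, kronecker_apply, Fintype.sum_prod_type, Finset.mul_sum, mul_assoc]
  rw [Fintype.sum_prod_type, Finset.sum_comm]
  simp_rw [h1]
  calc _ ≤ ∑ a', ‖A‖ ^ 2 * ∑ b, (B *ᵥ fun b' => v (b, b')) a' ^ 2 :=
        Finset.sum_le_sum fun a' _ => sum_mulVec_sq_le A _
    _ = ‖A‖ ^ 2 * ∑ b, ∑ a', (B *ᵥ fun b' => v (b, b')) a' ^ 2 := by
        rw [← Finset.mul_sum, Finset.sum_comm]
    _ ≤ ‖A‖ ^ 2 * ∑ b, ‖B‖ ^ 2 * ∑ b', v (b, b') ^ 2 := by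
        gcongr with b
        exact sum_mulVec_sq_le B _
    _ = _ := by rw [← Finset.mul_sum, Fintype.sum_prod_type, mul_assoc]

/-- A single half is itself a Rademacher sum, with multiples of matrix units as coefficients. Its
variance parameter is then the largest row or column sum of squares; positions in other slices get
the coefficient 0. -/
theorem signHalf_applySigns_eq (u : ℤˣ) (χ : α × β → ℤˣ) (w : ι → α → β → ℝ) (i : ι)
    (ε : ι × α × β → ℤˣ) :
    signHalf u χ (applySigns ε w i) = signedSum (fun x : ι × α × β =>
      if x.1 = i then single x.2.1 x.2.2 (signHalf u χ (w i) x.2.1 x.2.2) else 0) ε := by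
  ext a b
  simp only [signedSum, Matrix.sum_apply, smul_apply, smul_eq_mul]
  rw [Finset.sum_eq_single (i, a, b)]
  · simp [signHalf, applySigns]
  · rintro ⟨i', a', b'⟩ _ hne
    by_cases hi : i' = i
    · subst hi
      have : ¬(a' = a ∧ b' = b) := by rintro ⟨rfl, rfl⟩; exact hne rfl
      simp [this]
    · simp [hi]
  · simp

theorem signHalf_sq_le (u : ℤˣ) (χ : α × β → ℤˣ) (W : α → β → ℝ) (a : α) (b : β) :
    signHalf u χ W a b ^ 2 ≤ W a b ^ 2 := by
  simp only [signHalf, of_apply]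
  split_ifs
  · exact le_rfl
  · simp [sq_nonneg]

theorem sum_norm_signHalf_pow_le (u : ℤˣ) (χ : α × β → ℤˣ) {w : ι → α → β → ℝ} {D : ℝ}
    (hD0 : 0 ≤ D) (h₁ : ∀ i a, ∑ b, w i a b ^ 2 ≤ D) (h₂ : ∀ i b, ∑ a, w i a b ^ 2 ≤ D) (i : ι)
    (L : ℕ) :
    ∑ ε : ι × α × β → ℤˣ, ‖signHalf u χ (applySigns ε w i)‖ ^ (2 * 2 ^ L) ≤
      Fintype.card (ι × α × β → ℤˣ) *
        ((Fintype.card α + Fintype.card β) * (4 * 2 ^ L * D) ^ 2 ^ L) := by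
  refine (Finset.sum_le_sum fun ε _ => norm_pow_le_trace _ L).trans ?_
  simp_rw [signHalf_applySigns_eq]
  have key := sum_trace_signedSum_mul_transpose_pow_le (fun x : ι × α × β =>
      if x.1 = i then single x.2.1 x.2.2 (signHalf u χ (w i) x.2.1 x.2.2) else 0) hD0 ?_ ?_ (2 ^ L)
  · push_cast at key
    exact key
  · intro v
    have : ∀ x : ι × α × β, ∑ a, ((if x.1 = i then
        single x.2.1 x.2.2 (signHalf u χ (w i) x.2.1 x.2.2) else 0 : Matrix α β ℝ) *ᵥ v) a ^ 2
        = if x.1 = i then signHalf u χ (w i) x.2.1 x.2.2 ^ 2 * v x.2.2 ^ 2 else 0 := by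
      rintro ⟨i', a, b⟩
      split_ifs
      · simp only [single_mulVec]
        rw [Finset.sum_eq_single a] <;> simp +contextual [mul_pow]
      · simp
    simp_rw [this]
    rw [Fintype.sum_prod_type, Finset.sum_eq_single i (by simp +contextual) (by simp),
      Fintype.sum_prod_type, Finset.sum_comm, Finset.mul_sum]
    refine Finset.sum_le_sum fun b _ => ?_
    simp only [if_true]
    rw [← Finset.sum_mul]
    gcongr
    exact (Finset.sum_le_sum fun a _ => signHalf_sq_le u χ (w i) a b).trans (h₂ i b)
  · intro v
    have : ∀ x : ι × α × β, ∑ a, ((if x.1 = i then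
        single x.2.1 x.2.2 (signHalf u χ (w i) x.2.1 x.2.2) else 0 : Matrix α β ℝ)ᵀ *ᵥ v) a ^ 2
        = if x.1 = i then signHalf u χ (w i) x.2.1 x.2.2 ^ 2 * v x.2.1 ^ 2 else 0 := by
      rintro ⟨i', a, b⟩
      split_ifs
      · simp only [transpose_single, single_mulVec]
        rw [Finset.sum_eq_single b] <;> simp +contextual [mul_pow]
      · simp
    simp_rw [this]
    rw [Fintype.sum_prod_type, Finset.sum_eq_single i (by simp +contextual) (by simp),
      Fintype.sum_prod_type, Finset.mul_sum]
    refine Finset.sum_le_sum fun a _ => ?_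
    simp only [if_true]
    rw [← Finset.sum_mul]
    gcongr
    exact (Finset.sum_le_sum fun b _ => signHalf_sq_le u χ (w i) a b).trans (h₁ i a)

/-- Trace moment of `offDiag` from bounds on the row and column sums of squares. -/
theorem sum_trace_offDiag_le_of_degree {w : ι → α → β → ℝ} {D : ℝ}
    (hD0 : 0 ≤ D) (h₁ : ∀ i a, ∑ b, w i a b ^ 2 ≤ D) (h₂ : ∀ i b, ∑ a, w i a b ^ 2 ≤ D) (L : ℕ) :
    ∑ ε : ι × α × β → ℤˣ, trace ((offDiag (applySigns ε w) * (offDiag (applySigns ε w))ᵀ) ^ 2 ^ L)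
      ≤ Fintype.card (ι × α × β → ℤˣ) *
        (Fintype.card α ^ 2 * (Fintype.card α ^ 2 + Fintype.card β ^ 2) *
          (Fintype.card α + Fintype.card β) *
          (4096 * Fintype.card ι * (2 ^ L) ^ 3 * D ^ 2) ^ 2 ^ L) := by
  set q : ℝ := (Fintype.card ι : ℝ) with hq
  set c : ℝ := (Fintype.card (ι × α × β → ℤˣ) : ℝ) with hc
  set P : ℝ := (Fintype.card α : ℝ) + Fintype.card β with hP
  set l : ℝ := 2 ^ L with hl
  have hdec : ∀ χ : α × β → ℤˣ, ∑ ε : ι × α × β → ℤˣ, trace ((decoupled χ (applySigns ε w)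
        * (decoupled χ (applySigns ε w))ᵀ) ^ 2 ^ L)
      ≤ (Fintype.card α ^ 2 + Fintype.card β ^ 2) * (4 * l) ^ 2 ^ L *
        (q ^ 2 ^ L * (c * (P * (4 * 2 ^ (L + 1) * D) ^ 2 ^ (L + 1)))) := by
    intro χ
    set f : ℤˣ → (ι × α × β → ℤˣ) → ι → ℝ :=
      fun u ε i => ‖signHalf u χ (applySigns ε w i)‖ ^ 2 with hf
    have hnorm : ∀ ε i, ‖kronHalves χ (applySigns ε w) i‖ ^ 2 ≤ f 1 ε i * f (-1) ε i := fun ε i =>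
      norm_sq_kronecker_le _ _
    -- By AM–GM the product of the two norms is replaced by separate moments of twice the order;
    -- hence L + 1 below.
    have hpow : ∀ ε i, (f 1 ε i * f (-1) ε i) ^ 2 ^ L ≤
        (‖signHalf 1 χ (applySigns ε w i)‖ ^ (2 * 2 ^ (L + 1)) +
          ‖signHalf (-1) χ (applySigns ε w i)‖ ^ (2 * 2 ^ (L + 1))) / 2 := fun ε i => by
      have e : ∀ x : ℝ, x ^ (2 * 2 ^ (L + 1)) = ((x ^ 2) ^ 2 ^ L) ^ 2 := fun x => by
        rw [← pow_mul, ← pow_mul]; ring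
      rw [e, e, mul_pow]
      have := two_mul_le_add_sq ((‖signHalf 1 χ (applySigns ε w i)‖ ^ 2) ^ 2 ^ L)
        ((‖signHalf (-1) χ (applySigns ε w i)‖ ^ 2) ^ 2 ^ L)
      simp only [hf]
      linarith
    refine (sum_trace_decoupled_le χ w (2 ^ L) (fun ε => ∑ i, f 1 ε i * f (-1) ε i)
      (fun ε => by positivity) ?_ ?_).trans ?_
    · intro ε v
      rw [Finset.sum_mul]
      refine Finset.sum_le_sum fun i _ => (sum_mulVec_sq_le _ v).trans ?_
      gcongr
      exact hnorm ε i
    · intro ε v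
      rw [Finset.sum_mul]
      refine Finset.sum_le_sum fun i _ => (sum_mulVec_sq_le _ v).trans ?_
      rw [norm_transpose_eq]
      gcongr
      exact hnorm ε i
    -- The power mean inequality over the slices: the number q of slices enters to the power 2^L,
    -- that is, once per unit of the exponent.
    · have hmean : ∀ ε, (∑ i, f 1 ε i * f (-1) ε i) ^ 2 ^ L
          ≤ q ^ (2 ^ L - 1) * ∑ i, (f 1 ε i * f (-1) ε i) ^ 2 ^ L := fun ε => by
        obtain ⟨d, hd⟩ := Nat.exists_eq_succ_of_ne_zero (Nat.two_pow_pos L).ne'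
        rw [hd, Nat.succ_sub_one]
        have := pow_sum_le_card_mul_sum_pow (s := Finset.univ) (f := fun i => f 1 ε i * f (-1) ε i)
          (fun i _ => by positivity) d
        rwa [Finset.card_univ] at this
      have hsum : ∑ ε, (∑ i, f 1 ε i * f (-1) ε i) ^ 2 ^ L
          ≤ q ^ 2 ^ L * (c * (P * (4 * 2 ^ (L + 1) * D) ^ 2 ^ (L + 1))) := by
        calc ∑ ε, (∑ i, f 1 ε i * f (-1) ε i) ^ 2 ^ L
            ≤ ∑ ε, q ^ (2 ^ L - 1) * ∑ i,
              (‖signHalf 1 χ (applySigns ε w i)‖ ^ (2 * 2 ^ (L + 1)) +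
                ‖signHalf (-1) χ (applySigns ε w i)‖ ^ (2 * 2 ^ (L + 1))) / 2 := by
              refine Finset.sum_le_sum fun ε _ => (hmean ε).trans ?_
              gcongr with i
              exact hpow ε i
          _ = q ^ (2 ^ L - 1) * ∑ i,
              ((∑ ε, ‖signHalf 1 χ (applySigns ε w i)‖ ^ (2 * 2 ^ (L + 1))) +
                ∑ ε, ‖signHalf (-1) χ (applySigns ε w i)‖ ^ (2 * 2 ^ (L + 1))) / 2 := by
              rw [← Finset.mul_sum, Finset.sum_comm]
              simp_rw [← Finset.sum_div, Finset.sum_add_distrib]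
          _ ≤ q ^ (2 ^ L - 1) * ∑ i : ι, (c * (P * (4 * 2 ^ (L + 1) * D) ^ 2 ^ (L + 1))) := by
              gcongr with i
              have e1 := sum_norm_signHalf_pow_le 1 χ hD0 h₁ h₂ i (L + 1)
              have e2 := sum_norm_signHalf_pow_le (-1) χ hD0 h₁ h₂ i (L + 1)
              linarith
          _ = _ := by
              rw [Finset.sum_const, nsmul_eq_mul, Finset.card_univ, ← hq, ← mul_assoc, ← pow_succ,
                Nat.sub_add_cancel (Nat.two_pow_pos L)]
      simp_rw [mul_pow _ (∑ i, _)]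
      rw [← Finset.mul_sum, ← Finset.mul_sum, ← mul_assoc]
      push_cast
      gcongr
  refine (sum_trace_offDiag_le hdec).trans (le_of_eq ?_)
  have e : (4 * 2 ^ (L + 1) * D) ^ 2 ^ (L + 1) = (64 * l ^ 2 * D ^ 2) ^ 2 ^ L := by
    rw [show 2 ^ (L + 1) = 2 * 2 ^ L from pow_succ' 2 L, pow_mul, show (2 : ℝ) ^ (L + 1) = 2 * l from
      pow_succ' 2 L]
    ring
  rw [e, show 4096 * q * l ^ 3 * D ^ 2 = 16 * (4 * l) * q * (64 * l ^ 2 * D ^ 2) by ring,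
    mul_pow _ (64 * l ^ 2 * D ^ 2), mul_pow _ q, mul_pow _ (4 * l)]
  ring

/-- Cauchy–Schwarz with the number of non-zero coefficients. -/
theorem sq_sum_mul_le {κ : Type*} [Fintype κ] {c v e : κ → ℝ} (he : ∀ x, 0 ≤ e x)
    (hc : ∀ x, c x = 0 ∨ 1 ≤ e x) :
    (∑ x, c x * v x) ^ 2 ≤ (∑ x, e x) * ∑ x, c x ^ 2 * v x ^ 2 := by
  classical
  have h1 : ∀ x, c x * v x = (if c x = 0 then 0 else 1) * (c x * v x) := fun x => by
    split_ifs with h <;> simp [h]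
  rw [Finset.sum_congr rfl fun x _ => h1 x]
  refine (Finset.sum_mul_sq_le_sq_mul_sq _ _ _).trans ?_
  have h2 : ∑ x, (if c x = 0 then (0 : ℝ) else 1) ^ 2 ≤ ∑ x, e x :=
    Finset.sum_le_sum fun x _ => by
      rcases hc x with h | h
      · simp [h, he]
      · split_ifs <;> simp [he, h]
  simp_rw [mul_pow (c _)]
  exact mul_le_mul_of_nonneg_right h2 (Finset.sum_nonneg fun x _ => by positivity)

/-- Nonzero entries have square at least 1, so sums of squares bound the number of nonzero entries.
Cauchy–Schwarz in each row gives the factor D², and K bounds what a single column collects over all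
slices and rows. -/
theorem sum_kronHalves_mulVec_sq_le (χ : α × β → ℤˣ) {w : ι → α → β → ℝ} {D K : ℝ}
    (hw : ∀ i a b, w i a b = 0 ∨ 1 ≤ w i a b ^ 2)
    (hD0 : 0 ≤ D) (h₁ : ∀ i a, ∑ b, w i a b ^ 2 ≤ D)
    (hK : ∀ b b', ∑ i, ∑ a, ∑ a', (if a = a' ∧ b = b' then 0 else w i a b ^ 2 * w i a' b' ^ 2) ≤ K)
    (v : β × β → ℝ) :
    ∑ i, ∑ r, (kronHalves χ w i *ᵥ v) r ^ 2 ≤ D ^ 2 * K * ∑ c, v c ^ 2 := by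
  -- The halves are disjoint, so the entry vanishes when both factors come from the same position.
  have hsq : ∀ i a a' b b', (kronHalves χ w i (a, a') (b, b')) ^ 2
      ≤ if a = a' ∧ b = b' then 0 else w i a b ^ 2 * w i a' b' ^ 2 := by
    intro i a a' b b'
    simp only [kronHalves, kronecker_apply, mul_pow]
    split_ifs with h
    · obtain ⟨rfl, rfl⟩ := h
      simp only [signHalf, of_apply]
      rcases Int.units_eq_one_or (χ (a, b)) with h | h
      · have : (1 : ℤˣ) ≠ -1 := by decide
        simp [h, this]
      · have : (-1 : ℤˣ) ≠ 1 := by decide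
        simp [h, this]
    · exact mul_le_mul (signHalf_sq_le ..) (signHalf_sq_le ..) (sq_nonneg _) (sq_nonneg _)
  -- At most D² entries of the row (a, a') are nonzero: their number is bounded by the product of
  -- the row sums for a and a'.
  have hrow : ∀ i a a', (kronHalves χ w i *ᵥ v) (a, a') ^ 2
      ≤ D ^ 2 * ∑ b, ∑ b', (if a = a' ∧ b = b' then 0 else w i a b ^ 2 * w i a' b' ^ 2)
          * v (b, b') ^ 2 := by
    intro i a a'
    have h := sq_sum_mul_le (c := fun c : β × β => kronHalves χ w i (a, a') c) (v := v)
      (e := fun c => w i a c.1 ^ 2 * w i a' c.2 ^ 2) (fun c => by positivity) (fun c => by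
        simp only [kronHalves, signHalf]
        rcases hw i a c.1 with h | h
        · left; simp [h]
        · rcases hw i a' c.2 with h' | h'
          · left; simp [h']
          · right; nlinarith)
    refine h.trans ?_
    have h3 : ∑ c : β × β, w i a c.1 ^ 2 * w i a' c.2 ^ 2 ≤ D ^ 2 := by
      rw [Fintype.sum_prod_type]
      simp_rw [← Finset.mul_sum]
      rw [← Finset.sum_mul, sq]
      exact mul_le_mul (h₁ i a) (h₁ i a') (by positivity) hD0
    refine mul_le_mul h3 ?_ (by positivity) (by positivity)
    rw [Fintype.sum_prod_type]
    gcongr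
    exact hsq ..
  calc ∑ i, ∑ r, (kronHalves χ w i *ᵥ v) r ^ 2
      ≤ ∑ i, ∑ r : α × α, D ^ 2 * ∑ b, ∑ b',
          (if r.1 = r.2 ∧ b = b' then 0 else w i r.1 b ^ 2 * w i r.2 b' ^ 2) * v (b, b') ^ 2 :=
        Finset.sum_le_sum fun i _ => Finset.sum_le_sum fun r _ => hrow i r.1 r.2
    _ = D ^ 2 * ∑ b, ∑ b', (∑ i, ∑ a, ∑ a',
          (if a = a' ∧ b = b' then 0 else w i a b ^ 2 * w i a' b' ^ 2)) * v (b, b') ^ 2 := by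
        simp_rw [← Finset.mul_sum]
        congr 1
        simp_rw [Finset.sum_mul, Fintype.sum_prod_type]
        rw [Finset.sum_congr rfl fun i _ => Finset.sum_congr rfl fun a _ =>
          Finset.sum_comm' (t' := Finset.univ) (s' := fun _ => Finset.univ) (by simp)]
        rw [Finset.sum_congr rfl fun i _ => Finset.sum_comm]
        rw [Finset.sum_comm]
        refine Finset.sum_congr rfl fun b _ => ?_
        rw [Finset.sum_congr rfl fun i _ => Finset.sum_congr rfl fun a _ => Finset.sum_comm]
        rw [Finset.sum_congr rfl fun i _ => Finset.sum_comm]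
        rw [Finset.sum_comm]
    _ ≤ D ^ 2 * ∑ b, ∑ b', K * v (b, b') ^ 2 := by
        gcongr
        exact hK ..
    _ = _ := by
        simp_rw [← Finset.mul_sum, Fintype.sum_prod_type]; ring

theorem kronHalves_transpose (χ : α × β → ℤˣ) (w : ι → α → β → ℝ) (i : ι) :
    (kronHalves χ w i)ᵀ = kronHalves (χ ∘ Prod.swap) (fun i b a => w i a b) i := by
  ext ⟨b, b'⟩ ⟨a, a'⟩
  simp [kronHalves, signHalf]

/-- Trace moment of `offDiag` for sparse arrays. -/
theorem sum_trace_offDiag_le_of_sparse {w : ι → α → β → ℝ} {D K : ℝ}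
    (hw : ∀ i a b, w i a b = 0 ∨ 1 ≤ w i a b ^ 2)
    (hD0 : 0 ≤ D) (h₁ : ∀ i a, ∑ b, w i a b ^ 2 ≤ D) (h₂ : ∀ i b, ∑ a, w i a b ^ 2 ≤ D)
    (hK0 : 0 ≤ K)
    (hK₁ : ∀ b b', ∑ i, ∑ a, ∑ a', (if a = a' ∧ b = b' then 0 else w i a b ^ 2 * w i a' b' ^ 2) ≤ K)
    (hK₂ : ∀ a a', ∑ i, ∑ b, ∑ b', (if a = a' ∧ b = b' then 0 else w i a b ^ 2 * w i a' b' ^ 2) ≤ K)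
    (L : ℕ) :
    ∑ ε : ι × α × β → ℤˣ, trace ((offDiag (applySigns ε w) * (offDiag (applySigns ε w))ᵀ) ^ 2 ^ L)
      ≤ Fintype.card (ι × α × β → ℤˣ) *
        (Fintype.card α ^ 2 * (Fintype.card α ^ 2 + Fintype.card β ^ 2) *
          (64 * 2 ^ L * D ^ 2 * K) ^ 2 ^ L) := by
  have hdec : ∀ χ : α × β → ℤˣ, ∑ ε : ι × α × β → ℤˣ, trace ((decoupled χ (applySigns ε w)
        * (decoupled χ (applySigns ε w))ᵀ) ^ 2 ^ L)
      ≤ ∑ ε : ι × α × β → ℤˣ, (Fintype.card α ^ 2 + Fintype.card β ^ 2) *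
        (4 * (2 ^ L : ℕ) * (D ^ 2 * K)) ^ 2 ^ L := by
    intro χ
    have hw' : ∀ (ε : ι × α × β → ℤˣ) i a b, applySigns ε w i a b = 0 ∨
        1 ≤ applySigns ε w i a b ^ 2 := fun ε i a b => by
      rw [applySigns_sq]
      refine (hw i a b).imp (fun h => ?_) id
      rw [applySigns, h, mul_zero]
    refine sum_trace_decoupled_le χ w (2 ^ L) (fun ε => D ^ 2 * K) (fun ε => by positivity) ?_ ?_
    · intro ε v
      refine sum_kronHalves_mulVec_sq_le χ (hw' ε) hD0 ?_ ?_ v <;> simp_rw [applySigns_sq] <;>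
        assumption
    · intro ε v
      simp_rw [kronHalves_transpose]
      refine sum_kronHalves_mulVec_sq_le _ (fun i a b => hw' ε i b a) hD0 ?_ ?_ v <;>
        simp_rw [applySigns_sq]
      · exact h₂
      · simpa only [and_comm] using hK₂
  refine (sum_trace_offDiag_le hdec).trans (le_of_eq ?_)
  rw [Finset.sum_const, nsmul_eq_mul, Finset.card_univ,
    show 64 * 2 ^ L * D ^ 2 * K = 16 * (4 * 2 ^ L * (D ^ 2 * K)) by ring, mul_pow 16]
  push_cast
  ring

end Decoupling

end Matrix

/-! ### Bit lengths, costs and loops of the random access machine -/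

namespace RAM

theorem bitLength_le_succ_iff {z : ℤ} {b : ℕ} : bitLength z ≤ b + 1 ↔ z.natAbs < 2 ^ b := by
  rw [bitLength, Nat.add_le_add_iff_right, Nat.size_le]

theorem one_le_bitLength (z : ℤ) : 1 ≤ bitLength z := Nat.le_add_left _ _

theorem natAbs_lt_two_pow (z : ℤ) : z.natAbs < 2 ^ (bitLength z - 1) :=
  bitLength_le_succ_iff.1 (by have := one_le_bitLength z; omega)

theorem bitLength_mono {x y : ℤ} (h : x.natAbs ≤ y.natAbs) : bitLength x ≤ bitLength y :=
  Nat.add_le_add_right (Nat.size_le_size h) 1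

/-- Two extra bits: one for the sign, one because |z| may be equal to 2 ^ b. -/
theorem bitLength_le_of_abs_le {z : ℤ} {b : ℕ} (h : |z| ≤ 2 ^ b) : bitLength z ≤ b + 2 := by
  rw [bitLength_le_succ_iff, pow_succ]
  have h1 : (z.natAbs : ℤ) ≤ 2 ^ b := by rwa [Int.natCast_natAbs]
  have h2 : z.natAbs ≤ 2 ^ b := by exact_mod_cast h1
  have := Nat.two_pow_pos b
  omega

theorem bitLength_add_le (x y : ℤ) : bitLength (x + y) ≤ bitLength x + bitLength y := by
  have hx := natAbs_lt_two_pow x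
  have hy := natAbs_lt_two_pow y
  have hx1 := one_le_bitLength x
  have hy1 := one_le_bitLength y
  obtain ⟨a, ha⟩ := Nat.exists_eq_add_of_le' hx1
  obtain ⟨b, hb⟩ := Nat.exists_eq_add_of_le' hy1
  rw [ha, Nat.add_sub_cancel] at hx
  rw [hb, Nat.add_sub_cancel] at hy
  rw [ha, hb]
  rw [show a + 1 + (b + 1) = a + b + 1 + 1 by ring, bitLength_le_succ_iff]
  have h1 : 2 ^ a ≤ 2 ^ (a + b) := Nat.pow_le_pow_right (by norm_num) (by omega)
  have h2 : 2 ^ b ≤ 2 ^ (a + b) := Nat.pow_le_pow_right (by norm_num) (by omega)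
  have := Int.natAbs_add_le x y
  rw [pow_succ]
  omega

theorem bitLength_neg (x : ℤ) : bitLength (-x) = bitLength x := by simp [bitLength]

theorem bitLength_sub_le (x y : ℤ) : bitLength (x - y) ≤ bitLength x + bitLength y := by
  rw [sub_eq_add_neg, ← bitLength_neg y]; exact bitLength_add_le _ _

theorem bitLength_mul_le (x y : ℤ) : bitLength (x * y) ≤ bitLength x + bitLength y := by
  have hx := natAbs_lt_two_pow x
  have hy := natAbs_lt_two_pow y
  have hx1 := one_le_bitLength x
  have hy1 := one_le_bitLength y
  obtain ⟨a, ha⟩ := Nat.exists_eq_add_of_le' hx1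
  obtain ⟨b, hb⟩ := Nat.exists_eq_add_of_le' hy1
  rw [ha, Nat.add_sub_cancel] at hx
  rw [hb, Nat.add_sub_cancel] at hy
  rw [ha, hb]
  refine le_trans (b := a + b + 1) ?_ (by omega)
  rw [bitLength_le_succ_iff, Int.natAbs_mul, pow_add]
  exact Nat.mul_lt_mul'' hx hy

theorem bitLength_div_le (x y : ℤ) : bitLength (x / y) ≤ bitLength x :=
  bitLength_mono (Int.natAbs_ediv_le_natAbs x y)

/-- The size of an expression, with literals counted by their bit length. -/
def Expr.weight : Expr → ℕ
  | .lit z => bitLength z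
  | .get _ i => i.weight + 1
  | .add e f => e.weight + f.weight + 1
  | .sub e f => e.weight + f.weight + 1
  | .mul e f => e.weight + f.weight + 1
  | .div e f => e.weight + f.weight + 1

/-- The size of a program. -/
def Program.weight : Program → ℕ
  | .skip => 1
  | .set _ i e => i.weight + e.weight + 1
  | .seq c d => c.weight + d.weight + 1
  | .ite e c d => e.weight + c.weight + d.weight + 1
  | .while e c => e.weight + c.weight + 1

/-- All cells of the memory contain integers with at most `B` bits. -/
def Memory.Bits (s : Memory) (B : ℕ) : Prop := ∀ a i, bitLength (s a i) ≤ B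

theorem Memory.Bits.one_le {s : Memory} {B : ℕ} (h : s.Bits B) : 1 ≤ B :=
  (one_le_bitLength _).trans (h 0 0)

theorem Expr.bitLength_eval_le {s : Memory} {B : ℕ} (h : s.Bits B) (e : Expr) :
    bitLength (e.eval s) ≤ e.weight * B := by
  have hB := h.one_le
  induction e with
  | lit z => simp only [Expr.eval, Expr.weight]; nlinarith [one_le_bitLength z]
  | get a i => simp only [Expr.eval, Expr.weight]; nlinarith [h a (i.eval s)]
  | add e f he hf => simp only [Expr.eval, Expr.weight]; nlinarith [bitLength_add_le (e.eval s) (f.eval s)]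
  | sub e f he hf => simp only [Expr.eval, Expr.weight]; nlinarith [bitLength_sub_le (e.eval s) (f.eval s)]
  | mul e f he hf => simp only [Expr.eval, Expr.weight]; nlinarith [bitLength_mul_le (e.eval s) (f.eval s)]
  | div e f he hf => simp only [Expr.eval, Expr.weight]; nlinarith [bitLength_div_le (e.eval s) (f.eval s)]

/-- Each node costs at most its weight times B, and the squares of the weights absorb the sum over
all nodes because w₁² + w₂² + (w₁ + w₂ + 1) ≤ (w₁ + w₂ + 1)². -/
theorem Expr.cost_le {s : Memory} {B : ℕ} (h : s.Bits B) (e : Expr) :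
    e.cost s ≤ e.weight ^ 2 * B := by
  have hB := h.one_le
  have key : ∀ w₁ w₂ c₁ c₂ b : ℕ, c₁ ≤ w₁ ^ 2 * B → c₂ ≤ w₂ ^ 2 * B → b ≤ (w₁ + w₂ + 1) * B →
      c₁ + c₂ + b ≤ (w₁ + w₂ + 1) ^ 2 * B := by
    intro w₁ w₂ c₁ c₂ b h1 h2 h3
    have : w₁ ^ 2 + w₂ ^ 2 + (w₁ + w₂ + 1) ≤ (w₁ + w₂ + 1) ^ 2 := by nlinarith
    calc c₁ + c₂ + b ≤ (w₁ ^ 2 + w₂ ^ 2 + (w₁ + w₂ + 1)) * B := by linarith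
      _ ≤ _ := Nat.mul_le_mul_right _ this
  induction e with
  | lit z =>
    simp only [Expr.cost, Expr.weight]
    have := one_le_bitLength z
    calc bitLength z ≤ bitLength z * (bitLength z * B) := Nat.le_mul_of_pos_right _ (by positivity)
      _ = _ := by ring
  | get a i hi =>
    have := key i.weight 0 (i.cost s) 0 (bitLength (s a (i.eval s))) hi (by simp)
      ((h a (i.eval s)).trans (Nat.le_mul_of_pos_left _ (by omega)))
    simpa [Expr.cost, Expr.weight] using this
  | add e f he hf => exact key _ _ _ _ _ he hf (Expr.bitLength_eval_le h (.add e f))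
  | sub e f he hf => exact key _ _ _ _ _ he hf (Expr.bitLength_eval_le h (.sub e f))
  | mul e f he hf => exact key _ _ _ _ _ he hf (Expr.bitLength_eval_le h (.mul e f))
  | div e f he hf => exact key _ _ _ _ _ he hf (Expr.bitLength_eval_le h (.div e f))

/-- The program halts in memory `s'` after time at most `T`. -/
def Runs (c : Program) (s : Memory) (T : ℕ) (s' : Memory) : Prop := ∃ t ≤ T, Exec c s t s'

theorem Runs.mono {c : Program} {s s' : Memory} {T T' : ℕ} (h : Runs c s T s') (hT : T ≤ T') :
    Runs c s T' s' := by
  obtain ⟨t, ht, h⟩ := h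
  exact ⟨t, ht.trans hT, h⟩

theorem Runs.skip (s : Memory) : Runs .skip s 1 s := ⟨1, le_rfl, Exec.skip s⟩

theorem Runs.seq {c d : Program} {s s' s'' : Memory} {T T' : ℕ} (h : Runs c s T s')
    (h' : Runs d s' T' s'') : Runs (.seq c d) s (T + T' + 1) s'' := by
  obtain ⟨t, ht, h⟩ := h
  obtain ⟨t', ht', h'⟩ := h'
  exact ⟨t + t' + 1, by omega, Exec.seq h h'⟩

theorem Runs.set {s : Memory} {B : ℕ} (hs : s.Bits B) (a : ℕ) (i e : Expr) {κ : ℕ}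
    (hκ : (Program.set a i e).weight ≤ κ) :
    Runs (.set a i e) s (κ ^ 2 * B) (s.write a (i.eval s) (e.eval s)) := by
  refine ⟨_, ?_, Exec.set a i e s⟩
  have hB := hs.one_le
  have hi := i.cost_le hs
  have he := e.cost_le hs
  simp only [Program.weight] at hκ
  calc i.cost s + e.cost s + 1 ≤ (i.weight ^ 2 + e.weight ^ 2 + 1) * B := by nlinarith
    _ ≤ (i.weight + e.weight + 1) ^ 2 * B := Nat.mul_le_mul_right _ (by nlinarith)
    _ ≤ κ ^ 2 * B := by gcongr

theorem Runs.ite_true {e : Expr} {c d : Program} {s s' : Memory} {T B κ : ℕ} (hs : s.Bits B)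
    (hκ : e.weight ≤ κ) (he : 0 < e.eval s) (h : Runs c s T s') :
    Runs (.ite e c d) s (κ ^ 2 * B + T + 1) s' := by
  obtain ⟨t, ht, h⟩ := h
  refine ⟨_, ?_, Exec.ite_true he h⟩
  have : e.cost s ≤ κ ^ 2 * B := (e.cost_le hs).trans (by gcongr)
  omega

theorem Runs.ite_false {e : Expr} {c d : Program} {s s' : Memory} {T B κ : ℕ} (hs : s.Bits B)
    (hκ : e.weight ≤ κ) (he : ¬ 0 < e.eval s) (h : Runs d s T s') :
    Runs (.ite e c d) s (κ ^ 2 * B + T + 1) s' := by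
  obtain ⟨t, ht, h⟩ := h
  refine ⟨_, ?_, Exec.ite_false he h⟩
  have : e.cost s ≤ κ ^ 2 * B := (e.cost_le hs).trans (by gcongr)
  omega

/-- The invariant carries the number of completed iterations and decides the test, so the body runs
exactly J times; the additional 1 pays for the failing test. -/
theorem Runs.while {e : Expr} {c : Program} (Inv : ℕ → Memory → Prop) {J B κ T : ℕ}
    (hκ : e.weight ≤ κ) (hB : ∀ j s, Inv j s → s.Bits B)
    (hstep : ∀ j < J, ∀ s, Inv j s → 0 < e.eval s ∧ ∃ s', Runs c s T s' ∧ Inv (j + 1) s')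
    (hend : ∀ s, Inv J s → ¬ 0 < e.eval s) {s : Memory} (h0 : Inv 0 s) :
    ∃ s', Runs (.while e c) s ((J + 1) * (κ ^ 2 * B + T + 1)) s' ∧ Inv J s' := by
  have hcost : ∀ j s, Inv j s → e.cost s ≤ κ ^ 2 * B := fun j s h =>
    (e.cost_le (hB j s h)).trans (by gcongr)
  have key : ∀ d j, j + d = J → ∀ s, Inv j s →
      ∃ s', Runs (.while e c) s ((d + 1) * (κ ^ 2 * B + T + 1)) s' ∧ Inv J s' := by
    intro d
    induction d with
    | zero =>
      rintro j rfl s h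
      refine ⟨s, ⟨_, ?_, Exec.while_false (hend s h)⟩, h⟩
      have := hcost _ s h
      omega
    | succ d ih =>
      intro j hj s h
      obtain ⟨he, s', ⟨t, ht, h1⟩, h'⟩ := hstep j (by omega) s h
      obtain ⟨s'', ⟨t', ht', h2⟩, h''⟩ := ih (j + 1) (by omega) s' h'
      refine ⟨s'', ⟨_, ?_, Exec.while_true he h1 h2⟩, h''⟩
      have := hcost _ s h
      calc e.cost s + t + t' + 1
          ≤ κ ^ 2 * B + T + (d + 1) * (κ ^ 2 * B + T + 1) + 1 := by omega
        _ = _ := by ring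
  exact key J 0 (by omega) s h0

/-- The content of cell `0` of array `a`. -/
abbrev Expr.var (a : ℕ) : Expr := .get a (.lit 0)

theorem Memory.write_same (s : Memory) (a : ℕ) (i z : ℤ) : s.write a i z a i = z := by
  simp [Memory.write]

theorem Memory.write_of_ne {s : Memory} {a b : ℕ} (h : b ≠ a) (i z : ℤ) : s.write a i z b = s b := by
  funext j; simp [Memory.write, h]

theorem Memory.write_of_ne' {s : Memory} {a : ℕ} {i j : ℤ} (h : j ≠ i) (z : ℤ) :
    s.write a i z a j = s a j := by
  simp [Memory.write, h]

theorem Memory.Bits.write {s : Memory} {B : ℕ} (h : s.Bits B) (a : ℕ) (i : ℤ) {z : ℤ}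
    (hz : bitLength z ≤ B) : (s.write a i z).Bits B := by
  intro b j
  unfold Memory.write
  split_ifs
  · exact hz
  · exact h b j

/-- `tabulate a I J e` stores `∑ j < J, e` in cell `i` of array `a` for all `i < I`. The value of
`i` is in cell `0` of array `2`, the value of `j` in cell `0` of array `3`. -/
def tabulate (a : ℕ) (I J e : Expr) : Program :=
  .seq (.set 2 (.lit 0) (.lit 0)) <| .while (.sub I (.var 2)) <|
    .seq (.set a (.var 2) (.lit 0)) <| .seq (.set 3 (.lit 0) (.lit 0)) <|
    .seq (.while (.sub J (.var 3)) <|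
      .seq (.set a (.var 2) (.add (.get a (.var 2)) e)) (.set 3 (.lit 0) (.add (.var 3) (.lit 1))))
    (.set 2 (.lit 0) (.add (.var 2) (.lit 1)))

theorem bitLength_natCast_mono {x y : ℕ} (h : x ≤ y) : bitLength (x : ℤ) ≤ bitLength (y : ℤ) :=
  bitLength_mono (by simpa using h)

/-- Apart from iterated squaring, this is the only form of loop over data. The expressions are
required to have the right value in every memory that differs from `s` only in the target array and
the two counters, which is what holds during the loops. All partial sums, not only the final ones,
must fit into B bits. -/
theorem runs_tabulate {a : ℕ} (ha2 : a ≠ 2) (ha3 : a ≠ 3) {I J e : Expr} {s : Memory} {B : ℕ}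
    (hs : s.Bits B) {u v : ℕ} {F : ℕ → ℕ → ℤ}
    (hI : ∀ s' : Memory, (∀ b, b ≠ a → b ≠ 2 → b ≠ 3 → s' b = s b) → I.eval s' = u)
    (hJ : ∀ s' : Memory, (∀ b, b ≠ a → b ≠ 2 → b ≠ 3 → s' b = s b) → J.eval s' = v)
    (he : ∀ s' : Memory, (∀ b, b ≠ a → b ≠ 2 → b ≠ 3 → s' b = s b) → ∀ i < u, ∀ j < v,
      s' 2 0 = (i : ℤ) → s' 3 0 = (j : ℤ) → e.eval s' = F i j)
    (hu : bitLength (u : ℤ) ≤ B) (hv : bitLength (v : ℤ) ≤ B)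
    (hF : ∀ i < u, ∀ j ≤ v, bitLength (∑ j' ∈ Finset.range j, F i j') ≤ B)
    {κ : ℕ} (hκ : (tabulate a I J e).weight ≤ κ) :
    ∃ s', Runs (tabulate a I J e) s (15 * ((u + 1) * (v + 1)) * (κ ^ 2 * B)) s' ∧ s'.Bits B ∧
      (∀ b, b ≠ a → b ≠ 2 → b ≠ 3 → s' b = s b) ∧
      (∀ i < u, s' a (i : ℤ) = ∑ j ∈ Finset.range v, F i j) := by
  simp only [tabulate, Program.weight, Expr.weight, Expr.var] at hκ
  set p := κ ^ 2 * B with hp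
  have hB1 := hs.one_le
  have hκ1 : 1 ≤ κ := by omega
  have hp1 : 1 ≤ p := Nat.mul_pos (by positivity) hB1
  have h1B : bitLength 0 ≤ B := by
    have := bitLength_natCast_mono (Nat.zero_le u); simp only [Nat.cast_zero] at this; omega
  -- inner loop
  have inner : ∀ i < u, ∀ s₁ : Memory, s₁.Bits B →
      (∀ b, b ≠ a → b ≠ 2 → b ≠ 3 → s₁ b = s b) → s₁ 2 0 = (i : ℤ) → s₁ 3 0 = 0 →
      s₁ a (i : ℤ) = 0 →
      ∃ s₂, Runs (.while (.sub J (.var 3)) <|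
        .seq (.set a (.var 2) (.add (.get a (.var 2)) e))
          (.set 3 (.lit 0) (.add (.var 3) (.lit 1)))) s₁ ((v + 1) * (p + (p + p + 1) + 1)) s₂ ∧
        (s₂.Bits B ∧ (∀ b, b ≠ a → b ≠ 2 → b ≠ 3 → s₂ b = s b) ∧ s₂ 2 0 = (i : ℤ) ∧
          s₂ 3 0 = (v : ℤ) ∧ s₂ a (i : ℤ) = ∑ j' ∈ Finset.range v, F i j' ∧
          ∀ i' : ℤ, i' ≠ i → s₂ a i' = s₁ a i') := by
    intro i hi s₁ hb1 hs1 h21 h31 ha1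
    refine Runs.while (fun j s₂ => s₂.Bits B ∧ (∀ b, b ≠ a → b ≠ 2 → b ≠ 3 → s₂ b = s b) ∧
        s₂ 2 0 = (i : ℤ) ∧ s₂ 3 0 = (j : ℤ) ∧ s₂ a (i : ℤ) = ∑ j' ∈ Finset.range j, F i j' ∧
        ∀ i' : ℤ, i' ≠ i → s₂ a i' = s₁ a i') (B := B) (κ := κ) ?_ (fun j s₂ h => h.1) ?_ ?_ ?_
    · simp only [Expr.weight]; omega
    · rintro j hj s₂ ⟨hb2, hs2, h22, h32, ha2', hn2⟩
      refine ⟨?_, ?_⟩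
      · simp only [Expr.eval, hJ s₂ hs2, h32]; omega
      · have r1 := Runs.set hb2 a (.var 2) (.add (.get a (.var 2)) e) (κ := κ)
          (by simp only [Program.weight, Expr.weight]; omega)
        simp only [Expr.eval, h22, ha2', he s₂ hs2 i hi j hj h22 h32] at r1
        rw [← Finset.sum_range_succ] at r1
        have hb3 := hb2.write a (i : ℤ) (hF i hi (j + 1) hj)
        set s₃ := s₂.write a (i : ℤ) (∑ j' ∈ Finset.range (j + 1), F i j') with hs3
        have r2 := Runs.set hb3 3 (.lit 0) (.add (.var 3) (.lit 1)) (κ := κ)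
          (by simp only [Program.weight, Expr.weight]; omega)
        have h33 : s₃ 3 0 = (j : ℤ) := by rw [hs3, Memory.write_of_ne ha3.symm, h32]
        simp only [Expr.eval, h33] at r2
        refine ⟨_, r1.seq r2, hb3.write 3 0 ?_, ?_, ?_, ?_, ?_, ?_⟩
        · have := bitLength_natCast_mono (Nat.succ_le_of_lt hj)
          push_cast at this
          exact this.trans hv
        · intro b h1 h2 h3
          rw [Memory.write_of_ne h3, hs3, Memory.write_of_ne h1, hs2 b h1 h2 h3]
        · rw [Memory.write_of_ne (by norm_num), hs3, Memory.write_of_ne ha2.symm, h22]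
        · rw [Memory.write_same]; push_cast; rfl
        · rw [Memory.write_of_ne ha3, hs3, Memory.write_same]
        · intro i' hi'
          rw [Memory.write_of_ne ha3, hs3, Memory.write_of_ne' hi', hn2 i' hi']
    · rintro s₂ ⟨hb2, hs2, h22, h32, ha2', hn2⟩
      simp only [Expr.eval, hJ s₂ hs2, h32]; omega
    · exact ⟨hb1, hs1, h21, by simpa using h31, by simpa using ha1, fun _ _ => rfl⟩
  -- outer loop
  have r0 := Runs.set hs 2 (.lit 0) (.lit 0) (κ := κ)
    (by simp only [Program.weight, Expr.weight]; omega)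
  simp only [Expr.eval] at r0
  have hb0 := hs.write 2 0 h1B
  set s₀ := s.write 2 0 0 with hs0
  have outer := Runs.while (e := .sub I (.var 2))
    (c := .seq (.set a (.var 2) (.lit 0)) <| .seq (.set 3 (.lit 0) (.lit 0)) <|
      .seq (.while (.sub J (.var 3)) <|
        .seq (.set a (.var 2) (.add (.get a (.var 2)) e)) (.set 3 (.lit 0) (.add (.var 3) (.lit 1))))
      (.set 2 (.lit 0) (.add (.var 2) (.lit 1))))
    (fun i s₁ => s₁.Bits B ∧ (∀ b, b ≠ a → b ≠ 2 → b ≠ 3 → s₁ b = s b) ∧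
      s₁ 2 0 = (i : ℤ) ∧ ∀ i' < i, s₁ a (i' : ℤ) = ∑ j ∈ Finset.range v, F i' j)
    (J := u) (B := B) (κ := κ) (T := p + (p + ((v + 1) * (p + (p + p + 1) + 1) + p + 1) + 1) + 1)
    (by simp only [Expr.weight]; omega) (fun j s₂ h => h.1) ?_ ?_ (s := s₀) ?_
  · obtain ⟨s', r', hb', hs', -, ha'⟩ := outer
    refine ⟨s', (r0.seq r').mono ?_, hb', hs', ha'⟩
    rw [← hp]
    nlinarith [Nat.zero_le (u * v), Nat.zero_le (u * (v * p)), Nat.zero_le (v * p), Nat.zero_le (u * p),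
      Nat.mul_le_mul_left (u * v) hp1, Nat.mul_le_mul_left u hp1, Nat.mul_le_mul_left v hp1]
  · rintro i hi s₁ ⟨hb1, hs1, h21, ha1⟩
    refine ⟨?_, ?_⟩
    · simp only [Expr.eval, hI s₁ hs1, h21]; omega
    · have r1 := Runs.set hb1 a (.var 2) (.lit 0) (κ := κ)
        (by simp only [Program.weight, Expr.weight]; omega)
      simp only [Expr.eval, h21] at r1
      have hb2 := hb1.write a (i : ℤ) h1B
      set s₂ := s₁.write a (i : ℤ) 0 with hs2
      have r2 := Runs.set hb2 3 (.lit 0) (.lit 0) (κ := κ)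
        (by simp only [Program.weight, Expr.weight]; omega)
      simp only [Expr.eval] at r2
      have hb3 := hb2.write 3 0 h1B
      set s₃ := s₂.write 3 0 0 with hs3
      obtain ⟨s₄, r3, hb4, hs4, h24, h34, ha4, hn4⟩ := inner i hi s₃ hb3 (by
          intro b h1 h2 h3
          rw [hs3, Memory.write_of_ne h3, hs2, Memory.write_of_ne h1, hs1 b h1 h2 h3])
        (by rw [hs3, Memory.write_of_ne (by norm_num), hs2, Memory.write_of_ne ha2.symm, h21])
        (by rw [hs3, Memory.write_same])
        (by rw [hs3, Memory.write_of_ne ha3, hs2, Memory.write_same])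
      have r4 := Runs.set hb4 2 (.lit 0) (.add (.var 2) (.lit 1)) (κ := κ)
        (by simp only [Program.weight, Expr.weight]; omega)
      simp only [Expr.eval, h24] at r4
      refine ⟨_, r1.seq (r2.seq (r3.seq r4)), hb4.write 2 0 ?_, ?_, ?_, ?_⟩
      · have := bitLength_natCast_mono (Nat.succ_le_of_lt hi)
        push_cast at this
        exact this.trans hu
      · intro b h1 h2 h3
        rw [Memory.write_of_ne h2, hs4 b h1 h2 h3]
      · rw [Memory.write_same]; push_cast; rfl
      · intro i' hi'
        rw [Memory.write_of_ne ha2]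
        rcases Nat.lt_succ_iff_lt_or_eq.1 hi' with h | rfl
        · rw [hn4 _ (by exact_mod_cast h.ne), hs3, Memory.write_of_ne ha3, hs2,
            Memory.write_of_ne' (by exact_mod_cast h.ne), ha1 i' h]
        · exact ha4
  · rintro s₁ ⟨hb1, hs1, h21, ha1⟩
    simp only [Expr.eval, hI s₁ hs1, h21]; omega
  · refine ⟨hb0, fun b h1 h2 h3 => ?_, ?_, by simp⟩
    · rw [hs0, Memory.write_of_ne h2]
    · rw [hs0, Memory.write_same]; simp

end RAM

/-! ### The certificate -/

namespace CSP

open Matrix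

/-- The code of a scope: its entries are the digits in base `n`. -/
def scopeCode {k n : ℕ} (S : Fin k → Fin n) : ℕ := ∑ j, (S j : ℕ) * n ^ (j : ℕ)

/-- The sum of the signs `∏ j ∈ T, c j` over all constraints whose scope has code `a`. -/
def coeff {k n : ℕ} (T : Finset (Fin k)) (J : Instance k n) (a : ℕ) : ℤ :=
  (J.map fun cS => if scopeCode cS.2 = a then ∏ j ∈ T, ((cS.1 j : ℤˣ) : ℤ) else 0).sum

/-- The number of values of `⌊k/2⌋` variables. -/
def rowCount (k n : ℕ) : ℕ := n ^ (k / 2)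

/-- The number of values of the remaining variable if `k` is odd, otherwise `1`. -/
def sliceCount (k n : ℕ) : ℕ := n ^ (k % 2)

/-- The coefficients as a three-dimensional array. -/
def coeffArray {k n : ℕ} (T : Finset (Fin k)) (J : Instance k n) :
    Fin (sliceCount k n) → Fin (rowCount k n) → Fin (rowCount k n) → ℤ := fun i u v =>
  coeff T J (i * (rowCount k n * rowCount k n) + u * rowCount k n + v)

/-- The number of squarings in the computation of the trace moment. -/
def squarings (n : ℕ) : ℕ := Nat.clog 2 (Nat.clog 2 n)

/-- The trace moment that bounds the norm of the matrix `offDiag`. -/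
def traceMoment {k n : ℕ} (T : Finset (Fin k)) (J : Instance k n) : ℤ :=
  trace ((offDiag (coeffArray T J) * (offDiag (coeffArray T J))ᵀ) ^ 2 ^ squarings n)

/-- The sum of the squares of the coefficients. -/
def sumSq {k n : ℕ} (T : Finset (Fin k)) (J : Instance k n) : ℤ :=
  ∑ a ∈ Finset.range (sliceCount k n * (rowCount k n * rowCount k n)), coeff T J a * coeff T J a

/-- What remains of the allowed square of the Fourier coefficient after subtracting `sumSq`. -/
def slack {k n : ℕ} (T : Finset (Fin k)) (J : Instance k n) (γ : ℚ) : ℤ :=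
  γ.num ^ 2 * (Multiset.card J : ℤ) ^ 2
    - (sliceCount k n : ℤ) * (4 ^ k * (γ.den : ℤ) ^ 2) * sumSq T J

/-- The factor of the norm in the bound for the Fourier coefficient. -/
def scaling (k n : ℕ) (γ : ℚ) : ℤ :=
  (sliceCount k n : ℤ) * (4 ^ k * (γ.den : ℤ) ^ 2) * ((rowCount k n : ℤ) * rowCount k n)

/-- The certificate for the Fourier coefficient of `T`. -/
def Certified {k n : ℕ} (T : Finset (Fin k)) (J : Instance k n) (γ : ℚ) : Prop :=
  0 ≤ slack T J γ ∧
    (scaling k n γ ^ 2) ^ 2 ^ squarings n * traceMoment T J ≤ (slack T J γ ^ 2) ^ 2 ^ squarings n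

open Classical in
/-- The certification algorithm. -/
noncomputable def certifier {k : ℕ} (n : ℕ) (J : Instance k n) (γ : ℚ) : Bool :=
  -- The number n is given in binary, but the matrices have size polynomial in n; the test `n ≤ card
  -- J` makes n at most polynomial in the input length. The test `0 < card J` is not redundant when
  -- n = 0.
  decide (0 < γ ∧ n ≤ Multiset.card J ∧ 0 < Multiset.card J ∧
    ∀ T : Finset (Fin k), T.Nonempty → Certified T J γ)

/-- The matrix `offDiag` with rows and columns numbered. -/
def flatMatrix {k n : ℕ} (T : Finset (Fin k)) (J : Instance k n) :
    Matrix (Fin (rowCount k n * rowCount k n)) (Fin (rowCount k n * rowCount k n)) ℤ :=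
  (offDiag (coeffArray T J)).submatrix finProdFinEquiv.symm finProdFinEquiv.symm

/-- Traces are invariant under renumbering; the program works with `flatMatrix`, the estimates with
pairs as indices. -/
theorem traceMoment_eq {k n : ℕ} (T : Finset (Fin k)) (J : Instance k n) :
    traceMoment T J = trace ((flatMatrix T J * (flatMatrix T J)ᵀ) ^ 2 ^ squarings n) := by
  set X := offDiag (coeffArray T J) with hX
  have h : flatMatrix T J * (flatMatrix T J)ᵀ =
      reindexAlgEquiv ℤ ℤ finProdFinEquiv (X * Xᵀ) := by
    rw [flatMatrix, transpose_submatrix, submatrix_mul_equiv]; rfl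
  rw [h, ← map_pow, traceMoment, ← hX]
  simp only [coe_reindexAlgEquiv, trace, diag_apply, reindex_apply, submatrix_apply]
  exact (Equiv.sum_comp finProdFinEquiv.symm fun i => ((X * Xᵀ) ^ 2 ^ squarings n) i i).symm

end CSP

namespace RAM

/-! ### Input access -/

theorem getD_flatMap {α : Type*} {f : α → List ℤ} {b : ℕ} (l : List α) (hf : ∀ x ∈ l, (f x).length = b)
    (i : ℕ) (hi : i < l.length) (j : ℕ) (hj : j < b) :
    (l.flatMap f).getD (b * i + j) 0 = (f l[i]).getD j 0 := by
  induction l generalizing i with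
  | nil => simp at hi
  | cons x l ih =>
    have hx : (f x).length = b := hf x (by simp)
    rw [List.flatMap_cons]
    cases i with
    | zero =>
      rw [Nat.mul_zero, Nat.zero_add, List.getD_append _ _ _ _ (by omega)]
      rfl
    | succ i =>
      rw [List.getD_append_right _ _ _ _ (by rw [hx]; nlinarith), hx,
        show b * (i + 1) + j - b = b * i + j by rw [Nat.mul_succ]; omega]
      exact ih (fun y hy => hf y (by simp [hy])) i (by simpa using hi)

section Input
variable {k : ℕ} (x : CSP.AlgInput k)

theorem initialMemory_natCast (l : List ℤ) (i : ℕ) : initialMemory l 0 (i : ℤ) = l.getD i 0 := by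
  simp [initialMemory]

theorem initialMemory_encode_n : initialMemory x.encode 0 0 = x.n := by
  rw [show (0 : ℤ) = ((0 : ℕ) : ℤ) from rfl, initialMemory_natCast]; rfl

theorem initialMemory_encode_length : initialMemory x.encode 0 1 = x.constraints.length := by
  rw [show (1 : ℤ) = ((1 : ℕ) : ℤ) from rfl, initialMemory_natCast]; rfl

theorem initialMemory_encode_num : initialMemory x.encode 0 2 = x.γ.num := by
  rw [show (2 : ℤ) = ((2 : ℕ) : ℤ) from rfl, initialMemory_natCast]; rfl

theorem initialMemory_encode_den : initialMemory x.encode 0 3 = x.γ.den := by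
  rw [show (3 : ℤ) = ((3 : ℕ) : ℤ) from rfl, initialMemory_natCast]; rfl

theorem initialMemory_encode_block (e : ℕ) (he : e < x.constraints.length) (j : ℕ) (hj : j < 2 * k) :
    initialMemory x.encode 0 (4 + 2 * k * e + j) =
      (List.ofFn (fun i => (((x.constraints[e]).1 i : ℤˣ) : ℤ)) ++
        List.ofFn (fun i => ((((x.constraints[e]).2 i : Fin x.n) : ℕ) : ℤ))).getD j 0 := by
  rw [show (4 + 2 * k * e + j : ℤ) = ((4 + (2 * k * e + j) : ℕ) : ℤ) by push_cast; ring,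
    initialMemory_natCast, CSP.AlgInput.encode]
  rw [List.getD_append_right _ _ _ _ (by simp)]
  simp only [List.length_cons, List.length_nil, Nat.zero_add, Nat.reduceAdd, Nat.add_sub_cancel_left]
  exact getD_flatMap _ (by simp; intros; omega) e he j hj

theorem initialMemory_encode_sign (e : ℕ) (he : e < x.constraints.length) (j : Fin k) :
    initialMemory x.encode 0 (4 + 2 * k * e + (j : ℕ)) = (((x.constraints[e]).1 j : ℤˣ) : ℤ) := by
  rw [initialMemory_encode_block x e he j (by omega), List.getD_append _ _ _ _ (by simp)]
  simp [List.getD]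

theorem initialMemory_encode_scope (e : ℕ) (he : e < x.constraints.length) (j : Fin k) :
    initialMemory x.encode 0 (4 + 2 * k * e + (k + (j : ℕ))) =
      (((x.constraints[e]).2 j : Fin x.n) : ℕ) := by
  have := initialMemory_encode_block x e he (k + j) (by omega)
  push_cast at this
  rw [this, List.getD_append_right _ _ _ _ (by simp)]
  simp [List.getD]

theorem bitLength_le_inputSize {l : List ℤ} {z : ℤ} (h : z ∈ l) : bitLength z ≤ inputSize l :=
  List.single_le_sum (by simp) _ (List.mem_map_of_mem h)

theorem length_le_inputSize (l : List ℤ) : l.length ≤ inputSize l := by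
  rw [inputSize, ← List.length_map (f := bitLength)]
  refine List.length_le_sum_of_one_le _ fun i hi => ?_
  obtain ⟨z, -, rfl⟩ := List.mem_map.1 hi
  exact one_le_bitLength z

theorem bits_initialMemory {l : List ℤ} (hl : 1 ≤ l.length) :
    (initialMemory l).Bits (inputSize l) := by
  intro a i
  have h0 : bitLength 0 ≤ inputSize l := by
    have : bitLength 0 = 1 := by simp [bitLength]
    rw [this]; exact hl.trans (length_le_inputSize l)
  unfold initialMemory
  split_ifs with h
  · rcases lt_or_ge i.toNat l.length with h1 | h1
    · rw [List.getD_eq_getElem _ _ h1]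
      exact bitLength_le_inputSize (List.getElem_mem h1)
    · rw [List.getD_eq_default _ _ h1]; exact h0
  · exact h0

theorem length_constraints_le (hk : 1 ≤ k) : x.constraints.length ≤ inputSize x.encode := by
  refine le_trans ?_ (length_le_inputSize _)
  simp only [CSP.AlgInput.encode, List.length_append, List.length_flatMap, List.length_ofFn]
  simp
  nlinarith

end Input

/-! ### Expressions -/

/-- The power `e ^ j`. -/
def Expr.pow (e : Expr) : ℕ → Expr
  | 0 => .lit 1
  | j + 1 => .mul (e.pow j) e

theorem Expr.eval_pow (s : Memory) (e : Expr) (j : ℕ) : (e.pow j).eval s = e.eval s ^ j := by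
  induction j with
  | zero => rw [pow_zero]; rfl
  | succ j ih => rw [Expr.pow, Expr.eval, ih, pow_succ]

/-- `1` if the value of `e` is `0`, otherwise `0`. -/
def Expr.isZero (e : Expr) : Expr := .div (.lit 1) (.add (.lit 1) (.mul e e))

/-- For v ≠ 0 the denominator 1 + v² exceeds 1, and the integer quotient is 0. -/
theorem Expr.eval_isZero (s : Memory) (e : Expr) :
    e.isZero.eval s = if e.eval s = 0 then 1 else 0 := by
  simp only [Expr.isZero, Expr.eval]
  split_ifs with h
  · simp [h]
  · refine Int.ediv_eq_zero_of_lt zero_le_one ?_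
    have : 0 < e.eval s * e.eval s := mul_self_pos.2 h
    omega

/-- The remainder of `e` modulo `f`. -/
def Expr.mod (e f : Expr) : Expr := .sub e (.mul f (.div e f))

theorem Expr.eval_mod (s : Memory) (e f : Expr) : (e.mod f).eval s = e.eval s % f.eval s := by
  simp only [Expr.mod, Expr.eval, Int.emod_def]

/-- The product of the entries at the positions in `l` of the negation pattern of the constraint
whose number is in cell `0` of array `3`. -/
def signExpr {k : ℕ} (l : List (Fin k)) : Expr :=
  l.foldr (fun (j : Fin k) (E : Expr) => .mul (.get 0
    (.add (.add (.lit 4) (.mul (.lit (2 * k)) (.var 3))) (.lit ((j : ℕ) : ℤ)))) E) (.lit 1)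

/-- The code of the scope of the constraint whose number is in cell `0` of array `3`. -/
def codeExpr {k : ℕ} (l : List (Fin k)) : Expr :=
  l.foldr (fun (j : Fin k) (E : Expr) => .add (.mul (.get 0
    (.add (.add (.lit 4) (.mul (.lit (2 * k)) (.var 3))) (.add (.lit k) (.lit ((j : ℕ) : ℤ)))))
      ((Expr.var 0).pow j)) E) (.lit 0)

theorem eval_signExpr {k : ℕ} (x : CSP.AlgInput k) {s : Memory}
    (hs : s 0 = initialMemory x.encode 0) (l : List (Fin k)) {e : ℕ}
    (he : e < x.constraints.length) (h3 : s 3 0 = (e : ℤ)) :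
    (signExpr l).eval s = (l.map fun j => (((x.constraints[e]).1 j : ℤˣ) : ℤ)).prod := by
  induction l with
  | nil => rfl
  | cons j l ih =>
    rw [List.map_cons, List.prod_cons, ← ih]
    simp only [signExpr, List.foldr_cons, Expr.eval, h3, hs]
    rw [initialMemory_encode_sign x e he j]

theorem eval_codeExpr {k : ℕ} (x : CSP.AlgInput k) {s : Memory}
    (hs : s 0 = initialMemory x.encode 0) (l : List (Fin k)) {e : ℕ}
    (he : e < x.constraints.length) (h3 : s 3 0 = (e : ℤ)) :
    (codeExpr l).eval s =
      (l.map fun j => ((((x.constraints[e]).2 j : Fin x.n) : ℕ) : ℤ) * (x.n : ℤ) ^ (j : ℕ)).sum := by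
  induction l with
  | nil => rfl
  | cons j l ih =>
    rw [List.map_cons, List.sum_cons, ← ih]
    simp only [codeExpr, List.foldr_cons, Expr.eval, h3, hs, Expr.eval_pow]
    rw [initialMemory_encode_scope x e he j, initialMemory_encode_n]

end RAM

/-! ### Programs for matrices stored row by row -/

namespace RAM

open Matrix

/-- Array `a` contains the entries of the matrix `X`, row by row. -/
def HoldsMatrix (s : Memory) (a : ℕ) {d : ℕ} (X : Matrix (Fin d) (Fin d) ℤ) : Prop :=
  ∀ r c : Fin d, s a (((r : ℕ) * d + c : ℕ) : ℤ) = X r c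

theorem HoldsMatrix.congr {s s' : Memory} {a d : ℕ} {X : Matrix (Fin d) (Fin d) ℤ}
    (h : HoldsMatrix s a X) (hs : s' a = s a) : HoldsMatrix s' a X := fun r c => by rw [hs, h r c]

theorem abs_sum_range_le {f : ℕ → ℤ} {x : ℤ} {j : ℕ} (h : ∀ i < j, |f i| ≤ x) :
    |∑ i ∈ Finset.range j, f i| ≤ j * x := by
  refine (Finset.abs_sum_le_sum_abs _ _).trans ?_
  refine (Finset.sum_le_sum fun i hi => h i (Finset.mem_range.1 hi)).trans ?_
  simp

theorem natCast_div_add {d : ℕ} (r : ℕ) (c : Fin d) :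
    (((r * d + c : ℕ) : ℤ) / (d : ℤ)) = (r : ℤ) := by
  have hd : 0 < d := c.pos
  rw [← Int.natCast_div, Nat.mul_comm, Nat.mul_add_div hd, Nat.div_eq_of_lt c.isLt, Nat.add_zero]

theorem natCast_mod_add {d : ℕ} (r : ℕ) (c : Fin d) :
    (((r * d + c : ℕ) : ℤ) % (d : ℤ)) = ((c : ℕ) : ℤ) := by
  rw [← Int.natCast_mod, Nat.mul_comm, Nat.mul_add_mod, Nat.mod_eq_of_lt c.isLt]

/-- Cell number i stands for row i / d and column i % d. The hypothesis on x is a bound for single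
summands, so v * x bounds all partial sums. -/
theorem runs_tabulate_matrix {a : ℕ} (ha2 : a ≠ 2) (ha3 : a ≠ 3) {I J e : Expr} {s : Memory} {B : ℕ}
    (hs : s.Bits B) {d v : ℕ} {F : Fin d → Fin d → ℕ → ℤ}
    (hI : ∀ s' : Memory, (∀ b, b ≠ a → b ≠ 2 → b ≠ 3 → s' b = s b) → I.eval s' = (d * d : ℕ))
    (hJ : ∀ s' : Memory, (∀ b, b ≠ a → b ≠ 2 → b ≠ 3 → s' b = s b) → J.eval s' = v)
    (he : ∀ s' : Memory, (∀ b, b ≠ a → b ≠ 2 → b ≠ 3 → s' b = s b) → ∀ r c : Fin d, ∀ j < v,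
      s' 2 0 = (((r : ℕ) * d + c : ℕ) : ℤ) → s' 3 0 = (j : ℤ) → e.eval s' = F r c j)
    {b : ℕ} (hbB : b + 2 ≤ B) (hd : ((d * d : ℕ) : ℤ) ≤ 2 ^ b) (hv : (v : ℤ) ≤ 2 ^ b)
    {x : ℤ} (hF : ∀ r c, ∀ j < v, |F r c j| ≤ x) (hx : v * x ≤ 2 ^ b)
    {κ : ℕ} (hκ : (tabulate a I J e).weight ≤ κ) :
    ∃ s', Runs (tabulate a I J e) s (15 * ((d * d + 1) * (v + 1)) * (κ ^ 2 * B)) s' ∧ s'.Bits B ∧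
      (∀ b, b ≠ a → b ≠ 2 → b ≠ 3 → s' b = s b) ∧
      HoldsMatrix s' a (of fun r c => ∑ j ∈ Finset.range v, F r c j) := by
  have hlt : ∀ i < d * d, i / d < d ∧ i % d < d := fun i hi => by
    have : 0 < d := Nat.pos_of_ne_zero (by rintro rfl; simp at hi)
    exact ⟨Nat.div_lt_of_lt_mul hi, Nat.mod_lt _ this⟩
  have hbits : ∀ z : ℤ, |z| ≤ 2 ^ b → bitLength z ≤ B := fun z h =>
    (bitLength_le_of_abs_le h).trans hbB
  obtain ⟨s', r', hb', hf', ha'⟩ := runs_tabulate ha2 ha3 hs (u := d * d) (v := v)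
    (F := fun i j => if h : i < d * d then F ⟨i / d, (hlt i h).1⟩ ⟨i % d, (hlt i h).2⟩ j else 0)
    hI hJ (fun s' hs' i hi j hj h2 h3 => by
      rw [dif_pos hi]
      refine he s' hs' _ _ j hj ?_ h3
      rw [h2]
      congr 1
      simp only
      rw [Nat.mul_comm]
      exact (Nat.div_add_mod i d).symm)
    (hbits _ (by rwa [Nat.abs_cast])) (hbits _ (by rwa [Nat.abs_cast]))
    (fun i hi j hj => hbits _ (by
      rcases Nat.eq_zero_or_pos v with rfl | hv0
      · rw [Nat.le_zero.1 hj]; simp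
      · refine (abs_sum_range_le (x := x) fun i' hi' => ?_).trans ?_
        · rw [dif_pos hi]; exact hF _ _ _ (by omega)
        · have hx0 : 0 ≤ x := (abs_nonneg _).trans
            (hF ⟨i / d, (hlt i hi).1⟩ ⟨i % d, (hlt i hi).2⟩ 0 hv0)
          refine le_trans ?_ hx
          gcongr)) hκ
  refine ⟨s', r', hb', hf', fun r c => ?_⟩
  have hlt' : (r : ℕ) * d + c < d * d := by nlinarith [r.isLt, c.isLt]
  rw [ha' _ hlt', of_apply]
  refine Finset.sum_congr rfl fun j _ => ?_
  rw [dif_pos hlt']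
  have hd0 : 0 < d := c.pos
  congr 1 <;> apply Fin.ext <;> simp only
  · rw [Nat.mul_comm, Nat.mul_add_div hd0, Nat.div_eq_of_lt c.isLt, Nat.add_zero]
  · rw [Nat.mul_comm, Nat.mul_add_mod, Nat.mod_eq_of_lt c.isLt]

/-- Tabulation of a product of matrices. -/
theorem runs_tabulate_mul {a : ℕ} (ha2 : a ≠ 2) (ha3 : a ≠ 3) {I J e : Expr} {s : Memory} {B : ℕ}
    (hs : s.Bits B) {d : ℕ} {X Y : Matrix (Fin d) (Fin d) ℤ}
    (hI : ∀ s' : Memory, (∀ b, b ≠ a → b ≠ 2 → b ≠ 3 → s' b = s b) → I.eval s' = (d * d : ℕ))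
    (hJ : ∀ s' : Memory, (∀ b, b ≠ a → b ≠ 2 → b ≠ 3 → s' b = s b) → J.eval s' = d)
    (he : ∀ s' : Memory, (∀ b, b ≠ a → b ≠ 2 → b ≠ 3 → s' b = s b) → ∀ r c j : Fin d,
      s' 2 0 = (((r : ℕ) * d + c : ℕ) : ℤ) → s' 3 0 = ((j : ℕ) : ℤ) → e.eval s' = X r j * Y j c)
    {b : ℕ} (hbB : b + 2 ≤ B) (hd : ((d * d : ℕ) : ℤ) ≤ 2 ^ b)
    {x y : ℤ} (hX : ∀ r c, |X r c| ≤ x) (hY : ∀ r c, |Y r c| ≤ y) (hxy : d * (x * y) ≤ 2 ^ b)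
    {κ : ℕ} (hκ : (tabulate a I J e).weight ≤ κ) :
    ∃ s', Runs (tabulate a I J e) s (15 * ((d * d + 1) * (d + 1)) * (κ ^ 2 * B)) s' ∧ s'.Bits B ∧
      (∀ b, b ≠ a → b ≠ 2 → b ≠ 3 → s' b = s b) ∧ HoldsMatrix s' a (X * Y) := by
  obtain ⟨s', r', hb', hf', ha'⟩ := runs_tabulate_matrix ha2 ha3 hs (d := d) (v := d)
    (F := fun r c j => if h : j < d then X r ⟨j, h⟩ * Y ⟨j, h⟩ c else 0) hI hJ
    (fun s' hs' r c j hj h2 h3 => by rw [dif_pos hj]; exact he s' hs' r c ⟨j, hj⟩ h2 h3)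
    hbB hd (le_trans (by push_cast; nlinarith [Nat.zero_le d]) hd) (x := x * y)
    (fun r c j hj => by
      rw [dif_pos hj, abs_mul]
      exact mul_le_mul (hX _ _) (hY _ _) (abs_nonneg _) ((abs_nonneg _).trans (hX r r)))
    hxy hκ
  refine ⟨s', r', hb', hf', ?_⟩
  convert ha' using 1
  ext r c
  rw [mul_apply, of_apply, Finset.sum_range]
  simp

/-! ### The certificate for one character -/

/-- Number of the row of the entry whose number is in cell `0` of array `2`. -/
def rowExpr : Expr := .div (.var 2) (.var 9)

/-- Number of the column of the entry whose number is in cell `0` of array `2`. -/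
def colExpr : Expr := .mod (.var 2) (.var 9)

/-- Entry `(i, j)` of the matrix in array `a`. -/
def entryExpr (a : ℕ) (i j : Expr) : Expr := .get a (.add (.mul i (.var 9)) j)

/-- Coefficient number `(i, u, v)`, where `i` is in cell `0` of array `3`. -/
def coeffExpr (u v : Expr) : Expr :=
  .get 4 (.add (.add (.mul (.var 3) (.var 9)) (.mul u (.var 8))) v)

/-- The program for the array of coefficients. -/
def coeffProgram {k : ℕ} (l : List (Fin k)) : Program :=
  tabulate 4 (.mul (.var 10) (.var 9)) (.get 0 (.lit 1))
    (.mul (signExpr l) (.isZero (.sub (codeExpr (List.finRange k)) (.var 2))))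

/-- The program for `CSP.flatMatrix`. -/
def flatMatrixProgram : Program :=
  tabulate 5 (.mul (.var 9) (.var 9)) (.var 10)
    (.mul (.sub (.lit 1) (.mul
        (.isZero (.sub (.div rowExpr (.var 8)) (.mod rowExpr (.var 8))))
        (.isZero (.sub (.div colExpr (.var 8)) (.mod colExpr (.var 8))))))
      (.mul (coeffExpr (.div rowExpr (.var 8)) (.div colExpr (.var 8)))
        (coeffExpr (.mod rowExpr (.var 8)) (.mod colExpr (.var 8)))))

/-- The program for the product of `CSP.flatMatrix` with its transpose. -/
def gramProgram : Program :=
  tabulate 6 (.mul (.var 9) (.var 9)) (.var 9)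
    (.mul (entryExpr 5 rowExpr (.var 3)) (entryExpr 5 colExpr (.var 3)))

/-- The program for the square of the matrix in array `6`. -/
def squareProgram : Program :=
  tabulate 7 (.mul (.var 9) (.var 9)) (.var 9)
    (.mul (entryExpr 6 rowExpr (.var 3)) (entryExpr 6 (.var 3) colExpr))

/-- The program that copies array `7` to array `6`. -/
def copyProgram : Program :=
  tabulate 6 (.mul (.var 9) (.var 9)) (.lit 1) (.get 7 (.var 2))

/-- The program for the sum of the squares of the coefficients. -/
def sumSqProgram : Program :=
  tabulate 12 (.lit 1) (.mul (.var 10) (.var 9)) (.mul (.get 4 (.var 3)) (.get 4 (.var 3)))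

/-- The program for the trace of the matrix in array `6`. -/
def traceProgram : Program :=
  tabulate 17 (.lit 1) (.var 9) (entryExpr 6 (.var 3) (.var 3))

section Phases
variable {k : ℕ} (x : CSP.AlgInput k)

open CSP

/-- Rewrites the coefficient as a sum over list positions, with value 0 beyond the end of the list,
to match the inner loop of `tabulate`. -/
theorem coeff_coe_eq_sum_range (T : Finset (Fin k)) (a : ℕ) :
    coeff T (x.constraints : Instance k x.n) a = ∑ e ∈ Finset.range x.constraints.length,
      if h : e < x.constraints.length then
        if scopeCode (x.constraints[e]).2 = a then
          ∏ j ∈ T, (((x.constraints[e]).1 j : ℤˣ) : ℤ) else 0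
      else 0 := by
  rw [coeff, Multiset.map_coe, Multiset.sum_coe, Finset.sum_range]
  simp only [Fin.is_lt, dite_true]
  rw [← Fin.sum_univ_fun_getElem]

theorem abs_prod_sign_le {n : ℕ} (T : Finset (Fin k)) (cS : Constraint k n) :
    |∏ j ∈ T, ((cS.1 j : ℤˣ) : ℤ)| ≤ 1 := by
  rw [Finset.abs_prod]
  refine le_of_eq (Finset.prod_eq_one fun j _ => ?_)
  rcases Int.units_eq_one_or (cS.1 j) with h | h <;> simp [h]

theorem runs_coeffProgram (T : Finset (Fin k)) {s : Memory} {B : ℕ} (hs : s.Bits B)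
    (h0 : s 0 = initialMemory x.encode 0)
    (h9 : s 9 0 = ((rowCount k x.n * rowCount k x.n : ℕ) : ℤ))
    (h10 : s 10 0 = (sliceCount k x.n : ℤ)) {b : ℕ} (hbB : b + 2 ≤ B)
    (hu : ((sliceCount k x.n * (rowCount k x.n * rowCount k x.n) : ℕ) : ℤ) ≤ 2 ^ b)
    (hv : (x.constraints.length : ℤ) ≤ 2 ^ b)
    {κ : ℕ} (hκ : (coeffProgram T.toList).weight ≤ κ) :
    ∃ s', Runs (coeffProgram T.toList) s
        (15 * ((sliceCount k x.n * (rowCount k x.n * rowCount k x.n) + 1) *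
          (x.constraints.length + 1)) * (κ ^ 2 * B)) s' ∧ s'.Bits B ∧
      (∀ b, b ≠ 4 → b ≠ 2 → b ≠ 3 → s' b = s b) ∧
      ∀ a < sliceCount k x.n * (rowCount k x.n * rowCount k x.n),
        s' 4 (a : ℤ) = coeff T (x.constraints : Instance k x.n) a := by
  have hbits : ∀ z : ℤ, |z| ≤ 2 ^ b → bitLength z ≤ B := fun z h =>
    (bitLength_le_of_abs_le h).trans hbB
  have := runs_tabulate (a := 4) (by norm_num) (by norm_num) (I := .mul (.var 10) (.var 9))
    (J := .get 0 (.lit 1))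
    (e := .mul (signExpr T.toList) (.isZero (.sub (codeExpr (List.finRange k)) (.var 2)))) hs
    (u := sliceCount k x.n * (rowCount k x.n * rowCount k x.n)) (v := x.constraints.length)
    (F := fun a e => if h : e < x.constraints.length then
        if scopeCode (x.constraints[e]).2 = a then
          ∏ j ∈ T, (((x.constraints[e]).1 j : ℤˣ) : ℤ) else 0
      else 0) ?_ ?_ ?_ (hbits _ (by rwa [Nat.abs_cast])) (hbits _ (by rwa [Nat.abs_cast])) ?_ hκ
  · simp_rw [coeff_coe_eq_sum_range]
    exact this
  · intro s' hs'
    simp only [Expr.eval, hs' 10 (by norm_num) (by norm_num) (by norm_num),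
      hs' 9 (by norm_num) (by norm_num) (by norm_num), h9, h10]
    push_cast; rfl
  · intro s' hs'
    simp only [Expr.eval, hs' 0 (by norm_num) (by norm_num) (by norm_num), h0]
    exact initialMemory_encode_length x
  · intro s' hs' a ha e he h2 h3
    have h0' : s' 0 = initialMemory x.encode 0 := by
      rw [hs' 0 (by norm_num) (by norm_num) (by norm_num), h0]
    rw [dif_pos he]
    simp only [Expr.eval, Expr.eval_isZero, eval_signExpr x h0' _ he h3,
      eval_codeExpr x h0' _ he h3, h2]
    have e1 : ((List.finRange k).map fun j => ((((x.constraints[e]).2 j : Fin x.n) : ℕ) : ℤ)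
        * (x.n : ℤ) ^ (j : ℕ)).sum = (scopeCode (x.constraints[e]).2 : ℤ) := by
      rw [scopeCode, ← List.ofFn_eq_map, List.sum_ofFn]
      push_cast; rfl
    rw [e1, Finset.prod_map_toList]
    by_cases h : scopeCode (x.constraints[e]).2 = a
    · simp [h]
    · have : ¬ ((scopeCode (x.constraints[e]).2 : ℤ) - a = 0) := by
        rw [sub_eq_zero]; exact_mod_cast h
      simp [h, this]
  · intro a ha j hj
    refine hbits _ ((abs_sum_range_le (x := 1) fun e he => ?_).trans ?_)
    · split_ifs
      · exact abs_prod_sign_le _ _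
      · simp
      · simp
    · rw [mul_one]; exact le_trans (by exact_mod_cast hj) hv

theorem abs_coeff_le {n : ℕ} (T : Finset (Fin k)) (J : Instance k n) (a : ℕ) :
    |coeff T J a| ≤ Multiset.card J := by
  induction J using Multiset.induction_on with
  | empty => simp [coeff]
  | cons cS J ih =>
    rw [coeff, Multiset.map_cons, Multiset.sum_cons, Multiset.card_cons, ← coeff]
    refine (abs_add_le _ _).trans ?_
    push_cast
    rw [add_comm]
    refine add_le_add ih ?_
    split_ifs
    · exact abs_prod_sign_le _ _
    · simp

/-- A flat index r encodes the pair (r / N, r % N), so self-products are recognized by equality of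
quotient and remainder in both the row and the column. -/
theorem offDiag_flat_apply {n : ℕ} (T : Finset (Fin k)) (J : Instance k n)
    (r c : Fin (rowCount k n * rowCount k n)) :
    flatMatrix T J r c = ∑ i ∈ Finset.range (sliceCount k n),
      if (r : ℕ) / rowCount k n = r % rowCount k n ∧ (c : ℕ) / rowCount k n = c % rowCount k n
      then 0 else
      coeff T J (i * (rowCount k n * rowCount k n) + r / rowCount k n * rowCount k n
          + c / rowCount k n) *
        coeff T J (i * (rowCount k n * rowCount k n) + r % rowCount k n * rowCount k n
          + c % rowCount k n) := by
  rw [flatMatrix, submatrix_apply, offDiag, of_apply, Finset.sum_range]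
  refine Finset.sum_congr rfl fun i _ => ?_
  simp [coeffArray, finProdFinEquiv, Fin.ext_iff]

theorem runs_flatMatrixProgram {n : ℕ} (T : Finset (Fin k)) (J : Instance k n) {s : Memory} {B : ℕ}
    (hs : s.Bits B) (h8 : s 8 0 = (rowCount k n : ℤ))
    (h9 : s 9 0 = ((rowCount k n * rowCount k n : ℕ) : ℤ)) (h10 : s 10 0 = (sliceCount k n : ℤ))
    (h4 : ∀ a < sliceCount k n * (rowCount k n * rowCount k n), s 4 (a : ℤ) = coeff T J a)
    {b : ℕ} (hbB : b + 2 ≤ B)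
    (hd : ((rowCount k n * rowCount k n * (rowCount k n * rowCount k n) : ℕ) : ℤ) ≤ 2 ^ b)
    (hv : (sliceCount k n : ℤ) ≤ 2 ^ b)
    (hx : (sliceCount k n : ℤ) * (Multiset.card J * Multiset.card J) ≤ 2 ^ b)
    {κ : ℕ} (hκ : flatMatrixProgram.weight ≤ κ) :
    ∃ s', Runs flatMatrixProgram s
        (15 * ((rowCount k n * rowCount k n * (rowCount k n * rowCount k n) + 1) *
          (sliceCount k n + 1)) * (κ ^ 2 * B)) s' ∧ s'.Bits B ∧
      (∀ b, b ≠ 5 → b ≠ 2 → b ≠ 3 → s' b = s b) ∧ HoldsMatrix s' 5 (flatMatrix T J) := by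
  set N := rowCount k n with hN
  have := runs_tabulate_matrix (a := 5) (by norm_num) (by norm_num)
    (I := .mul (.var 9) (.var 9)) (J := .var 10) (e := _) hs (d := N * N) (v := sliceCount k n)
    (F := fun r c i => if (r : ℕ) / N = r % N ∧ (c : ℕ) / N = c % N then 0 else
      coeff T J (i * (N * N) + r / N * N + c / N) * coeff T J (i * (N * N) + r % N * N + c % N))
    ?_ ?_ ?_ hbB hd hv (x := Multiset.card J * Multiset.card J) ?_ hx hκ
  · obtain ⟨s', r', hb', hf', ha'⟩ := this
    refine ⟨s', r', hb', hf', ?_⟩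
    convert ha' using 1
    ext r c
    rw [offDiag_flat_apply, of_apply]
  · intro s' hs'
    simp only [Expr.eval, hs' 9 (by norm_num) (by norm_num) (by norm_num), h9]
    push_cast; rfl
  · intro s' hs'
    simp only [Expr.eval, hs' 10 (by norm_num) (by norm_num) (by norm_num), h10]
  · intro s' hs' r c j hj h2 h3
    have e4 : s' 4 = s 4 := hs' 4 (by norm_num) (by norm_num) (by norm_num)
    have e8 : s' 8 0 = (N : ℤ) := by rw [hs' 8 (by norm_num) (by norm_num) (by norm_num), h8]
    have e9 : s' 9 0 = ((N * N : ℕ) : ℤ) := by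
      rw [hs' 9 (by norm_num) (by norm_num) (by norm_num), h9]
    have er : rowExpr.eval s' = ((r : ℕ) : ℤ) := by
      simp only [rowExpr, Expr.eval, h2, e9]
      exact natCast_div_add _ c
    have ec : colExpr.eval s' = ((c : ℕ) : ℤ) := by
      simp only [colExpr, Expr.eval_mod, Expr.eval, h2, e9]
      exact natCast_mod_add _ c
    have hNpos : 0 < N := Nat.pos_of_ne_zero (by rintro h; have := r.pos; simp [h] at this)
    have hdiv : ∀ t : Fin (N * N), (t : ℕ) / N < N ∧ (t : ℕ) % N < N := fun t =>
      ⟨Nat.div_lt_of_lt_mul t.isLt, Nat.mod_lt _ hNpos⟩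
    have key : ∀ (uE vE : Expr) (u v : ℕ), uE.eval s' = (u : ℤ) → vE.eval s' = (v : ℤ) →
        u < N → v < N → (coeffExpr uE vE).eval s' = coeff T J (j * (N * N) + u * N + v) := by
      intro uE vE u v hu hv hu' hv'
      simp only [coeffExpr, Expr.eval, h3, e9, e8, hu, hv, e4]
      rw [← h4 (j * (N * N) + u * N + v)]
      · push_cast; rfl
      · have : u * N + v < N * N := by nlinarith
        have : (j + 1) * (N * N) ≤ sliceCount k n * (N * N) := Nat.mul_le_mul_right _ hj
        nlinarith
    simp only [Expr.eval, Expr.eval_isZero]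
    rw [key _ _ (r / N) (c / N) (by simp [Expr.eval, er, e8]) (by simp [Expr.eval, ec, e8])
        (hdiv r).1 (hdiv c).1,
      key _ _ (r % N) (c % N) (by simp [Expr.eval_mod, Expr.eval, er, e8])
        (by simp [Expr.eval_mod, Expr.eval, ec, e8]) (hdiv r).2 (hdiv c).2]
    simp only [Expr.eval_mod, Expr.eval, er, ec, e8]
    have hz : ∀ t : ℕ, ((t : ℤ) / (N : ℤ) - (t : ℤ) % (N : ℤ) = 0) ↔ t / N = t % N := fun t => by
      rw [sub_eq_zero]; exact_mod_cast Iff.rfl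
    simp only [hz]
    by_cases h1 : (r : ℕ) / N = r % N <;> by_cases h2 : (c : ℕ) / N = c % N <;> simp [h1, h2]
  · intro r c j _
    split_ifs
    · simpa using mul_self_nonneg _
    · rw [abs_mul]
      exact mul_le_mul (abs_coeff_le _ _ _) (abs_coeff_le _ _ _) (abs_nonneg _) (by positivity)

end Phases

end RAM

/-! ### Size bounds and correctness of the single phases -/

namespace RAM

open Matrix CSP

theorem abs_pow_apply_le {d : ℕ} {X : Matrix (Fin d) (Fin d) ℤ} {x : ℤ} (hx : ∀ r c, |X r c| ≤ x)
    (e : ℕ) (r c : Fin d) : |(X ^ e) r c| ≤ (d * x) ^ e := by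
  have hx0 : 0 ≤ x := (abs_nonneg _).trans (hx r r)
  induction e generalizing r c with
  | zero =>
    rw [pow_zero, pow_zero, one_apply]
    split_ifs <;> simp
  | succ e ih =>
    rw [pow_succ, mul_apply]
    refine (Finset.abs_sum_le_sum_abs _ _).trans ?_
    calc ∑ j, |(X ^ e) r j * X j c| ≤ ∑ _j : Fin d, (d * x) ^ e * x := by
          refine Finset.sum_le_sum fun j _ => ?_
          rw [abs_mul]
          exact mul_le_mul (ih r j) (hx j c) (abs_nonneg _) (by positivity)
      _ = _ := by
          rw [Finset.sum_const, Finset.card_univ, Fintype.card_fin, nsmul_eq_mul, pow_succ]; ring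

/-- The body of the loop that computes the iterated squares. -/
def squaringBody : Program :=
  .seq squareProgram <| .seq copyProgram <| .seq (.set 14 (.lit 0) (.mul (.var 14) (.var 14))) <|
    .seq (.set 15 (.lit 0) (.mul (.var 15) (.var 15)))
      (.set 16 (.lit 0) (.mul (.var 16) (.var 16)))

/-- The loop that computes the iterated squares. -/
def squaringLoop : Program := .while (.sub (.var 0) (.var 16)) squaringBody

/-- The expression for `CSP.slack`. -/
def slackExpr (k : ℕ) : Expr :=
  .sub (.mul (.mul (.get 0 (.lit 2)) (.get 0 (.lit 2))) (.mul (.get 0 (.lit 1)) (.get 0 (.lit 1))))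
    (.mul (.mul (.var 10) (.mul (.lit (4 ^ k)) (.mul (.get 0 (.lit 3)) (.get 0 (.lit 3)))))
      (.var 12))

/-- The expression for `CSP.scaling`. -/
def scalingExpr (k : ℕ) : Expr :=
  .mul (.mul (.var 10) (.mul (.lit (4 ^ k)) (.mul (.get 0 (.lit 3)) (.get 0 (.lit 3))))) (.var 9)

/-- The final comparison: the output is set to `0` if the test fails. -/
def comparison : Program :=
  -- Tests have the strict form 0 < e; adding 1 expresses a weak inequality between integers.
  .ite (.add (.var 13) (.lit 1))
    (.ite (.add (.sub (.var 15) (.mul (.var 14) (.var 17))) (.lit 1)) .skip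
      (.set 1 (.lit 0) (.lit 0)))
    (.set 1 (.lit 0) (.lit 0))

/-- The program for the certificate of one character. -/
def certificateProgram {k : ℕ} (l : List (Fin k)) : Program :=
  .seq (.set 8 (.lit 0) ((Expr.var 0).pow (k / 2))) <|
  .seq (.set 9 (.lit 0) (.mul (.var 8) (.var 8))) <|
  .seq (.set 10 (.lit 0) ((Expr.var 0).pow (k % 2))) <|
  .seq (coeffProgram l) <| .seq flatMatrixProgram <| .seq gramProgram <| .seq sumSqProgram <|
  .seq (.set 13 (.lit 0) (slackExpr k)) <|
  .seq (.set 14 (.lit 0) (.mul (scalingExpr k) (scalingExpr k))) <|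
  .seq (.set 15 (.lit 0) (.mul (.var 13) (.var 13))) <|
  .seq (.set 16 (.lit 0) (.lit 2)) <|
  .seq squaringLoop <| .seq traceProgram comparison

/-- Bounds for the quantities that occur in the computation: `Y` bounds the values, `W` the lengths
of the loops, and `B` the bit lengths. -/
structure Bounds {k : ℕ} (x : AlgInput k) (Y W b B κ : ℕ) : Prop where
  two_le : 2 ≤ Y
  length_le : x.constraints.length ≤ Y
  row_le : rowCount k x.n ≤ Y
  slice_le : sliceCount k x.n ≤ Y
  num_le : |x.γ.num| ≤ Y
  den_le : x.γ.den ≤ Y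
  four_le : 4 ^ k ≤ Y
  -- The slack is at most Y^10, so its square is at most Y^20 before the iterated squaring; entries
  -- of the e-th power of the Gram matrix are at most Y^(10 e). The exponent 20 · 2^L covers both,
  -- and the partial sums while squaring.
  pow_le : Y ^ (20 * 2 ^ squarings x.n) ≤ 2 ^ b
  bits : b + 2 ≤ B
  one_le_W : 1 ≤ W
  row_le_W : rowCount k x.n ≤ W
  slice_le_W : sliceCount k x.n ≤ W
  length_le_W : x.constraints.length ≤ W
  squarings_le_W : squarings x.n ≤ W
  weight_le : ∀ T : Finset (Fin k), (certificateProgram T.toList).weight ≤ κ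

namespace Bounds
variable {k : ℕ} {x : AlgInput k} {Y W b B κ : ℕ} (h : Bounds x Y W b B κ)
include h

theorem pow_le_int {e : ℕ} (he : e ≤ 20 * 2 ^ squarings x.n) : (Y : ℤ) ^ e ≤ 2 ^ b := by
  have h1 : Y ^ e ≤ 2 ^ b := (Nat.pow_le_pow_right (by have := h.two_le; omega) he).trans h.pow_le
  exact_mod_cast h1

theorem pow_le_int' {e : ℕ} (he : e ≤ 20) : (Y : ℤ) ^ e ≤ 2 ^ b :=
  h.pow_le_int (he.trans (Nat.le_mul_of_pos_right _ (Nat.two_pow_pos _)))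

theorem bitLength_le {z : ℤ} (hz : |z| ≤ 2 ^ b) : bitLength z ≤ B :=
  (bitLength_le_of_abs_le hz).trans h.bits

theorem one_le : (1 : ℤ) ≤ Y := by have := h.two_le; exact_mod_cast (by omega : 1 ≤ Y)

/-- Gives one common time bound for all tabulations, whatever their shape: 60 = 15 · 2 · 2. -/
theorem time_le {u v : ℕ} (hu : u ≤ W ^ 4) (hv : v ≤ W ^ 3) :
    15 * ((u + 1) * (v + 1)) * (κ ^ 2 * B) ≤ 60 * W ^ 7 * (κ ^ 2 * B) := by
  refine Nat.mul_le_mul_right _ ?_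
  have h1 := h.one_le_W
  have h4 : u + 1 ≤ 2 * W ^ 4 := by have := Nat.pow_le_pow_left h1 4; omega
  have h3 : v + 1 ≤ 2 * W ^ 3 := by have := Nat.pow_le_pow_left h1 3; omega
  calc 15 * ((u + 1) * (v + 1)) ≤ 15 * ((2 * W ^ 4) * (2 * W ^ 3)) := by gcongr
    _ = 60 * W ^ 7 := by ring

theorem dim_le_W : rowCount k x.n * rowCount k x.n ≤ W ^ 2 := by
  rw [sq]; exact Nat.mul_le_mul h.row_le_W h.row_le_W

theorem dim_sq_le_W :
    rowCount k x.n * rowCount k x.n * (rowCount k x.n * rowCount k x.n) ≤ W ^ 4 := by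
  have := Nat.mul_le_mul h.dim_le_W h.dim_le_W
  rwa [← pow_add] at this

theorem slices_le_W : sliceCount k x.n * (rowCount k x.n * rowCount k x.n) ≤ W ^ 3 := by
  have := Nat.mul_le_mul h.slice_le_W h.dim_le_W
  rwa [← pow_succ'] at this

theorem dim_le : ((rowCount k x.n * rowCount k x.n : ℕ) : ℤ) ≤ Y ^ 2 := by
  rw [sq]; exact_mod_cast Nat.mul_le_mul h.row_le h.row_le

theorem dim_sq_le :
    ((rowCount k x.n * rowCount k x.n * (rowCount k x.n * rowCount k x.n) : ℕ) : ℤ) ≤ Y ^ 4 := by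
  have h1 := h.dim_le
  calc _ = ((rowCount k x.n * rowCount k x.n : ℕ) : ℤ) * ((rowCount k x.n * rowCount k x.n : ℕ) : ℤ) := by
        push_cast; ring
    _ ≤ (Y : ℤ) ^ 2 * Y ^ 2 := by gcongr
    _ = _ := by ring

theorem slices_le :
    ((sliceCount k x.n * (rowCount k x.n * rowCount k x.n) : ℕ) : ℤ) ≤ Y ^ 3 := by
  have h1 := h.dim_le
  have h2 : (sliceCount k x.n : ℤ) ≤ Y := by exact_mod_cast h.slice_le
  calc _ = (sliceCount k x.n : ℤ) * ((rowCount k x.n * rowCount k x.n : ℕ) : ℤ) := by push_cast; ring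
    _ ≤ (Y : ℤ) * Y ^ 2 := by gcongr
    _ = _ := by ring

theorem slice_mul_le : (sliceCount k x.n : ℤ) *
    (Multiset.card (x.constraints : Instance k x.n) * Multiset.card (x.constraints : Instance k x.n))
      ≤ Y ^ 3 := by
  have h1 : (x.constraints.length : ℤ) ≤ Y := by exact_mod_cast h.length_le
  have h2 : (sliceCount k x.n : ℤ) ≤ Y := by exact_mod_cast h.slice_le
  rw [Multiset.coe_card]
  calc _ ≤ (Y : ℤ) * (Y * Y) := by gcongr
    _ = _ := by ring

theorem abs_flatMatrix_le (T : Finset (Fin k)) (r c) :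
    |flatMatrix T (x.constraints : Instance k x.n) r c| ≤ Y ^ 3 := by
  rw [offDiag_flat_apply]
  refine (abs_sum_range_le (x := Multiset.card (x.constraints : Instance k x.n) *
    Multiset.card (x.constraints : Instance k x.n)) fun i _ => ?_).trans h.slice_mul_le
  split_ifs
  · simpa using mul_self_nonneg _
  · rw [abs_mul]
    exact mul_le_mul (abs_coeff_le _ _ _) (abs_coeff_le _ _ _) (abs_nonneg _) (by positivity)

theorem abs_gram_le (T : Finset (Fin k)) (r c) :
    |(flatMatrix T (x.constraints : Instance k x.n) *
      (flatMatrix T (x.constraints : Instance k x.n))ᵀ) r c| ≤ Y ^ 8 := by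
  rw [mul_apply]
  refine (Finset.abs_sum_le_sum_abs _ _).trans ?_
  calc _ ≤ ∑ _j : Fin (rowCount k x.n * rowCount k x.n), (Y : ℤ) ^ 3 * Y ^ 3 := by
        refine Finset.sum_le_sum fun j _ => ?_
        rw [abs_mul]
        exact mul_le_mul (h.abs_flatMatrix_le T _ _) (h.abs_flatMatrix_le T _ _) (abs_nonneg _)
          (by positivity)
    _ = ((rowCount k x.n * rowCount k x.n : ℕ) : ℤ) * Y ^ 6 := by
        rw [Finset.sum_const, Finset.card_univ, Fintype.card_fin, nsmul_eq_mul]; ring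
    _ ≤ (Y : ℤ) ^ 2 * Y ^ 6 := by gcongr; exact h.dim_le
    _ = _ := by ring

/-- Entries of the Gram matrix are at most Y^8 and its dimension is at most Y^2, so every further
factor costs Y^10. -/
theorem abs_gram_pow_le (T : Finset (Fin k)) (e : ℕ) (r c) :
    |((flatMatrix T (x.constraints : Instance k x.n) *
      (flatMatrix T (x.constraints : Instance k x.n))ᵀ) ^ e) r c| ≤ (Y : ℤ) ^ (10 * e) := by
  refine (abs_pow_apply_le (h.abs_gram_le T) e r c).trans ?_
  rw [pow_mul]
  have := h.dim_le
  calc _ ≤ ((Y : ℤ) ^ 2 * Y ^ 8) ^ e := by gcongr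
    _ = _ := by ring

theorem sumSq_nonneg (T : Finset (Fin k)) : 0 ≤ sumSq T (x.constraints : Instance k x.n) :=
  Finset.sum_nonneg fun _ _ => mul_self_nonneg _

theorem sumSq_le (T : Finset (Fin k)) : sumSq T (x.constraints : Instance k x.n) ≤ Y ^ 5 := by
  have h1 : (x.constraints.length : ℤ) ≤ Y := by exact_mod_cast h.length_le
  have h2 : ∀ a, coeff T (x.constraints : Instance k x.n) a *
      coeff T (x.constraints : Instance k x.n) a ≤ Y * Y := by
    intro a
    have h3 := abs_coeff_le T (x.constraints : Instance k x.n) a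
    rw [Multiset.coe_card] at h3
    rw [← abs_mul_abs_self]
    exact mul_le_mul (h3.trans h1) (h3.trans h1) (abs_nonneg _) (by positivity)
  rw [sumSq]
  refine (Finset.sum_le_sum fun a _ => h2 a).trans ?_
  rw [Finset.sum_const, Finset.card_range, nsmul_eq_mul]
  calc _ ≤ (Y : ℤ) ^ 3 * (Y * Y) := by gcongr; exact h.slices_le
    _ = _ := by ring

theorem scale_le : (sliceCount k x.n : ℤ) * (4 ^ k * (x.γ.den : ℤ) ^ 2) ≤ Y ^ 4 := by
  have h1 : (sliceCount k x.n : ℤ) ≤ Y := by exact_mod_cast h.slice_le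
  have h2 : (x.γ.den : ℤ) ≤ Y := by exact_mod_cast h.den_le
  have h3 : (4 : ℤ) ^ k ≤ Y := by exact_mod_cast h.four_le
  calc _ ≤ (Y : ℤ) * (Y * Y ^ 2) := by gcongr
    _ = _ := by ring

theorem abs_slack_le (T : Finset (Fin k)) :
    |slack T (x.constraints : Instance k x.n) x.γ| ≤ Y ^ 10 := by
  have h1 : (x.constraints.length : ℤ) ≤ Y := by exact_mod_cast h.length_le
  have h2 := h.sumSq_nonneg T
  have h3 := h.sumSq_le T
  have h4 := h.scale_le
  have h5 : x.γ.num ^ 2 * (x.constraints.length : ℤ) ^ 2 ≤ Y ^ 4 := by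
    rw [← sq_abs]
    have := h.num_le
    calc _ ≤ (Y : ℤ) ^ 2 * Y ^ 2 := by gcongr
      _ = _ := by ring
  have h6 : (sliceCount k x.n : ℤ) * (4 ^ k * (x.γ.den : ℤ) ^ 2) *
      sumSq T (x.constraints : Instance k x.n) ≤ Y ^ 9 := by
    calc _ ≤ (Y : ℤ) ^ 4 * Y ^ 5 := by gcongr
      _ = _ := by ring
  have h7 : 0 ≤ (sliceCount k x.n : ℤ) * (4 ^ k * (x.γ.den : ℤ) ^ 2) *
      sumSq T (x.constraints : Instance k x.n) := by positivity
  have h8 : 0 ≤ x.γ.num ^ 2 * (x.constraints.length : ℤ) ^ 2 := by positivity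
  have h9 : (Y : ℤ) ^ 4 ≤ Y ^ 10 := pow_le_pow_right₀ h.one_le (by norm_num)
  have h10 : (Y : ℤ) ^ 9 ≤ Y ^ 10 := pow_le_pow_right₀ h.one_le (by norm_num)
  rw [slack, Multiset.coe_card, abs_le]
  constructor <;> linarith

theorem scaling_nonneg : 0 ≤ scaling k x.n x.γ := by unfold scaling; positivity

theorem scaling_le : scaling k x.n x.γ ≤ Y ^ 6 := by
  have h1 := h.scale_le
  have h2 := h.dim_le
  push_cast at h2
  unfold scaling
  calc _ ≤ (Y : ℤ) ^ 4 * Y ^ 2 := by gcongr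
    _ = _ := by ring

end Bounds

theorem runs_gramProgram {d : ℕ} {X : Matrix (Fin d) (Fin d) ℤ} {s : Memory} {B : ℕ}
    (hs : s.Bits B) (h9 : s 9 0 = (d : ℤ)) (h5 : HoldsMatrix s 5 X)
    {b : ℕ} (hbB : b + 2 ≤ B) (hd : ((d * d : ℕ) : ℤ) ≤ 2 ^ b) {z : ℤ} (hX : ∀ r c, |X r c| ≤ z)
    (hz : d * (z * z) ≤ 2 ^ b) {κ : ℕ} (hκ : gramProgram.weight ≤ κ) :
    ∃ s', Runs gramProgram s (15 * ((d * d + 1) * (d + 1)) * (κ ^ 2 * B)) s' ∧ s'.Bits B ∧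
      (∀ b, b ≠ 6 → b ≠ 2 → b ≠ 3 → s' b = s b) ∧ HoldsMatrix s' 6 (X * Xᵀ) := by
  have e9 : ∀ s' : Memory, (∀ b, b ≠ 6 → b ≠ 2 → b ≠ 3 → s' b = s b) → s' 9 0 = (d : ℤ) := by
    intro s' hs'; rw [hs' 9 (by norm_num) (by norm_num) (by norm_num), h9]
  refine runs_tabulate_mul (by norm_num) (by norm_num) hs ?_ ?_ ?_ hbB hd hX (fun r c => hX c r) hz hκ
  · intro s' hs'; simp only [Expr.eval, e9 s' hs']; push_cast; rfl
  · intro s' hs'; simp only [Expr.eval, e9 s' hs']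
  · intro s' hs' r c j h2 h3
    have hr : rowExpr.eval s' = ((r : ℕ) : ℤ) := by
      simp only [rowExpr, Expr.eval, h2, e9 s' hs']; exact natCast_div_add _ c
    have hc : colExpr.eval s' = ((c : ℕ) : ℤ) := by
      simp only [colExpr, Expr.eval_mod, Expr.eval, h2, e9 s' hs']; exact natCast_mod_add _ c
    have h5' := h5.congr (hs' 5 (by norm_num) (by norm_num) (by norm_num))
    simp only [entryExpr, Expr.eval, hr, hc, h3, e9 s' hs']
    rw [← h5' r j, ← h5' c j]
    push_cast; rfl

theorem runs_squareProgram {d : ℕ} {X : Matrix (Fin d) (Fin d) ℤ} {s : Memory} {B : ℕ}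
    (hs : s.Bits B) (h9 : s 9 0 = (d : ℤ)) (h6 : HoldsMatrix s 6 X)
    {b : ℕ} (hbB : b + 2 ≤ B) (hd : ((d * d : ℕ) : ℤ) ≤ 2 ^ b) {z : ℤ} (hX : ∀ r c, |X r c| ≤ z)
    (hz : d * (z * z) ≤ 2 ^ b) {κ : ℕ} (hκ : squareProgram.weight ≤ κ) :
    ∃ s', Runs squareProgram s (15 * ((d * d + 1) * (d + 1)) * (κ ^ 2 * B)) s' ∧ s'.Bits B ∧
      (∀ b, b ≠ 7 → b ≠ 2 → b ≠ 3 → s' b = s b) ∧ HoldsMatrix s' 7 (X * X) := by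
  have e9 : ∀ s' : Memory, (∀ b, b ≠ 7 → b ≠ 2 → b ≠ 3 → s' b = s b) → s' 9 0 = (d : ℤ) := by
    intro s' hs'; rw [hs' 9 (by norm_num) (by norm_num) (by norm_num), h9]
  refine runs_tabulate_mul (by norm_num) (by norm_num) hs ?_ ?_ ?_ hbB hd hX hX hz hκ
  · intro s' hs'; simp only [Expr.eval, e9 s' hs']; push_cast; rfl
  · intro s' hs'; simp only [Expr.eval, e9 s' hs']
  · intro s' hs' r c j h2 h3
    have hr : rowExpr.eval s' = ((r : ℕ) : ℤ) := by
      simp only [rowExpr, Expr.eval, h2, e9 s' hs']; exact natCast_div_add _ c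
    have hc : colExpr.eval s' = ((c : ℕ) : ℤ) := by
      simp only [colExpr, Expr.eval_mod, Expr.eval, h2, e9 s' hs']; exact natCast_mod_add _ c
    have h6' := h6.congr (hs' 6 (by norm_num) (by norm_num) (by norm_num))
    simp only [entryExpr, Expr.eval, hr, hc, h3, e9 s' hs']
    rw [← h6' r j, ← h6' j c]
    push_cast; rfl

theorem runs_copyProgram {d : ℕ} {X : Matrix (Fin d) (Fin d) ℤ} {s : Memory} {B : ℕ}
    (hs : s.Bits B) (h9 : s 9 0 = (d : ℤ)) (h7 : HoldsMatrix s 7 X)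
    {b : ℕ} (hbB : b + 2 ≤ B) (hd : ((d * d : ℕ) : ℤ) ≤ 2 ^ b) {z : ℤ} (hX : ∀ r c, |X r c| ≤ z)
    (hz : z ≤ 2 ^ b) {κ : ℕ} (hκ : copyProgram.weight ≤ κ) :
    ∃ s', Runs copyProgram s (15 * ((d * d + 1) * (1 + 1)) * (κ ^ 2 * B)) s' ∧ s'.Bits B ∧
      (∀ b, b ≠ 6 → b ≠ 2 → b ≠ 3 → s' b = s b) ∧ HoldsMatrix s' 6 X := by
  have := runs_tabulate_matrix (a := 6) (I := .mul (.var 9) (.var 9)) (J := .lit 1)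
    (e := .get 7 (.var 2)) (by norm_num) (by norm_num) hs (v := 1) (F := fun r c _ => X r c)
    ?_ ?_ ?_ hbB hd (by exact_mod_cast Nat.one_le_two_pow) (fun r c _ _ => hX r c)
    (by simpa using hz) hκ
  · simp only [Finset.sum_range_one] at this
    exact this
  · intro s' hs'
    simp only [Expr.eval, hs' 9 (by norm_num) (by norm_num) (by norm_num), h9]; push_cast; rfl
  · intro s' hs'; rfl
  · intro s' hs' r c j _ h2 _
    simp only [Expr.eval, h2, hs' 7 (by norm_num) (by norm_num) (by norm_num)]
    exact h7 r c

theorem runs_sumSqProgram {k n : ℕ} (T : Finset (Fin k)) (J : Instance k n) {s : Memory} {B : ℕ}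
    (hs : s.Bits B) (h9 : s 9 0 = ((rowCount k n * rowCount k n : ℕ) : ℤ))
    (h10 : s 10 0 = (sliceCount k n : ℤ))
    (h4 : ∀ a < sliceCount k n * (rowCount k n * rowCount k n), s 4 (a : ℤ) = coeff T J a)
    {b : ℕ} (hbB : b + 2 ≤ B)
    (hu : ((sliceCount k n * (rowCount k n * rowCount k n) : ℕ) : ℤ) ≤ 2 ^ b)
    (hx : ((sliceCount k n * (rowCount k n * rowCount k n) : ℕ) : ℤ) *
      (Multiset.card J * Multiset.card J) ≤ 2 ^ b)
    {κ : ℕ} (hκ : sumSqProgram.weight ≤ κ) :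
    ∃ s', Runs sumSqProgram s
        (15 * ((1 + 1) * (sliceCount k n * (rowCount k n * rowCount k n) + 1)) * (κ ^ 2 * B)) s' ∧
      s'.Bits B ∧ (∀ b, b ≠ 12 → b ≠ 2 → b ≠ 3 → s' b = s b) ∧ s' 12 0 = sumSq T J := by
  have hbits : ∀ z : ℤ, |z| ≤ 2 ^ b → bitLength z ≤ B := fun z h =>
    (bitLength_le_of_abs_le h).trans hbB
  have := runs_tabulate (a := 12) (I := .lit 1) (J := .mul (.var 10) (.var 9))
    (e := .mul (.get 4 (.var 3)) (.get 4 (.var 3))) (by norm_num) (by norm_num) hs (u := 1)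
    (v := sliceCount k n * (rowCount k n * rowCount k n))
    (F := fun _ a => coeff T J a * coeff T J a) ?_ ?_ ?_
    (hbits _ (by rw [Nat.abs_cast]; exact_mod_cast Nat.one_le_two_pow))
    (hbits _ (by rwa [Nat.abs_cast])) ?_ hκ
  · obtain ⟨s', r', hb', hf', ha'⟩ := this
    exact ⟨s', r', hb', hf', by rw [sumSq, ← ha' 0 one_pos]; rfl⟩
  · intro s' hs'; rfl
  · intro s' hs'
    simp only [Expr.eval, hs' 10 (by norm_num) (by norm_num) (by norm_num),
      hs' 9 (by norm_num) (by norm_num) (by norm_num), h9, h10]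
    push_cast; rfl
  · intro s' hs' _ _ j hj _ h3
    simp only [Expr.eval, h3, hs' 4 (by norm_num) (by norm_num) (by norm_num), h4 j hj]
  · intro _ _ j hj
    refine hbits _ ((abs_sum_range_le (x := Multiset.card J * Multiset.card J) fun a _ => ?_).trans
      (le_trans ?_ hx))
    · rw [abs_mul]
      exact mul_le_mul (abs_coeff_le _ _ _) (abs_coeff_le _ _ _) (abs_nonneg _) (by positivity)
    · gcongr

theorem runs_traceProgram {d : ℕ} {X : Matrix (Fin d) (Fin d) ℤ} {s : Memory} {B : ℕ}
    (hs : s.Bits B) (h9 : s 9 0 = (d : ℤ)) (h6 : HoldsMatrix s 6 X)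
    {b : ℕ} (hbB : b + 2 ≤ B) (hd : (d : ℤ) ≤ 2 ^ b) {z : ℤ} (hX : ∀ r c, |X r c| ≤ z)
    (hz : d * z ≤ 2 ^ b) {κ : ℕ} (hκ : traceProgram.weight ≤ κ) :
    ∃ s', Runs traceProgram s (15 * ((1 + 1) * (d + 1)) * (κ ^ 2 * B)) s' ∧
      s'.Bits B ∧ (∀ b, b ≠ 17 → b ≠ 2 → b ≠ 3 → s' b = s b) ∧ s' 17 0 = trace X := by
  have hbits : ∀ z : ℤ, |z| ≤ 2 ^ b → bitLength z ≤ B := fun z h =>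
    (bitLength_le_of_abs_le h).trans hbB
  have := runs_tabulate (a := 17) (I := .lit 1) (J := .var 9)
    (e := entryExpr 6 (.var 3) (.var 3)) (by norm_num) (by norm_num) hs (u := 1)
    (v := d) (F := fun _ j => if h : j < d then X ⟨j, h⟩ ⟨j, h⟩ else 0) ?_ ?_ ?_
    (hbits _ (by rw [Nat.abs_cast]; exact_mod_cast Nat.one_le_two_pow))
    (hbits _ (by rwa [Nat.abs_cast])) ?_ hκ
  · obtain ⟨s', r', hb', hf', ha'⟩ := this
    refine ⟨s', r', hb', hf', ?_⟩
    have := ha' 0 one_pos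
    rw [Finset.sum_range] at this
    simpa [trace] using this
  · intro s' hs'; rfl
  · intro s' hs'
    simp only [Expr.eval, hs' 9 (by norm_num) (by norm_num) (by norm_num), h9]
  · intro s' hs' _ _ j hj _ h3
    rw [dif_pos hj, ← h6 ⟨j, hj⟩ ⟨j, hj⟩]
    simp only [entryExpr, Expr.eval, h3, hs' 9 (by norm_num) (by norm_num) (by norm_num), h9,
      hs' 6 (by norm_num) (by norm_num) (by norm_num)]
    push_cast; rfl
  · intro _ _ j hj
    refine hbits _ ?_
    rcases Nat.eq_zero_or_pos d with rfl | hd0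
    · rw [Nat.le_zero.1 hj]; simp
    · have hz0 : 0 ≤ z := (abs_nonneg _).trans (hX ⟨0, hd0⟩ ⟨0, hd0⟩)
      refine (abs_sum_range_le (x := z) fun a ha => ?_).trans (le_trans ?_ hz)
      · rw [dif_pos (by omega)]; exact hX _ _
      · gcongr

end RAM

/-! ### Iterated squaring and the program for one character -/

namespace RAM

open Matrix CSP

/-- Matches the number of squarings to a loop test that compares n with 2^(2^t), a quantity which is
maintained by squaring as well. -/
theorem lt_squarings_iff {n t : ℕ} : t < squarings n ↔ 2 ^ 2 ^ t < n := by
  rw [squarings, Nat.lt_clog_iff_pow_lt one_lt_two, Nat.lt_clog_iff_pow_lt one_lt_two]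

theorem le_two_pow_squarings (n : ℕ) : n ≤ 2 ^ 2 ^ squarings n := by
  by_contra h
  exact lt_irrefl _ (lt_squarings_iff.2 (not_le.1 h))

theorem bitLength_zero : bitLength 0 = 1 := by simp [bitLength]

theorem bitLength_one : bitLength 1 = 2 := by simp [bitLength]

section
variable {k : ℕ} {x : AlgInput k} {Y W b B κ : ℕ}

theorem one_le_sq_mul {κ B : ℕ} (hκ : 1 ≤ κ) (hB : 1 ≤ B) : 1 ≤ κ ^ 2 * B :=
  Nat.mul_pos (Nat.pow_pos hκ) hB

theorem sixty_mul_le {W p : ℕ} (hW : 1 ≤ W) : 60 * p ≤ 60 * W ^ 7 * p :=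
  Nat.mul_le_mul_right p (Nat.le_mul_of_pos_right 60 (Nat.pow_pos hW))

/-- The left side reproduces the nesting of the sequential compositions in `certificateProgram`,
with all tabulations bounded by `Bounds.time_le`. -/
theorem certificate_time_le {W p L : ℕ} (hp : 1 ≤ p) (hW : 1 ≤ W) (hL : L ≤ W) :
    p + (p + (p + (60 * W ^ 7 * p + (60 * W ^ 7 * p + (60 * W ^ 7 * p + (60 * W ^ 7 * p +
      (p + (p + (p + (p + ((L + 1) * (11 * (60 * W ^ 7 * p)) + (60 * W ^ 7 * p + (3 * p + 2) +
        1) + 1) + 1) + 1) + 1) + 1) + 1) + 1) + 1) + 1) + 1) + 1) + 1 ≤ 3600 * W ^ 8 * p := by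
  have hpτ := sixty_mul_le (p := p) hW
  have e3 : 3600 * W ^ 8 * p = 60 * (W * (60 * W ^ 7 * p)) := by ring
  rw [e3]
  generalize 60 * W ^ 7 * p = τ at *
  have e1 : (L + 1) * (11 * τ) ≤ 22 * (W * τ) := by
    have : L + 1 ≤ 2 * W := by omega
    calc (L + 1) * (11 * τ) ≤ (2 * W) * (11 * τ) := Nat.mul_le_mul_right _ this
      _ = _ := by ring
  have e2 : τ ≤ W * τ := Nat.le_mul_of_pos_left _ hW
  omega

/-- The matrix whose powers are computed. -/
def gram (x : AlgInput k) (T : Finset (Fin k)) :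
    Matrix (Fin (rowCount k x.n * rowCount k x.n)) (Fin (rowCount k x.n * rowCount k x.n)) ℤ :=
  flatMatrix T (x.constraints : Instance k x.n) * (flatMatrix T (x.constraints : Instance k x.n))ᵀ

/-- After t rounds, array 6 holds the 2^t-th power of the Gram matrix, cells 14 and 15 the 2^t-th
powers of the two scalars, and cell 16 the number 2^(2^t). The loop therefore stops after exactly
`squarings x.n` rounds without L ever being computed. -/
theorem runs_squaringLoop (h : Bounds x Y W b B κ) (T : Finset (Fin k)) {s : Memory} (hs : s.Bits B)
    (h0 : s 0 = initialMemory x.encode 0)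
    (h9 : s 9 0 = ((rowCount k x.n * rowCount k x.n : ℕ) : ℤ)) (h6 : HoldsMatrix s 6 (gram x T))
    {α β : ℤ} (h14 : s 14 0 = α) (h15 : s 15 0 = β) (h16 : s 16 0 = 2)
    (hα : |α| ≤ Y ^ 20) (hβ : |β| ≤ Y ^ 20) (hκ : squaringLoop.weight ≤ κ) :
    ∃ s', Runs squaringLoop s ((squarings x.n + 1) * (11 * (60 * W ^ 7 * (κ ^ 2 * B)))) s' ∧
      s'.Bits B ∧
      (∀ b, b ≠ 2 → b ≠ 3 → b ≠ 6 → b ≠ 7 → b ≠ 14 → b ≠ 15 → b ≠ 16 → s' b = s b) ∧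
      HoldsMatrix s' 6 (gram x T ^ 2 ^ squarings x.n) ∧ s' 14 0 = α ^ 2 ^ squarings x.n ∧
      s' 15 0 = β ^ 2 ^ squarings x.n := by
  simp only [squaringLoop, squaringBody, Program.weight, Expr.weight,
    bitLength_zero] at hκ
  have hκ1 : 1 ≤ κ := by omega
  have hp1 : 1 ≤ κ ^ 2 * B := one_le_sq_mul hκ1 hs.one_le
  have hpτ := sixty_mul_le (p := κ ^ 2 * B) h.one_le_W
  have hinv := Runs.while (e := .sub (.var 0) (.var 16)) (c := squaringBody)
    (fun t s' => s'.Bits B ∧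
      (∀ b, b ≠ 2 → b ≠ 3 → b ≠ 6 → b ≠ 7 → b ≠ 14 → b ≠ 15 → b ≠ 16 → s' b = s b) ∧
      HoldsMatrix s' 6 (gram x T ^ 2 ^ t) ∧ s' 14 0 = α ^ 2 ^ t ∧ s' 15 0 = β ^ 2 ^ t ∧
      s' 16 0 = 2 ^ 2 ^ t) (J := squarings x.n) (B := B) (κ := κ)
    (T := 60 * W ^ 7 * (κ ^ 2 * B) + (60 * W ^ 7 * (κ ^ 2 * B) + (κ ^ 2 * B +
      (κ ^ 2 * B + κ ^ 2 * B + 1) + 1) + 1) + 1) (by simp only [Expr.weight, bitLength_zero]; omega)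
    (fun _ _ h => h.1) ?_ ?_ (s := s) ?_
  · obtain ⟨s', r', hb', hf', h6', h14', h15', -⟩ := hinv
    refine ⟨s', r'.mono (Nat.mul_le_mul_left _ ?_), hb', hf', h6', h14', h15'⟩
    generalize 60 * W ^ 7 * (κ ^ 2 * B) = τ at *
    generalize κ ^ 2 * B = p at *
    omega
  · rintro t ht s₁ ⟨hb1, hf1, h61, h141, h151, h161⟩
    have hlt := lt_squarings_iff.1 ht
    have hn1 : s₁ 0 0 = x.n := by
      rw [hf1 0 (by norm_num) (by norm_num) (by norm_num) (by norm_num) (by norm_num) (by norm_num)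
        (by norm_num), h0, initialMemory_encode_n]
    refine ⟨?_, ?_⟩
    · simp only [Expr.eval, hn1, h161]
      have : ((2 ^ 2 ^ t : ℕ) : ℤ) < x.n := by exact_mod_cast hlt
      push_cast at this
      omega
    · have ht2 : 2 * 2 ^ t ≤ 2 ^ squarings x.n := by
        rw [← pow_succ']; exact Nat.pow_le_pow_right (by norm_num) ht
      have h91 : s₁ 9 0 = ((rowCount k x.n * rowCount k x.n : ℕ) : ℤ) := by
        rw [hf1 9 (by norm_num) (by norm_num) (by norm_num) (by norm_num) (by norm_num)
          (by norm_num) (by norm_num), h9]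
      have hpos := Nat.two_pow_pos t
      obtain ⟨s₂, r2, hb2, hf2, h72⟩ := runs_squareProgram hb1 h91 h61 h.bits
        (h.dim_sq_le.trans (h.pow_le_int' (by norm_num)))
        (fun r c => h.abs_gram_pow_le T (2 ^ t) r c) (by
          calc ((rowCount k x.n * rowCount k x.n : ℕ) : ℤ) *
                ((Y : ℤ) ^ (10 * 2 ^ t) * Y ^ (10 * 2 ^ t))
              ≤ (Y : ℤ) ^ 2 * ((Y : ℤ) ^ (10 * 2 ^ t) * Y ^ (10 * 2 ^ t)) := by
                gcongr; exact h.dim_le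
            _ = (Y : ℤ) ^ (2 + 20 * 2 ^ t) := by ring
            _ ≤ _ := h.pow_le_int (by omega)) (κ := κ)
        (by simp only [squareProgram] at hκ ⊢; omega)
      have r2' := r2.mono (h.time_le h.dim_sq_le_W (h.dim_le_W.trans
        (Nat.pow_le_pow_right h.one_le_W (by norm_num))))
      rw [← pow_add, ← two_mul, ← pow_succ'] at h72
      obtain ⟨s₃, r3, hb3, hf3, h63⟩ := runs_copyProgram hb2
        (by rw [hf2 9 (by norm_num) (by norm_num) (by norm_num), h91]) h72 h.bits
        (h.dim_sq_le.trans (h.pow_le_int' (by norm_num)))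
        (fun r c => h.abs_gram_pow_le T (2 ^ (t + 1)) r c)
        (h.pow_le_int (by rw [pow_succ]; omega)) (κ := κ)
        (by simp only [copyProgram, squareProgram] at hκ ⊢; omega)
      have r3' := r3.mono (h.time_le h.dim_sq_le_W (Nat.one_le_pow _ _ h.one_le_W))
      have hbit : ∀ z : ℤ, |z| ≤ Y ^ 20 → bitLength (z ^ 2 ^ t * z ^ 2 ^ t) ≤ B := fun z hz => by
        refine h.bitLength_le ?_
        rw [← pow_add, abs_pow]
        calc |z| ^ (2 ^ t + 2 ^ t) ≤ ((Y : ℤ) ^ 20) ^ (2 ^ t + 2 ^ t) := by gcongr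
          _ = (Y : ℤ) ^ (20 * (2 ^ t + 2 ^ t)) := by rw [← pow_mul]
          _ ≤ _ := h.pow_le_int (by omega)
      have hsq : ∀ z : ℤ, z ^ 2 ^ t * z ^ 2 ^ t = z ^ 2 ^ (t + 1) := fun z => by
        rw [← pow_add, pow_succ, mul_two]
      have f3 : ∀ b, b ≠ 2 → b ≠ 3 → b ≠ 6 → b ≠ 7 → s₃ b = s₁ b := fun b h2 h3 h6 h7 => by
        rw [hf3 b h6 h2 h3, hf2 b h7 h2 h3]
      have r4 := Runs.set hb3 14 (.lit 0) (.mul (.var 14) (.var 14)) (κ := κ)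
        (by simp only [Program.weight, Expr.weight, bitLength_zero]; omega)
      have v14 : s₃ 14 0 = α ^ 2 ^ t := by
        rw [f3 14 (by norm_num) (by norm_num) (by norm_num) (by norm_num), h141]
      simp only [Expr.eval, v14] at r4
      have hb4 := hb3.write 14 0 (hbit α hα)
      rw [hsq] at r4 hb4
      set s₄ := s₃.write 14 0 (α ^ 2 ^ (t + 1)) with hs4
      have r5 := Runs.set hb4 15 (.lit 0) (.mul (.var 15) (.var 15)) (κ := κ)
        (by simp only [Program.weight, Expr.weight, bitLength_zero]; omega)
      have v15 : s₄ 15 0 = β ^ 2 ^ t := by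
        rw [hs4, Memory.write_of_ne (by norm_num),
          f3 15 (by norm_num) (by norm_num) (by norm_num) (by norm_num), h151]
      simp only [Expr.eval, v15] at r5
      have hb5 := hb4.write 15 0 (hbit β hβ)
      rw [hsq] at r5 hb5
      set s₅ := s₄.write 15 0 (β ^ 2 ^ (t + 1)) with hs5
      have r6 := Runs.set hb5 16 (.lit 0) (.mul (.var 16) (.var 16)) (κ := κ)
        (by simp only [Program.weight, Expr.weight, bitLength_zero]; omega)
      have v16 : s₅ 16 0 = 2 ^ 2 ^ t := by
        rw [hs5, Memory.write_of_ne (by norm_num), hs4, Memory.write_of_ne (by norm_num),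
          f3 16 (by norm_num) (by norm_num) (by norm_num) (by norm_num), h161]
      simp only [Expr.eval, v16] at r6
      have hb6 := hb5.write 16 0 (hbit 2 (by
        have : (2 : ℤ) ≤ Y := by exact_mod_cast h.two_le
        calc |(2 : ℤ)| = 2 ^ 1 := by norm_num
          _ ≤ (Y : ℤ) ^ 1 := by gcongr
          _ ≤ (Y : ℤ) ^ 20 := pow_le_pow_right₀ h.one_le (by norm_num)))
      rw [hsq] at r6 hb6
      refine ⟨_, r2'.seq (r3'.seq (r4.seq (r5.seq r6))), hb6, ?_, ?_, ?_, ?_, ?_⟩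
      · intro b h2 h3 h6 h7 h14 h15 h16
        rw [Memory.write_of_ne h16, hs5, Memory.write_of_ne h15, hs4, Memory.write_of_ne h14,
          f3 b h2 h3 h6 h7, hf1 b h2 h3 h6 h7 h14 h15 h16]
      · refine h63.congr ?_
        rw [Memory.write_of_ne (by norm_num), hs5, Memory.write_of_ne (by norm_num), hs4,
          Memory.write_of_ne (by norm_num)]
      · rw [Memory.write_of_ne (by norm_num), hs5, Memory.write_of_ne (by norm_num), hs4,
          Memory.write_same]
      · rw [Memory.write_of_ne (by norm_num), hs5, Memory.write_same]
      · rw [Memory.write_same]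
  · rintro s₁ ⟨hb1, hf1, h61, h141, h151, h161⟩
    have hn1 : s₁ 0 0 = x.n := by
      rw [hf1 0 (by norm_num) (by norm_num) (by norm_num) (by norm_num) (by norm_num) (by norm_num)
        (by norm_num), h0, initialMemory_encode_n]
    simp only [Expr.eval, hn1, h161]
    have : (x.n : ℤ) ≤ ((2 ^ 2 ^ squarings x.n : ℕ) : ℤ) := by exact_mod_cast le_two_pow_squarings x.n
    push_cast at this
    omega
  · exact ⟨hs, fun _ _ _ _ _ _ _ _ => rfl, by simpa using h6, by simpa using h14, by simpa using h15,
      by simpa using h16⟩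

theorem runs_comparison {s : Memory} (hs : s.Bits B) {u v w z : ℤ}
    (h13 : s 13 0 = u) (h14 : s 14 0 = v) (h15 : s 15 0 = w) (h17 : s 17 0 = z)
    (hκ : comparison.weight ≤ κ) :
    ∃ s', Runs comparison s (3 * (κ ^ 2 * B) + 2) s' ∧ s'.Bits B ∧ (∀ b, b ≠ 1 → s' b = s b) ∧
      s' 1 0 = if 0 ≤ u ∧ v * z ≤ w then s 1 0 else 0 := by
  simp only [comparison, Program.weight, Expr.weight, bitLength_zero, bitLength_one] at hκ
  have hB := hs.one_le
  have e1 : (Expr.add (.var 13) (.lit 1)).eval s = u + 1 := by simp only [Expr.eval, h13]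
  have e2 : (Expr.add (.sub (.var 15) (.mul (.var 14) (.var 17))) (.lit 1)).eval s
      = w - v * z + 1 := by
    simp only [Expr.eval, h14, h15, h17]
  have hfail := Runs.set hs 1 (.lit 0) (.lit 0) (κ := κ)
    (by simp only [Program.weight, Expr.weight, bitLength_zero]; omega)
  simp only [Expr.eval] at hfail
  have hbf := hs.write 1 0 (z := 0) (by simpa [bitLength] using hB)
  have k1 : (Expr.add (.var 13) (.lit 1)).weight ≤ κ := by simp only [Expr.weight, bitLength_zero, bitLength_one]; omega
  have k2 : (Expr.add (.sub (.var 15) (.mul (.var 14) (.var 17))) (.lit 1)).weight ≤ κ := by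
    simp only [Expr.weight, bitLength_zero, bitLength_one]; omega
  have hp : 1 ≤ κ ^ 2 * B := one_le_sq_mul (by omega) hB
  have t1 : κ ^ 2 * B + (κ ^ 2 * B + 1 + 1) + 1 ≤ 3 * (κ ^ 2 * B) + 2 := by
    generalize κ ^ 2 * B = p at *; omega
  have t2 : κ ^ 2 * B + (κ ^ 2 * B + κ ^ 2 * B + 1) + 1 ≤ 3 * (κ ^ 2 * B) + 2 := by
    generalize κ ^ 2 * B = p at *; omega
  have t3 : κ ^ 2 * B + κ ^ 2 * B + 1 ≤ 3 * (κ ^ 2 * B) + 2 := by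
    generalize κ ^ 2 * B = p at *; omega
  by_cases c1 : 0 ≤ u
  · by_cases c2 : v * z ≤ w
    · refine ⟨s, (Runs.ite_true hs k1 (by rw [e1]; omega)
        (Runs.ite_true hs k2 (by rw [e2]; omega) (Runs.skip s))).mono t1, hs, fun _ _ => rfl, ?_⟩
      rw [if_pos ⟨c1, c2⟩]
    · refine ⟨_, (Runs.ite_true hs k1 (by rw [e1]; omega)
        (Runs.ite_false hs k2 (by rw [e2]; omega) hfail)).mono t2, hbf,
        fun b hb => Memory.write_of_ne hb _ _, ?_⟩
      rw [if_neg (fun hc => c2 hc.2), Memory.write_same]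
  · refine ⟨_, (Runs.ite_false hs k1 (by rw [e1]; omega) hfail).mono t3, hbf,
      fun b hb => Memory.write_of_ne hb _ _, ?_⟩
    rw [if_neg (fun hc => c1 hc.1), Memory.write_same]

-- The output cell is either left alone or overwritten by 0. Running the certificates in succession,
-- starting from 1, thus computes their conjunction; the input array is preserved for the next
-- character.
open Classical in
theorem runs_certificateProgram (h : Bounds x Y W b B κ) (T : Finset (Fin k)) {s : Memory}
    (hs : s.Bits B) (h0 : s 0 = initialMemory x.encode 0) :
    ∃ s', Runs (certificateProgram T.toList) s (3600 * W ^ 8 * (κ ^ 2 * B)) s' ∧ s'.Bits B ∧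
      s' 0 = s 0 ∧
      s' 1 0 = if Certified T (x.constraints : Instance k x.n) x.γ then s 1 0 else 0 := by
  have hκ := h.weight_le T
  set J : Instance k x.n := (x.constraints : Instance k x.n) with hJ
  simp only [certificateProgram, Program.weight] at hκ
  have hκ1 : 1 ≤ κ := by omega
  have hp1 : 1 ≤ κ ^ 2 * B := one_le_sq_mul hκ1 hs.one_le
  have hn : s 0 0 = x.n := by rw [h0, initialMemory_encode_n]
  -- the sizes
  have r1 := Runs.set hs 8 (.lit 0) ((Expr.var 0).pow (k / 2)) (κ := κ)
    (by simp only [Program.weight]; omega)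
  simp only [Expr.eval_pow, Expr.eval, hn] at r1
  have ev8 : (x.n : ℤ) ^ (k / 2) = (rowCount k x.n : ℤ) := by rw [rowCount]; push_cast; rfl
  rw [ev8] at r1
  have hb1 := hs.write 8 0 (z := (rowCount k x.n : ℤ)) (h.bitLength_le (by
    rw [Nat.abs_cast]
    refine le_trans ?_ (h.pow_le_int' (e := 1) (by norm_num))
    rw [pow_one]; exact_mod_cast h.row_le))
  set s₁ := s.write 8 0 (rowCount k x.n : ℤ) with hs1
  have r2 := Runs.set hb1 9 (.lit 0) (.mul (.var 8) (.var 8)) (κ := κ)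
    (by simp only [Program.weight]; omega)
  have v8 : s₁ 8 0 = (rowCount k x.n : ℤ) := Memory.write_same _ _ _ _
  simp only [Expr.eval, v8] at r2
  rw [← Nat.cast_mul] at r2
  have hb2 := hb1.write 9 0 (z := ((rowCount k x.n * rowCount k x.n : ℕ) : ℤ)) (h.bitLength_le (by
    rw [Nat.abs_cast]
    exact h.dim_le.trans (h.pow_le_int' (by norm_num))))
  set s₂ := s₁.write 9 0 ((rowCount k x.n * rowCount k x.n : ℕ) : ℤ) with hs2
  have r3 := Runs.set hb2 10 (.lit 0) ((Expr.var 0).pow (k % 2)) (κ := κ)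
    (by simp only [Program.weight]; omega)
  have hn2 : s₂ 0 0 = x.n := by
    rw [hs2, Memory.write_of_ne (by norm_num), hs1, Memory.write_of_ne (by norm_num), hn]
  simp only [Expr.eval_pow, Expr.eval, hn2] at r3
  have ev10 : (x.n : ℤ) ^ (k % 2) = (sliceCount k x.n : ℤ) := by rw [sliceCount]; push_cast; rfl
  rw [ev10] at r3
  have hb3 := hb2.write 10 0 (z := (sliceCount k x.n : ℤ)) (h.bitLength_le (by
    rw [Nat.abs_cast]
    refine le_trans ?_ (h.pow_le_int' (e := 1) (by norm_num))
    rw [pow_one]; exact_mod_cast h.slice_le))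
  set s₃ := s₂.write 10 0 (sliceCount k x.n : ℤ) with hs3
  have f3 : ∀ b, b ≠ 8 → b ≠ 9 → b ≠ 10 → s₃ b = s b := fun b h8 h9 h10 => by
    rw [hs3, Memory.write_of_ne h10, hs2, Memory.write_of_ne h9, hs1, Memory.write_of_ne h8]
  have w8 : s₃ 8 0 = (rowCount k x.n : ℤ) := by
    rw [hs3, Memory.write_of_ne (by norm_num), hs2, Memory.write_of_ne (by norm_num), v8]
  have w9 : s₃ 9 0 = ((rowCount k x.n * rowCount k x.n : ℕ) : ℤ) := by
    rw [hs3, Memory.write_of_ne (by norm_num), hs2, Memory.write_same]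
  have w10 : s₃ 10 0 = (sliceCount k x.n : ℤ) := by rw [hs3, Memory.write_same]
  -- the tables
  obtain ⟨s₄, r4, hb4, f4, w4⟩ := runs_coeffProgram x T hb3
    (by rw [f3 0 (by norm_num) (by norm_num) (by norm_num), h0]) w9 w10 h.bits
    (h.slices_le.trans (h.pow_le_int' (by norm_num)))
    (le_trans (by rw [pow_one]; exact_mod_cast h.length_le) (h.pow_le_int' (e := 1) (by norm_num)))
    (κ := κ) (by omega)
  have r4' := r4.mono ((by
    rw [mul_comm (_ + 1) (x.constraints.length + 1)]
    exact h.time_le (h.length_le_W.trans (Nat.le_self_pow (by norm_num) _)) h.slices_le_W) : _ ≤ 60 * W ^ 7 * (κ ^ 2 * B))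
  obtain ⟨s₅, r5, hb5, f5, w5⟩ := runs_flatMatrixProgram T J hb4
    (by rw [f4 8 (by norm_num) (by norm_num) (by norm_num), w8])
    (by rw [f4 9 (by norm_num) (by norm_num) (by norm_num), w9])
    (by rw [f4 10 (by norm_num) (by norm_num) (by norm_num), w10]) w4 h.bits
    (h.dim_sq_le.trans (h.pow_le_int' (by norm_num)))
    (le_trans (by rw [pow_one]; exact_mod_cast h.slice_le) (h.pow_le_int' (e := 1) (by norm_num)))
    (h.slice_mul_le.trans (h.pow_le_int' (by norm_num))) (κ := κ) (by omega)
  have r5' := r5.mono (h.time_le h.dim_sq_le_W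
    (h.slice_le_W.trans (Nat.le_self_pow (by norm_num) _)))
  have w9' : s₅ 9 0 = ((rowCount k x.n * rowCount k x.n : ℕ) : ℤ) := by
    rw [f5 9 (by norm_num) (by norm_num) (by norm_num),
      f4 9 (by norm_num) (by norm_num) (by norm_num), w9]
  obtain ⟨s₆, r6, hb6, f6, w6⟩ := runs_gramProgram hb5 w9' w5 h.bits
    (h.dim_sq_le.trans (h.pow_le_int' (by norm_num))) (h.abs_flatMatrix_le T) (by
      calc ((rowCount k x.n * rowCount k x.n : ℕ) : ℤ) * ((Y : ℤ) ^ 3 * Y ^ 3)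
          ≤ (Y : ℤ) ^ 2 * ((Y : ℤ) ^ 3 * Y ^ 3) := by gcongr; exact h.dim_le
        _ = (Y : ℤ) ^ 8 := by ring
        _ ≤ _ := h.pow_le_int' (by norm_num)) (κ := κ) (by omega)
  have hd3 : rowCount k x.n * rowCount k x.n ≤ W ^ 3 :=
    h.dim_le_W.trans (Nat.pow_le_pow_right h.one_le_W (by norm_num))
  have r6' := r6.mono (h.time_le h.dim_sq_le_W hd3)
  have f456 : ∀ b, b ≠ 2 → b ≠ 3 → b ≠ 4 → b ≠ 5 → b ≠ 6 → s₆ b = s₃ b :=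
    fun b h2 h3 h4 h5 h6 => by rw [f6 b h6 h2 h3, f5 b h5 h2 h3, f4 b h4 h2 h3]
  have w10' : s₆ 10 0 = (sliceCount k x.n : ℤ) := by
    rw [f456 10 (by norm_num) (by norm_num) (by norm_num) (by norm_num) (by norm_num), w10]
  have w9'' : s₆ 9 0 = ((rowCount k x.n * rowCount k x.n : ℕ) : ℤ) := by
    rw [f456 9 (by norm_num) (by norm_num) (by norm_num) (by norm_num) (by norm_num), w9]
  have hm : (x.constraints.length : ℤ) ≤ Y := by exact_mod_cast h.length_le
  obtain ⟨s₇, r7, hb7, f7, w12⟩ := runs_sumSqProgram T J hb6 w9'' w10'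
    (fun a ha => by
      rw [f6 4 (by norm_num) (by norm_num) (by norm_num),
        f5 4 (by norm_num) (by norm_num) (by norm_num)]
      exact w4 a ha) h.bits
    (h.slices_le.trans (h.pow_le_int' (by norm_num))) (by
      rw [hJ, Multiset.coe_card]
      calc _ ≤ (Y : ℤ) ^ 3 * (Y * Y) := by gcongr; exact h.slices_le
        _ = (Y : ℤ) ^ 5 := by ring
        _ ≤ _ := h.pow_le_int' (by norm_num)) (κ := κ) (by omega)
  have r7' := r7.mono (h.time_le (Nat.one_le_pow _ _ h.one_le_W) h.slices_le_W)
  have f7' : ∀ b, b ≠ 2 → b ≠ 3 → b ≠ 4 → b ≠ 5 → b ≠ 6 → b ≠ 8 → b ≠ 9 → b ≠ 10 → b ≠ 12 →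
      s₇ b = s b := fun b h2 h3 h4 h5 h6 h8 h9 h10 h12 => by
    rw [f7 b h12 h2 h3, f456 b h2 h3 h4 h5 h6, f3 b h8 h9 h10]
  -- the scalars
  have v0 : s₇ 0 = initialMemory x.encode 0 := by
    rw [f7' 0 (by norm_num) (by norm_num) (by norm_num) (by norm_num) (by norm_num) (by norm_num)
      (by norm_num) (by norm_num) (by norm_num), h0]
  have v10 : s₇ 10 0 = (sliceCount k x.n : ℤ) := by
    rw [f7 10 (by norm_num) (by norm_num) (by norm_num), w10']
  have v9 : s₇ 9 0 = ((rowCount k x.n * rowCount k x.n : ℕ) : ℤ) := by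
    rw [f7 9 (by norm_num) (by norm_num) (by norm_num), w9'']
  have r8 := Runs.set hb7 13 (.lit 0) (slackExpr k) (κ := κ) (by simp only [Program.weight]; omega)
  have ev13 : (slackExpr k).eval s₇ = slack T J x.γ := by
    simp only [slackExpr, Expr.eval, v0, v10, w12, initialMemory_encode_num,
      initialMemory_encode_length, initialMemory_encode_den]
    rw [slack, hJ, Multiset.coe_card]
    ring
  simp only [ev13, Expr.eval] at r8
  have hslack := h.abs_slack_le T
  have hb8 := hb7.write 13 0 (h.bitLength_le (hslack.trans (h.pow_le_int' (by norm_num))))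
  set s₈ := s₇.write 13 0 (slack T J x.γ) with hs8
  have r9 := Runs.set hb8 14 (.lit 0) (.mul (scalingExpr k) (scalingExpr k)) (κ := κ)
    (by simp only [Program.weight]; omega)
  have ev14 : (scalingExpr k).eval s₈ = scaling k x.n x.γ := by
    have e0 : s₈ 0 = s₇ 0 := Memory.write_of_ne (by norm_num) _ _
    have e9 : s₈ 9 = s₇ 9 := Memory.write_of_ne (by norm_num) _ _
    have e10 : s₈ 10 = s₇ 10 := Memory.write_of_ne (by norm_num) _ _
    simp only [scalingExpr, Expr.eval, e0, e9, e10, v0, v9, v10, initialMemory_encode_den]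
    rw [scaling]
    push_cast
    ring
  simp only [Expr.eval, ev14] at r9
  rw [← sq] at r9
  have hsc0 := h.scaling_nonneg
  have hsc : |scaling k x.n x.γ ^ 2| ≤ (Y : ℤ) ^ 20 := by
    rw [abs_of_nonneg (by positivity)]
    calc _ ≤ ((Y : ℤ) ^ 6) ^ 2 := by gcongr; exact h.scaling_le
      _ = (Y : ℤ) ^ 12 := by ring
      _ ≤ _ := pow_le_pow_right₀ h.one_le (by norm_num)
  have hb9 := hb8.write 14 0 (h.bitLength_le (hsc.trans (h.pow_le_int' (by norm_num))))
  set s₉ := s₈.write 14 0 (scaling k x.n x.γ ^ 2) with hs9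
  have r10 := Runs.set hb9 15 (.lit 0) (.mul (.var 13) (.var 13)) (κ := κ)
    (by simp only [Program.weight]; omega)
  have v13 : s₉ 13 0 = slack T J x.γ := by
    rw [hs9, Memory.write_of_ne (by norm_num), hs8, Memory.write_same]
  simp only [Expr.eval, v13] at r10
  rw [← sq] at r10
  have hsl : |slack T J x.γ ^ 2| ≤ (Y : ℤ) ^ 20 := by
    rw [abs_pow]
    calc _ ≤ ((Y : ℤ) ^ 10) ^ 2 := by gcongr
      _ = (Y : ℤ) ^ 20 := by ring
  have hb10 := hb9.write 15 0 (h.bitLength_le (hsl.trans (h.pow_le_int' (by norm_num))))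
  set s₁₀ := s₉.write 15 0 (slack T J x.γ ^ 2) with hs10
  have r11 := Runs.set hb10 16 (.lit 0) (.lit 2) (κ := κ) (by simp only [Program.weight]; omega)
  simp only [Expr.eval] at r11
  have hb11 := hb10.write 16 0 (z := 2) (h.bitLength_le (by
    refine le_trans ?_ (h.pow_le_int' (e := 1) (by norm_num))
    rw [pow_one]
    exact_mod_cast h.two_le))
  set s₁₁ := s₁₀.write 16 0 2 with hs11
  have f11 : ∀ b, b ≠ 13 → b ≠ 14 → b ≠ 15 → b ≠ 16 → s₁₁ b = s₇ b := fun b h1 h2 h3 h4 => by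
    rw [hs11, Memory.write_of_ne h4, hs10, Memory.write_of_ne h3, hs9, Memory.write_of_ne h2, hs8,
      Memory.write_of_ne h1]
  -- the loop
  obtain ⟨s₁₂, r12, hb12, f12, w6', w14, w15⟩ := runs_squaringLoop h T hb11
    (by rw [f11 0 (by norm_num) (by norm_num) (by norm_num) (by norm_num), v0])
    (by rw [f11 9 (by norm_num) (by norm_num) (by norm_num) (by norm_num), v9])
    (w6.congr (by rw [f11 6 (by norm_num) (by norm_num) (by norm_num) (by norm_num),
      f7 6 (by norm_num) (by norm_num) (by norm_num)]))
    (α := scaling k x.n x.γ ^ 2) (β := slack T J x.γ ^ 2)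
    (by rw [hs11, Memory.write_of_ne (by norm_num), hs10, Memory.write_of_ne (by norm_num), hs9,
      Memory.write_same])
    (by rw [hs11, Memory.write_of_ne (by norm_num), hs10, Memory.write_same])
    (by rw [hs11, Memory.write_same]) hsc hsl (by omega)
  -- the trace
  have hd9 : s₁₂ 9 0 = ((rowCount k x.n * rowCount k x.n : ℕ) : ℤ) := by
    rw [f12 9 (by norm_num) (by norm_num) (by norm_num) (by norm_num) (by norm_num) (by norm_num)
      (by norm_num), f11 9 (by norm_num) (by norm_num) (by norm_num) (by norm_num), v9]
  have hLpos := Nat.two_pow_pos (squarings x.n)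
  obtain ⟨s₁₃, r13, hb13, f13, w17⟩ := runs_traceProgram hb12 hd9 w6' h.bits
    (h.dim_le.trans (h.pow_le_int' (by norm_num)))
    (fun r c => h.abs_gram_pow_le T (2 ^ squarings x.n) r c) (by
      calc ((rowCount k x.n * rowCount k x.n : ℕ) : ℤ) * (Y : ℤ) ^ (10 * 2 ^ squarings x.n)
          ≤ (Y : ℤ) ^ 2 * (Y : ℤ) ^ (10 * 2 ^ squarings x.n) := by gcongr; exact h.dim_le
        _ = (Y : ℤ) ^ (2 + 10 * 2 ^ squarings x.n) := by ring
        _ ≤ _ := h.pow_le_int (by omega)) (κ := κ) (by omega)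
  have r13' := r13.mono (h.time_le (Nat.one_le_pow _ _ h.one_le_W) hd3)
  obtain ⟨s₁₄, r14, hb14, f14, w1⟩ := runs_comparison hb13
    (by
      rw [f13 13 (by norm_num) (by norm_num) (by norm_num),
        f12 13 (by norm_num) (by norm_num) (by norm_num) (by norm_num) (by norm_num) (by norm_num)
          (by norm_num), hs11, Memory.write_of_ne (by norm_num), hs10,
        Memory.write_of_ne (by norm_num), v13])
    (by rw [f13 14 (by norm_num) (by norm_num) (by norm_num), w14])
    (by rw [f13 15 (by norm_num) (by norm_num) (by norm_num), w15])
    (z := traceMoment T J) (by rw [w17, traceMoment_eq]; rfl) (κ := κ) (by omega)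
  have hout : s₁₃ 1 = s 1 := by
    rw [f13 1 (by norm_num) (by norm_num) (by norm_num),
      f12 1 (by norm_num) (by norm_num) (by norm_num) (by norm_num) (by norm_num) (by norm_num)
        (by norm_num), f11 1 (by norm_num) (by norm_num) (by norm_num) (by norm_num),
      f7' 1 (by norm_num) (by norm_num) (by norm_num) (by norm_num) (by norm_num) (by norm_num)
      (by norm_num) (by norm_num) (by norm_num)]
  refine ⟨s₁₄, (r1.seq (r2.seq (r3.seq (r4'.seq (r5'.seq (r6'.seq (r7'.seq (r8.seq (r9.seq (r10.seq
    (r11.seq (r12.seq (r13'.seq r14))))))))))))).mono ?_, hb14, ?_, ?_⟩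
  · exact certificate_time_le hp1 h.one_le_W h.squarings_le_W
  · rw [f14 0 (by norm_num), f13 0 (by norm_num) (by norm_num) (by norm_num),
      f12 0 (by norm_num) (by norm_num) (by norm_num) (by norm_num) (by norm_num) (by norm_num)
        (by norm_num), f11 0 (by norm_num) (by norm_num) (by norm_num) (by norm_num), v0, h0]
  · rw [w1, hout]
    exact if_congr Iff.rfl rfl rfl

end

end RAM

/-! ### The complete program and its polynomial running time -/

namespace RAM

open Matrix CSP

section
variable {k : ℕ} {x : AlgInput k} {Y W b B κ : ℕ}

/-- The programs for the certificates of the characters in a list, one after another. -/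
noncomputable def certificatesProgram (l : List (Finset (Fin k))) : Program :=
  l.foldr (fun T c => .seq (certificateProgram T.toList) c) .skip

open Classical in
theorem runs_certificatesProgram (h : Bounds x Y W b B κ) (l : List (Finset (Fin k)))
    {s : Memory} (hs : s.Bits B) (h0 : s 0 = initialMemory x.encode 0) :
    ∃ s', Runs (certificatesProgram l) s (l.length * (3600 * W ^ 8 * (κ ^ 2 * B) + 1) + 1) s' ∧
      s' 1 0 =
        if ∀ T ∈ l, Certified T (x.constraints : Instance k x.n) x.γ then s 1 0 else 0 := by
  induction l generalizing s with
  | nil => exact ⟨s, (Runs.skip s).mono (by simp), by simp⟩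
  | cons T l ih =>
    obtain ⟨s₁, r1, hb1, h01, h11⟩ := runs_certificateProgram h T hs h0
    obtain ⟨s₂, r2, h12⟩ := ih hb1 (h01.trans h0)
    refine ⟨s₂, (r1.seq r2).mono ?_, ?_⟩
    · rw [List.length_cons]
      generalize 3600 * W ^ 8 * (κ ^ 2 * B) = τ
      rw [Nat.add_mul, Nat.one_mul]
      omega
    · simp only [h12, h11, List.forall_mem_cons]
      by_cases c : Certified T (x.constraints : Instance k x.n) x.γ <;> simp [c]

open Classical in
/-- The program that computes `CSP.certifier`. -/
noncomputable def certifierProgram (k : ℕ) : Program :=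
  .ite (.get 0 (.lit 2))
    (.ite (.add (.sub (.get 0 (.lit 1)) (.get 0 (.lit 0))) (.lit 1))
      (.ite (.get 0 (.lit 1))
        (.seq (.set 1 (.lit 0) (.lit 1)) (certificatesProgram
          ((Finset.univ : Finset (Finset (Fin k))).filter (·.Nonempty)).toList)) .skip) .skip) .skip

theorem squarings_le (n : ℕ) : squarings n ≤ n :=
  (Nat.clog_le_of_le_pow (Nat.lt_two_pow_self.le)).trans
    (Nat.clog_le_of_le_pow (Nat.lt_two_pow_self.le))

/-- Minimality of L makes 2^L less than twice `Nat.clog 2 n` when that logarithm exceeds 1. A linear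
bound in n is all that polynomial time requires. -/
theorem two_pow_squarings_le (n : ℕ) : 2 ^ squarings n ≤ 2 * n + 1 := by
  have hc : Nat.clog 2 n ≤ n := Nat.clog_le_of_le_pow Nat.lt_two_pow_self.le
  rw [squarings]
  rcases Nat.lt_or_ge 1 (Nat.clog 2 n) with h | h
  · have h1 := Nat.pow_pred_clog_lt_self one_lt_two h
    have h2 := Nat.clog_pos one_lt_two h
    obtain ⟨j, hj⟩ := Nat.exists_eq_add_of_le' (show 1 ≤ Nat.clog 2 (Nat.clog 2 n) from h2)
    rw [hj] at h1 ⊢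
    rw [Nat.pred_eq_sub_one, Nat.add_sub_cancel] at h1
    rw [pow_succ]
    omega
  · rw [Nat.clog_of_right_le_one h]; omega

/-- The number of steps of the certificates for inputs of a given length. -/
def timeBound {R : Type*} [CommSemiring R] (k κ : ℕ) (s : R) : R :=
  2 ^ k * (3600 * ((s + 1) ^ k) ^ 8 * (κ ^ 2 * ((k + 2) * (s + 1) * (20 * (2 * s + 1)) + 2)) + 1) +
    10 * (κ ^ 2 * ((k + 2) * (s + 1) * (20 * (2 * s + 1)) + 2)) + 10

/-- The value bound Y must dominate 2^s for the input numbers, (2^s)^k for powers of n, and 4^k; the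
exponent (k + 2)(s + 1) covers all three. The loop bound W, in contrast, must be polynomial in s,
and this is where n ≤ s is indispensable. -/
theorem bounds_of_le (hk : 1 ≤ k) {s : ℕ} (hs : inputSize x.encode ≤ s) (hn : x.n ≤ s) (hs1 : 1 ≤ s)
    {κ : ℕ} (hκ : ∀ T : Finset (Fin k), (certificateProgram T.toList).weight ≤ κ) :
    Bounds x (2 ^ ((k + 2) * (s + 1))) ((s + 1) ^ k) ((k + 2) * (s + 1) * (20 * (2 * s + 1)))
      ((k + 2) * (s + 1) * (20 * (2 * s + 1)) + 2) κ := by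
  have hlen : x.constraints.length ≤ s := (length_constraints_le x hk).trans hs
  have hsY : s ≤ 2 ^ ((k + 2) * (s + 1)) :=
    Nat.lt_two_pow_self.le.trans (Nat.pow_le_pow_right (by norm_num) (by nlinarith))
  have hpowY : ∀ e ≤ k, x.n ^ e ≤ 2 ^ ((k + 2) * (s + 1)) := fun e he => by
    calc x.n ^ e ≤ (2 ^ s) ^ e := Nat.pow_le_pow_left (hn.trans Nat.lt_two_pow_self.le) _
      _ = 2 ^ (s * e) := (pow_mul _ _ _).symm
      _ ≤ _ := Nat.pow_le_pow_right (by norm_num) (by nlinarith)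
  have hpowW : ∀ e ≤ k, x.n ^ e ≤ (s + 1) ^ k := fun e he => by
    calc x.n ^ e ≤ (s + 1) ^ e := Nat.pow_le_pow_left (by omega) _
      _ ≤ _ := Nat.pow_le_pow_right (by omega) he
  have hsW : s + 1 ≤ (s + 1) ^ k := Nat.le_self_pow (by omega) _
  have hz : ∀ z ∈ x.encode, z.natAbs ≤ 2 ^ ((k + 2) * (s + 1)) := fun z hz => by
    refine (natAbs_lt_two_pow z).le.trans (Nat.pow_le_pow_right (by norm_num) ?_)
    have := (bitLength_le_inputSize hz).trans hs
    calc bitLength z - 1 ≤ s := by omega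
      _ ≤ _ := by nlinarith
  have hmod : k % 2 ≤ k := Nat.mod_le _ _
  refine ⟨?_, hlen.trans hsY, hpowY _ (Nat.div_le_self _ _), hpowY _ hmod, ?_, ?_, ?_,
    ?_, le_rfl, Nat.one_le_pow _ _ (by omega), hpowW _ (Nat.div_le_self _ _), hpowW _ hmod,
    hlen.trans (by omega), (squarings_le _).trans (by omega), hκ⟩
  · exact Nat.le_self_pow (by positivity) 2
  · rw [Int.abs_eq_natAbs]
    exact_mod_cast hz _ (by simp [AlgInput.encode])
  · simpa using hz (x.γ.den : ℤ) (by simp [AlgInput.encode])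
  · rw [show (4 : ℕ) = 2 ^ 2 by norm_num, ← pow_mul]
    exact Nat.pow_le_pow_right (by norm_num) (by nlinarith)
  · rw [← pow_mul]
    refine Nat.pow_le_pow_right (by norm_num) (Nat.mul_le_mul_left _ (Nat.mul_le_mul_left _ ?_))
    exact (two_pow_squarings_le _).trans (by omega)

theorem certifier_eq_false {n : ℕ} {J : Instance k n} {γ : ℚ}
    (h : ¬ (0 < γ ∧ n ≤ Multiset.card J ∧ 0 < Multiset.card J)) : certifier n J γ = false := by
  rw [certifier, decide_eq_false_iff_not]
  exact fun h' => h ⟨h'.1, h'.2.1, h'.2.2.1⟩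

-- Each failed preliminary test ends the program at once, and the initial content 0 of the output
-- cell already means failure.
open Classical in
theorem exists_runs_certifierProgram (hk : 1 ≤ k) {κ : ℕ}
    (hκ : ∀ T : Finset (Fin k), (certificateProgram T.toList).weight ≤ κ) (hκ' : 20 ≤ κ)
    (x : AlgInput k) :
    ∃ s', Runs (certifierProgram k) (initialMemory x.encode)
        (timeBound k κ (inputSize x.encode)) s' ∧
      s' 1 0 = if certifier x.n (x.constraints : Instance k x.n) x.γ then 1 else 0 := by
  set s := inputSize x.encode with hs
  set B := (k + 2) * (s + 1) * (20 * (2 * s + 1)) + 2 with hB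
  have hlen4 : 4 ≤ s := by
    refine le_trans ?_ (length_le_inputSize _)
    simp [AlgInput.encode]
  have hsB : s ≤ B := by
    rw [hB]
    nlinarith [Nat.zero_le (k * (s + 1) * (20 * (2 * s + 1)))]
  have hbits : (initialMemory x.encode).Bits B := fun a i =>
    (bits_initialMemory (by simp [AlgInput.encode]) a i).trans hsB
  have w0 : (Expr.get 0 (.lit 2)).weight ≤ κ := le_trans (by decide) hκ'
  have w1 : (Expr.add (.sub (.get 0 (.lit 1)) (.get 0 (.lit 0))) (.lit 1)).weight ≤ κ :=
    le_trans (by decide) hκ'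
  have w2 : (Expr.get 0 (.lit 1)).weight ≤ κ := le_trans (by decide) hκ'
  have w3 : (Program.set 1 (.lit 0) (.lit 1)).weight ≤ κ := le_trans (by decide) hκ'
  have hout : initialMemory x.encode 1 0 = 0 := by simp [initialMemory]
  have htime : timeBound k κ s = 2 ^ k * (3600 * ((s + 1) ^ k) ^ 8 * (κ ^ 2 * B) + 1) +
      10 * (κ ^ 2 * B) + 10 := by
    rw [timeBound, hB]; simp
  rw [htime]
  by_cases c0 : 0 < x.γ
  swap
  · refine ⟨_, (Runs.ite_false hbits w0 (by
      simpa [Expr.eval, initialMemory_encode_num, Rat.num_pos] using c0) (Runs.skip _)).mono ?_, ?_⟩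
    · omega
    · rw [certifier_eq_false fun h => c0 h.1, hout]; rfl
  have e0 : 0 < (Expr.get 0 (.lit 2)).eval (initialMemory x.encode) := by
    simpa [Expr.eval, initialMemory_encode_num, Rat.num_pos] using c0
  by_cases c1 : x.n ≤ x.constraints.length
  swap
  · refine ⟨_, (Runs.ite_true hbits w0 e0 (Runs.ite_false hbits w1 (by
      simp only [Expr.eval, initialMemory_encode_n, initialMemory_encode_length]
      omega) (Runs.skip _))).mono ?_, ?_⟩
    · omega
    · rw [certifier_eq_false fun h => c1 (by simpa using h.2.1), hout]; rfl
  have e1 : 0 < (Expr.add (.sub (.get 0 (.lit 1)) (.get 0 (.lit 0))) (.lit 1)).eval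
      (initialMemory x.encode) := by
    simp only [Expr.eval, initialMemory_encode_n, initialMemory_encode_length]
    omega
  by_cases c2 : 0 < x.constraints.length
  swap
  · refine ⟨_, (Runs.ite_true hbits w0 e0 (Runs.ite_true hbits w1 e1 (Runs.ite_false hbits w2 (by
      simp only [Expr.eval, initialMemory_encode_length]
      omega) (Runs.skip _)))).mono ?_, ?_⟩
    · omega
    · rw [certifier_eq_false fun h => c2 (by simpa using h.2.2), hout]; rfl
  have e2 : 0 < (Expr.get 0 (.lit 1)).eval (initialMemory x.encode) := by
    simp only [Expr.eval, initialMemory_encode_length]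
    omega
  -- The test passed above bounds n by the number of constraints, hence by the input length.
  have hb := bounds_of_le hk hs.symm.le (c1.trans (length_constraints_le x hk)) (by omega) hκ
  have r1 := Runs.set hbits 1 (.lit 0) (.lit 1) w3
  simp only [Expr.eval] at r1
  obtain ⟨s', r2, h2⟩ := runs_certificatesProgram hb
    ((Finset.univ : Finset (Finset (Fin k))).filter (·.Nonempty)).toList
    (hbits.write 1 0 (z := 1) (le_trans (by decide) (hlen4.trans hsB)))
    (Memory.write_of_ne (by norm_num) _ _)
  refine ⟨s', (Runs.ite_true hbits w0 e0 (Runs.ite_true hbits w1 e1 (Runs.ite_true hbits w2 e2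
    (r1.seq r2)))).mono ?_, ?_⟩
  · have hc : ((Finset.univ : Finset (Finset (Fin k))).filter (·.Nonempty)).toList.length ≤ 2 ^ k := by
      rw [Finset.length_toList]
      exact (Finset.card_filter_le _ _).trans (by simp)
    have := Nat.mul_le_mul_right (3600 * ((s + 1) ^ k) ^ 8 * (κ ^ 2 * B) + 1) hc
    rw [← hB]
    generalize 3600 * ((s + 1) ^ k) ^ 8 * (κ ^ 2 * B) + 1 = τ at *
    generalize κ ^ 2 * B = p at *
    generalize ((Finset.univ : Finset (Finset (Fin k))).filter (·.Nonempty)).toList.length * τ = a at *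
    generalize 2 ^ k * τ = c at *
    omega
  · rw [h2, Memory.write_same]
    simp [certifier, c0, c1, c2]

/-- The constant κ depends on k only, since there are finitely many characters; the summand 20
covers the preliminary tests. `timeBound` makes sense in every commutative semiring, so taking it at
`Polynomial.X` yields the polynomial. -/
theorem isEfficient_certifier (hk : 1 ≤ k) : IsEfficient (k := k) certifier := by
  classical
  set κ := ∑ T : Finset (Fin k), (certificateProgram T.toList).weight + 20 with hκ
  refine ⟨certifierProgram k, timeBound k κ Polynomial.X, fun x => ?_⟩
  obtain ⟨s', ⟨t, ht, r⟩, h⟩ := exists_runs_certifierProgram hk (κ := κ) (fun T =>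
    (Finset.single_le_sum (f := fun T : Finset (Fin k) => (certificateProgram T.toList).weight)
      (fun _ _ => Nat.zero_le _) (Finset.mem_univ T)).trans (Nat.le_add_right _ _))
    (Nat.le_add_left _ _) x
  refine ⟨t, ht.trans_eq ?_, s', r, h⟩
  simp [timeBound]

end

end RAM

/-! ### Soundness: character sums as forms in the coefficient array -/

namespace CSP

open Matrix

section
variable {k n : ℕ}

theorem sliceCount_mul (k n : ℕ) : sliceCount k n * (rowCount k n * rowCount k n) = n ^ k := by
  rw [sliceCount, rowCount, ← pow_add, ← pow_add]
  congr 1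
  omega

/-- The position of a scope in the three-dimensional array of coefficients. -/
def scopeEquiv (k n : ℕ) :
    (Fin k → Fin n) ≃ Fin (sliceCount k n) × Fin (rowCount k n) × Fin (rowCount k n) :=
  finFunctionFinEquiv.trans <| (finCongr (sliceCount_mul k n).symm).trans <|
    finProdFinEquiv.symm.trans <| (Equiv.refl _).prodCongr finProdFinEquiv.symm

theorem scopeCode_injective : Function.Injective (scopeCode : (Fin k → Fin n) → ℕ) := by
  intro S S' h
  refine finFunctionFinEquiv.injective (Fin.ext ?_)
  rwa [finFunctionFinEquiv_apply, finFunctionFinEquiv_apply]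

theorem scopeCode_scopeEquiv_symm
    (p : Fin (sliceCount k n) × Fin (rowCount k n) × Fin (rowCount k n)) :
    scopeCode ((scopeEquiv k n).symm p) =
      p.1 * (rowCount k n * rowCount k n) + p.2.1 * rowCount k n + p.2.2 := by
  rw [scopeCode, ← finFunctionFinEquiv_apply]
  simp only [scopeEquiv, Equiv.symm_trans_apply, Equiv.symm_symm, Equiv.apply_symm_apply,
    Equiv.prodCongr_symm, Equiv.prodCongr_apply, Prod.map, finCongr_symm, finCongr_apply,
    Fin.val_cast, finProdFinEquiv_apply_val, Equiv.refl_symm, Equiv.refl_apply]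
  ring

theorem scopeEquiv_symm_val
    (p : Fin (sliceCount k n) × Fin (rowCount k n) × Fin (rowCount k n)) (j : Fin k) :
    ((scopeEquiv k n).symm p j : ℕ) =
      (p.1 * (rowCount k n * rowCount k n) + p.2.1 * rowCount k n + p.2.2) / n ^ (j : ℕ) % n := by
  rw [← scopeCode_scopeEquiv_symm, scopeCode, ← finFunctionFinEquiv_apply]
  conv_lhs => rw [← finFunctionFinEquiv.symm_apply_apply ((scopeEquiv k n).symm p)]
  rfl

theorem coeffArray_eq (T : Finset (Fin k)) (J : Instance k n) (i : Fin (sliceCount k n))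
    (u v : Fin (rowCount k n)) :
    coeffArray T J i u v = (J.map fun cS =>
      if cS.2 = (scopeEquiv k n).symm (i, u, v) then ∏ j ∈ T, ((cS.1 j : ℤˣ) : ℤ) else 0).sum := by
  rw [coeffArray, coeff]
  congr 1
  refine Multiset.map_congr rfl fun cS _ => ?_
  refine if_congr ?_ rfl rfl
  rw [← scopeCode_scopeEquiv_symm (i, u, v)]
  exact scopeCode_injective.eq_iff

theorem sum_range_eq_sum_scope (f : ℕ → ℤ) :
    ∑ a ∈ Finset.range (sliceCount k n * (rowCount k n * rowCount k n)), f a =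
      ∑ i : Fin (sliceCount k n), ∑ u : Fin (rowCount k n), ∑ v : Fin (rowCount k n),
        f (i * (rowCount k n * rowCount k n) + u * rowCount k n + v) := by
  rw [Finset.sum_range, ← finProdFinEquiv.sum_comp, Fintype.sum_prod_type]
  refine Finset.sum_congr rfl fun i _ => ?_
  rw [← finProdFinEquiv.sum_comp, Fintype.sum_prod_type]
  refine Finset.sum_congr rfl fun u _ => Finset.sum_congr rfl fun v _ => ?_
  simp only [finProdFinEquiv_apply_val]
  congr 1
  ring

theorem sumSq_eq (T : Finset (Fin k)) (J : Instance k n) :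
    sumSq T J = ∑ i, ∑ u, ∑ v, coeffArray T J i u v ^ 2 := by
  rw [sumSq, sum_range_eq_sum_scope fun a => coeff T J a * coeff T J a]
  simp only [coeffArray, sq]

/-- The character sum over the constraints of an instance. -/
def charSum (T : Finset (Fin k)) (J : Instance k n) (x : Fin n → ℤˣ) : ℝ :=
  (J.map fun cS => ((∏ j ∈ T, (cS.1 j * x (cS.2 j)) : ℤˣ) : ℤ)).sum

/-- The value of the monomial depends only on the scope, so the constraints are grouped by scope and
their signs are collected in the coefficient. -/
theorem charSum_eq (T : Finset (Fin k)) (J : Instance k n) (x : Fin n → ℤˣ) :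
    charSum T J x = ∑ i, ∑ u, ∑ v, (coeffArray T J i u v : ℝ) *
      ((∏ j ∈ T, x ((scopeEquiv k n).symm (i, u, v) j) : ℤˣ) : ℤ) := by
  rw [charSum]
  simp only [coeffArray_eq]
  simp only [← Int.cast_mul, ← Int.cast_sum]
  congr 1
  rw [← Finset.sum_congr rfl fun i _ => Fintype.sum_prod_type
    (f := fun p : Fin (rowCount k n) × Fin (rowCount k n) => (J.map fun cS =>
      if cS.2 = (scopeEquiv k n).symm (i, p) then ∏ j ∈ T, ((cS.1 j : ℤˣ) : ℤ) else 0).sum *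
      ((∏ j ∈ T, x ((scopeEquiv k n).symm (i, p) j) : ℤˣ) : ℤ))]
  rw [← Fintype.sum_prod_type (f := fun p => (J.map fun cS =>
      if cS.2 = (scopeEquiv k n).symm p then ∏ j ∈ T, ((cS.1 j : ℤˣ) : ℤ) else 0).sum *
      ((∏ j ∈ T, x ((scopeEquiv k n).symm p j) : ℤˣ) : ℤ)),
    (scopeEquiv k n).symm.sum_comp fun S => (J.map fun cS =>
      if cS.2 = S then ∏ j ∈ T, ((cS.1 j : ℤˣ) : ℤ) else 0).sum * ((∏ j ∈ T, x (S j) : ℤˣ) : ℤ)]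
  induction J using Multiset.induction_on with
  | empty => simp
  | cons e J ih =>
    simp only [Multiset.map_cons, Multiset.sum_cons, add_mul, Finset.sum_add_distrib, ← ih,
      ite_mul, zero_mul, Finset.sum_ite_eq, Finset.mem_univ, if_true]
    rw [Finset.prod_mul_distrib]
    push_cast
    rfl

theorem add_mul_pow_div_mod {a t h j : ℕ} (hj : j < h) :
    (a + n ^ h * t) / n ^ j % n = a / n ^ j % n := by
  rcases Nat.eq_zero_or_pos n with rfl | hn
  · rw [zero_pow (by omega), Nat.zero_mul, Nat.add_zero]
  obtain ⟨d, rfl⟩ := Nat.exists_eq_add_of_lt hj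
  rw [show n ^ (j + d + 1) * t = n ^ j * (n * (n ^ d * t)) by ring,
    Nat.add_mul_div_left _ _ (pow_pos hn j), Nat.add_mul_mod_self_left]

/-- In base n, the code of a scope has v as its lowest ⌊k/2⌋ digits, u as the next ⌊k/2⌋, and i as
the remaining one if k is odd. Each variable of the monomial is read off from exactly one of the
three. -/
theorem exists_char_factorization (T : Finset (Fin k)) (x : Fin n → ℤˣ) :
    ∃ (A : Fin (sliceCount k n) → ℤˣ) (B C : Fin (rowCount k n) → ℤˣ), ∀ i u v,
      ∏ j ∈ T, x ((scopeEquiv k n).symm (i, u, v) j) = A i * (B u * C v) := by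
  -- Extending the assignment by 1 to all natural numbers avoids range proofs for digits.
  set y : ℕ → ℤˣ := fun a => if h : a < n then x ⟨a, h⟩ else 1 with hy
  refine ⟨fun i => ∏ j ∈ T, if (j : ℕ) < k / 2 + k / 2 then 1 else
      y (i / n ^ ((j : ℕ) - k / 2 - k / 2) % n),
    fun u => ∏ j ∈ T, if (j : ℕ) < k / 2 then 1 else if (j : ℕ) < k / 2 + k / 2 then
      y (u / n ^ ((j : ℕ) - k / 2) % n) else 1,
    fun v => ∏ j ∈ T, if (j : ℕ) < k / 2 then y (v / n ^ (j : ℕ) % n) else 1, fun i u v => ?_⟩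
  rw [← Finset.prod_mul_distrib, ← Finset.prod_mul_distrib]
  refine Finset.prod_congr rfl fun j _ => ?_
  have h1 : x ((scopeEquiv k n).symm (i, u, v) j) = y ((scopeEquiv k n).symm (i, u, v) j : ℕ) := by
    rw [hy]; simp
  rw [h1, scopeEquiv_symm_val]
  have e1 : (i : ℕ) * (rowCount k n * rowCount k n) + u * rowCount k n + v =
      v + n ^ (k / 2) * (u + n ^ (k / 2) * i) := by
    rw [show n ^ (k / 2) = rowCount k n from rfl]; ring
  have hv : (v : ℕ) / n ^ (k / 2) = 0 := Nat.div_eq_of_lt v.2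
  have hu : (u : ℕ) / n ^ (k / 2) = 0 := Nat.div_eq_of_lt u.2
  have hN : 0 < n ^ (k / 2) := lt_of_le_of_lt (Nat.zero_le _) v.2
  rw [e1]
  by_cases c1 : (j : ℕ) < k / 2
  · rw [add_mul_pow_div_mod c1]
    simp [c1, Nat.lt_of_lt_of_le c1 (Nat.le_add_left _ _)]
  · obtain ⟨d, hd⟩ := Nat.exists_eq_add_of_le (not_lt.1 c1)
    have e2 : (v + n ^ (k / 2) * (u + n ^ (k / 2) * i)) / n ^ (j : ℕ) =
        (u + n ^ (k / 2) * i) / n ^ d := by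
      rw [hd, pow_add, ← Nat.div_div_eq_div_mul, Nat.add_mul_div_left _ _ hN, hv, Nat.zero_add]
    rw [e2]
    have e3 : (j : ℕ) - k / 2 = d := by omega
    by_cases c2 : (j : ℕ) < k / 2 + k / 2
    · rw [add_mul_pow_div_mod (by omega : d < k / 2)]
      simp [c1, c2, e3]
    · obtain ⟨d', hd'⟩ := Nat.exists_eq_add_of_le (show k / 2 ≤ d by omega)
      have e4 : (u + n ^ (k / 2) * i) / n ^ d = i / n ^ d' := by
        rw [hd', pow_add, ← Nat.div_div_eq_div_mul, Nat.add_mul_div_left _ _ hN, hu, Nat.zero_add]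
      rw [e4]
      have e5 : (j : ℕ) - k / 2 - k / 2 = d' := by omega
      simp [c1, c2, e5]

end

end CSP

/-! ### Soundness: the spectral bound -/

namespace Matrix

open scoped Matrix.Norms.L2Operator

theorem dotProduct_mulVec_sq_le {m n : Type*} [Fintype m] [Fintype n] [DecidableEq n]
    (A : Matrix m n ℝ) (u : m → ℝ) (v : n → ℝ) :
    (u ⬝ᵥ A *ᵥ v) ^ 2 ≤ (∑ a, u a ^ 2) * (‖A‖ ^ 2 * ∑ b, v b ^ 2) := by
  classical
  refine (Finset.sum_mul_sq_le_sq_mul_sq _ _ _).trans ?_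
  gcongr
  exact sum_mulVec_sq_le A v

theorem units_int_cast_sq (u : ℤˣ) : ((u : ℤ) : ℝ) ^ 2 = 1 := by
  rw [sq, units_int_cast_mul_self]

/-- Cauchy–Schwarz over i eliminates A. Expanding the squares of the slices and separating the pairs
of equal positions leaves a bilinear form of `offDiag w` at the sign vectors B ⊗ B and C ⊗ C; on
equal positions all signs cancel. -/
theorem sum_signs_sq_le {ι α β : Type*} [Fintype ι] [Fintype α] [Fintype β] [DecidableEq α]
    [DecidableEq β] (w : ι → α → β → ℝ) (A : ι → ℤˣ) (B : α → ℤˣ) (C : β → ℤˣ) :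
    (∑ i, ∑ a, ∑ b, w i a b * ((A i * (B a * C b) : ℤˣ) : ℤ)) ^ 2 ≤
      Fintype.card ι * (∑ i, ∑ a, ∑ b, w i a b ^ 2 +
        Fintype.card α * Fintype.card β * ‖offDiag w‖) := by
  set g : ι → ℝ := fun i => ∑ a, ∑ b, w i a b * (B a : ℤ) * (C b : ℤ) with hg
  set U : α × α → ℝ := fun r => (B r.1 : ℤ) * (B r.2 : ℤ) with hU
  set V : β × β → ℝ := fun r => (C r.1 : ℤ) * (C r.2 : ℤ) with hV
  have h1 : (∑ i, ∑ a, ∑ b, w i a b * ((A i * (B a * C b) : ℤˣ) : ℤ)) ^ 2 ≤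
      Fintype.card ι * ∑ i, g i ^ 2 := by
    have e : ∀ i, ∑ a, ∑ b, w i a b * ((A i * (B a * C b) : ℤˣ) : ℤ) = (A i : ℤ) * g i := by
      intro i
      simp only [hg, Finset.mul_sum]
      refine Finset.sum_congr rfl fun a _ => Finset.sum_congr rfl fun b _ => ?_
      push_cast
      ring
    simp only [e]
    refine sq_sum_le_card_mul_sum_sq.trans_eq ?_
    simp only [mul_pow, units_int_cast_sq, one_mul, Finset.card_univ]
  have h2 : ∑ i, g i ^ 2 = ∑ i, ∑ a, ∑ b, w i a b ^ 2 + U ⬝ᵥ offDiag w *ᵥ V := by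
    have e1 : U ⬝ᵥ offDiag w *ᵥ V = ∑ i, ∑ r : α × α, ∑ c : β × β,
        (if r.1 = r.2 ∧ c.1 = c.2 then 0 else w i r.1 c.1 * w i r.2 c.2) * (U r * V c) := by
      simp only [dotProduct, mulVec, offDiag, of_apply, Finset.mul_sum, Finset.sum_mul]
      rw [Finset.sum_comm (γ := ι)]
      refine Finset.sum_congr rfl fun r _ => ?_
      rw [Finset.sum_comm (γ := ι)]
      refine Finset.sum_congr rfl fun c _ => Finset.sum_congr rfl fun i _ => ?_
      ring
    have e2 : ∀ i, g i ^ 2 = ∑ r : α × α, ∑ c : β × β,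
        w i r.1 c.1 * w i r.2 c.2 * (U r * V c) := by
      intro i
      rw [sq, hg, Finset.sum_mul_sum, Fintype.sum_prod_type]
      refine Finset.sum_congr rfl fun a _ => Finset.sum_congr rfl fun a' _ => ?_
      rw [Finset.sum_mul_sum, Fintype.sum_prod_type]
      refine Finset.sum_congr rfl fun b _ => Finset.sum_congr rfl fun b' _ => ?_
      simp only [hU, hV]
      ring
    have e3 : ∀ i, ∑ a, ∑ b, w i a b ^ 2 = ∑ r : α × α, ∑ c : β × β,
        (if r.1 = r.2 ∧ c.1 = c.2 then w i r.1 c.1 * w i r.2 c.2 else 0) * (U r * V c) := by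
      intro i
      rw [Fintype.sum_prod_type]
      refine Finset.sum_congr rfl fun a _ => ?_
      rw [Finset.sum_eq_single a (fun a' _ h => ?_) (by simp)]
      · rw [Fintype.sum_prod_type]
        refine Finset.sum_congr rfl fun b _ => ?_
        rw [Finset.sum_eq_single b (fun b' _ h => ?_) (by simp)]
        · simp only [hU, hV, units_int_cast_mul_self, and_self, if_true]; ring
        · simp [Ne.symm h]
      · simp [Ne.symm h]
    rw [e1, ← Finset.sum_add_distrib]
    refine Finset.sum_congr rfl fun i _ => ?_
    rw [e2, e3, ← Finset.sum_add_distrib]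
    refine Finset.sum_congr rfl fun r _ => ?_
    rw [← Finset.sum_add_distrib]
    refine Finset.sum_congr rfl fun c _ => ?_
    split_ifs <;> ring
  -- The vectors U and V have entries ±1, so their squared lengths are (card α)² and (card β)².
  have h3 : U ⬝ᵥ offDiag w *ᵥ V ≤ Fintype.card α * Fintype.card β * ‖offDiag w‖ := by
    refine le_of_sq_le_sq (?_ : _ ^ 2 ≤ _ ^ 2) (by positivity)
    refine (dotProduct_mulVec_sq_le _ _ _).trans_eq ?_
    have hU1 : ∀ r, U r ^ 2 = 1 := fun r => by rw [hU]; simp [mul_pow, units_int_cast_sq]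
    have hV1 : ∀ r, V r ^ 2 = 1 := fun r => by rw [hV]; simp [mul_pow, units_int_cast_sq]
    simp only [hU1, hV1, Finset.sum_const, Finset.card_univ, Fintype.card_prod, nsmul_eq_mul]
    push_cast
    ring
  refine h1.trans ?_
  rw [h2]
  gcongr

end Matrix

/-! ### Soundness: from the integer test to total variation distance -/

namespace CSP

open Matrix
open scoped Matrix.Norms.L2Operator

section
variable {k n : ℕ}

theorem offDiag_map {ι α β : Type*} [Fintype ι] [Fintype α] [Fintype β] [DecidableEq ι]
    [DecidableEq α] [DecidableEq β] (w : ι → α → β → ℤ) :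
    offDiag (fun i a b => (w i a b : ℝ)) = (offDiag w).map (Int.castRingHom ℝ) := by
  ext r c
  simp only [offDiag, of_apply, map_apply, map_sum, apply_ite (Int.castRingHom ℝ), map_mul, map_zero,
    eq_intCast]

theorem cast_traceMoment (T : Finset (Fin k)) (J : Instance k n) :
    (traceMoment T J : ℝ) = trace ((offDiag (fun i a b => (coeffArray T J i a b : ℝ)) *
      (offDiag (fun i a b => (coeffArray T J i a b : ℝ)))ᵀ) ^ 2 ^ squarings n) := by
  rw [offDiag_map, ← transpose_map, ← Matrix.map_mul, traceMoment]
  have h := map_pow (Int.castRingHom ℝ).mapMatrix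
    (offDiag (coeffArray T J) * (offDiag (coeffArray T J))ᵀ) (2 ^ squarings n)
  rw [RingHom.mapMatrix_apply, RingHom.mapMatrix_apply] at h
  rw [← h]
  simp [trace]

/-- The integer test is the bound of `sum_signs_sq_le` cleared of denominators: the slack is what
the sum of squares leaves for the norm, and `scaling` is the factor in front of the norm. -/
theorem Certified.charSum_sq_le {T : Finset (Fin k)} {J : Instance k n} {γ : ℚ}
    (h : Certified T J γ) (x : Fin n → ℤˣ) :
    4 ^ k * charSum T J x ^ 2 ≤ (γ : ℝ) ^ 2 * (Multiset.card J : ℝ) ^ 2 := by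
  obtain ⟨A, B, C, hABC⟩ := exists_char_factorization T x
  obtain ⟨h0, h1⟩ := h
  set w : Fin (sliceCount k n) → Fin (rowCount k n) → Fin (rowCount k n) → ℝ :=
    fun i a b => (coeffArray T J i a b : ℝ) with hw
  have hf := sum_signs_sq_le w A B C
  rw [Fintype.card_fin, Fintype.card_fin] at hf
  have hch : charSum T J x = ∑ i, ∑ a, ∑ b, w i a b * ((A i * (B a * C b) : ℤˣ) : ℤ) := by
    rw [charSum_eq]
    simp only [hABC, hw]
  rw [← hch] at hf
  have hD : ∑ i, ∑ a, ∑ b, w i a b ^ 2 = (sumSq T J : ℝ) := by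
    rw [sumSq_eq]; push_cast; rfl
  rw [hD] at hf
  have hn := norm_pow_le_trace (offDiag w) (squarings n)
  rw [← cast_traceMoment] at hn
  have h0' : (0 : ℝ) ≤ slack T J γ := by exact_mod_cast h0
  have h1' : ((scaling k n γ : ℝ) ^ 2) ^ 2 ^ squarings n * traceMoment T J ≤
      ((slack T J γ : ℝ) ^ 2) ^ 2 ^ squarings n := by exact_mod_cast h1
  -- Extraction of the root of order 2 · 2^L; it relies on the slack being nonnegative, which the
  -- even powers in the second inequality could not detect.
  have h2 : (scaling k n γ : ℝ) * ‖offDiag w‖ ≤ slack T J γ := by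
    refine le_of_pow_le_pow_left₀ (n := 2 * 2 ^ squarings n) (by positivity) h0' ?_
    rw [← pow_mul, ← pow_mul] at h1'
    rw [mul_pow]
    exact (mul_le_mul_of_nonneg_left hn (by rw [pow_mul]; positivity)).trans h1'
  have hγ : (γ : ℝ) = γ.num / γ.den := by exact_mod_cast γ.num_div_den.symm
  have hd : (0 : ℝ) < γ.den := by exact_mod_cast γ.den_pos
  have h3 : (sliceCount k n : ℝ) * (4 ^ k * (γ.den : ℝ) ^ 2) *
      (sumSq T J + rowCount k n * rowCount k n * ‖offDiag w‖) ≤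
        (γ.num : ℝ) ^ 2 * (Multiset.card J : ℝ) ^ 2 := by
    rw [scaling, slack] at h2
    push_cast at h2
    linarith
  rw [hγ, div_pow, div_mul_eq_mul_div, le_div_iff₀ (by positivity)]
  refine le_trans ?_ h3
  calc 4 ^ k * charSum T J x ^ 2 * (γ.den : ℝ) ^ 2 = (4 ^ k * (γ.den : ℝ) ^ 2) * charSum T J x ^ 2 := by
        ring
    _ ≤ (4 ^ k * (γ.den : ℝ) ^ 2) * (sliceCount k n *
        (sumSq T J + rowCount k n * rowCount k n * ‖offDiag w‖)) := by gcongr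
    _ = _ := by ring

theorem prod_one_add_units_eq {ι : Type*} [Fintype ι] [DecidableEq ι] (α : ι → ℤˣ) :
    ∏ i, (1 + ((α i : ℤ) : ℝ)) = if α = 1 then 2 ^ Fintype.card ι else 0 := by
  split_ifs with h
  · rw [h]; norm_num
  · obtain ⟨i, hi⟩ := Function.ne_iff.1 h
    refine Finset.prod_eq_zero (Finset.mem_univ i) ?_
    rw [Int.units_ne_iff_eq_neg.1 hi]
    simp

/-- Fourier inversion: 2^k times the indicator of equality with α is the product of the factors 1 +
α_i y_i, which expands into the characters. -/
theorem countP_eq (J : Instance k n) (x : Fin n → ℤˣ) (α : Fin k → ℤˣ) :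
    (2 : ℝ) ^ k * (J.countP (fun cS => (fun i => cS.1 i * x (cS.2 i)) = α) : ℝ) =
      ∑ T : Finset (Fin k), ((∏ j ∈ T, α j : ℤˣ) : ℤ) * charSum T J x := by
  simp only [charSum]
  induction J using Multiset.induction_on with
  | empty => simp
  | cons e J ih =>
    simp only [Multiset.map_cons, Multiset.sum_cons, Int.cast_add, mul_add, Finset.sum_add_distrib,
      ← ih, Multiset.countP_cons, Nat.cast_add]
    rw [add_comm]
    congr 1
    have h := prod_one_add_units_eq (fun i => α i * (e.1 i * x (e.2 i)))
    rw [Finset.prod_one_add, Finset.powerset_univ, Fintype.card_fin] at h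
    have e1 : ∀ T : Finset (Fin k), (((∏ j ∈ T, α j : ℤˣ) : ℤ) : ℝ) *
        (((∏ j ∈ T, (e.1 j * x (e.2 j)) : ℤˣ) : ℤ) : ℝ) =
          ∏ j ∈ T, (((α j * (e.1 j * x (e.2 j)) : ℤˣ) : ℤ) : ℝ) := fun T => by
      rw [← Int.cast_mul, ← Units.val_mul, ← Finset.prod_mul_distrib]
      push_cast
      rfl
    simp only [e1, h]
    have e2 : ((fun i => e.1 i * x (e.2 i)) = α) ↔ ((fun i => α i * (e.1 i * x (e.2 i))) = 1) := by
      constructor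
      · rintro rfl
        funext i
        exact Int.units_mul_self _
      · intro h
        funext i
        have := congrFun h i
        simp only [Pi.one_apply] at this
        rw [← mul_left_cancel_iff (a := α i), this, Int.units_mul_self]
    simp only [e2]
    split_ifs <;> simp

theorem charSum_empty (J : Instance k n) (x : Fin n → ℤˣ) : charSum ∅ J x = Multiset.card J := by
  simp [charSum]

/-- The empty set contributes exactly the uniform distribution. The other characters, fewer than 2^k
in number, move each probability by at most c / 2^k; summation over α even gives c / 2. -/
theorem tvDist_le {J : Instance k n} (hJ : 0 < Multiset.card J) (x : Fin n → ℤˣ) {c : ℝ} (hc : 0 ≤ c)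
    (h : ∀ T : Finset (Fin k), T.Nonempty → 2 ^ k * |charSum T J x| ≤ c * Multiset.card J) :
    tvDist (inducedDist J x) (uniformDist k) ≤ c := by
  have hm : (0 : ℝ) < Multiset.card J := by exact_mod_cast hJ
  have h1 : ∀ α, |inducedDist J x α - uniformDist k α| ≤ c / 2 ^ k := by
    intro α
    have e1 := countP_eq J x α
    rw [← Finset.add_sum_erase _ _ (Finset.mem_univ ∅), charSum_empty, Finset.prod_empty] at e1
    have e2 : 2 ^ k * (2 ^ k * (Multiset.card J * (inducedDist J x α - uniformDist k α))) =
        ∑ T ∈ Finset.univ.erase (∅ : Finset (Fin k)),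
          (((∏ j ∈ T, α j : ℤˣ) : ℤ) : ℝ) * (2 ^ k * charSum T J x) := by
      have e3 : ∑ T ∈ Finset.univ.erase (∅ : Finset (Fin k)),
          (((∏ j ∈ T, α j : ℤˣ) : ℤ) : ℝ) * (2 ^ k * charSum T J x) =
          2 ^ k * ∑ T ∈ Finset.univ.erase (∅ : Finset (Fin k)),
            (((∏ j ∈ T, α j : ℤˣ) : ℤ) : ℝ) * charSum T J x := by
        rw [Finset.mul_sum]
        exact Finset.sum_congr rfl fun T _ => by ring
      rw [e3]
      congr 1
      rw [← add_left_cancel_iff (a := ((((1 : ℤˣ) : ℤ) : ℝ) * (Multiset.card J : ℝ))), ← e1,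
        inducedDist, uniformDist]
      field_simp
      simp
    have e4 : |2 ^ k * (2 ^ k * (Multiset.card J * (inducedDist J x α - uniformDist k α)))| ≤
        2 ^ k * (c * Multiset.card J) := by
      rw [e2]
      refine (Finset.abs_sum_le_sum_abs _ _).trans ?_
      calc _ ≤ ∑ T ∈ Finset.univ.erase (∅ : Finset (Fin k)), c * (Multiset.card J : ℝ) := by
            refine Finset.sum_le_sum fun T hT => ?_
            rw [abs_mul, abs_mul, abs_of_pos (by positivity : (0 : ℝ) < 2 ^ k)]
            have : |(((∏ j ∈ T, α j : ℤˣ) : ℤ) : ℝ)| = 1 := by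
              rw [← Int.cast_abs, Int.isUnit_iff_abs_eq.1 (Units.isUnit _), Int.cast_one]
            rw [this, one_mul]
            exact h T (Finset.nonempty_iff_ne_empty.2 (Finset.ne_of_mem_erase hT))
        _ ≤ _ := by
            rw [Finset.sum_const, nsmul_eq_mul]
            refine mul_le_mul_of_nonneg_right ?_ (by positivity)
            exact_mod_cast (Finset.card_le_univ _).trans (by simp)
    rw [abs_mul, abs_mul, abs_mul, abs_of_pos (by positivity : (0 : ℝ) < 2 ^ k), abs_of_pos hm] at e4
    rw [le_div_iff₀ (by positivity)]
    have e5 := le_of_mul_le_mul_left e4 (by positivity)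
    refine le_of_mul_le_mul_right (a := (Multiset.card J : ℝ)) ?_ hm
    linarith
  rw [tvDist]
  calc 1 / 2 * ∑ α, |inducedDist J x α - uniformDist k α| ≤ 1 / 2 * ∑ α : Fin k → ℤˣ, c / 2 ^ k := by
        gcongr with α
        exact h1 α
    _ = c / 2 := by
        rw [Finset.sum_const, nsmul_eq_mul, Finset.card_univ, Fintype.card_fun, Fintype.card_fin]
        simp
        field_simp
    _ ≤ c := by linarith

theorem isQuasirandom_of_certifier {J : Instance k n} {γ : ℚ} (h : certifier n J γ = true) :
    IsQuasirandom (γ : ℝ) J := by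
  classical
  simp only [certifier, decide_eq_true_eq] at h
  obtain ⟨hγ, -, hm, hT⟩ := h
  refine ⟨Multiset.card_pos.1 hm, fun x => tvDist_le hm x (by exact_mod_cast hγ.le) fun T hT' => ?_⟩
  have h := (hT T hT').charSum_sq_le x
  have hγ' : (0 : ℝ) < γ := by exact_mod_cast hγ
  refine abs_le_of_sq_le_sq' ?_ (by positivity) |>.2
  rw [mul_pow, mul_pow, sq_abs, ← pow_mul, mul_comm k 2, pow_mul]
  norm_num
  exact h

end

end CSP

/-! ### Independent Boolean variables and tail bounds -/

namespace CSP

open Matrix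
open scoped Classical

section
variable {E F : Type*} [Fintype E] [Fintype F]

/-- The probability of `ω` if the values `true` have probability `p`, independently. -/
noncomputable def bernoulliWeight (p : ℝ) (ω : E → Bool) : ℝ := ∏ e, if ω e then p else 1 - p

/-- The expectation of `X` if the values `true` have probability `p`, independently. -/
noncomputable def bernoulliExp (p : ℝ) (X : (E → Bool) → ℝ) : ℝ := ∑ ω, bernoulliWeight p ω * X ω

/-- The probability of `Q` if the values `true` have probability `p`, independently. -/
noncomputable def bernoulliProb (p : ℝ) (Q : (E → Bool) → Prop) : ℝ :=
  bernoulliExp p fun ω => if Q ω then 1 else 0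

variable {p : ℝ}

theorem bernoulliWeight_nonneg (h0 : 0 ≤ p) (h1 : p ≤ 1) (ω : E → Bool) :
    0 ≤ bernoulliWeight p ω :=
  Finset.prod_nonneg fun e _ => by split_ifs <;> linarith

theorem bernoulliExp_prod (g : E → Bool → ℝ) :
    bernoulliExp p (fun ω => ∏ e, g e (ω e)) = ∏ e, (p * g e true + (1 - p) * g e false) := by
  have h := Finset.prod_univ_sum (fun _ : E => (Finset.univ : Finset Bool))
    (fun e b => (if b then p else 1 - p) * g e b)
  simp only [Fintype.piFinset_univ, Fintype.sum_bool, if_true, Bool.false_eq_true, if_false] at h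
  rw [h]
  simp only [bernoulliExp, bernoulliWeight, Finset.prod_mul_distrib]

/-- Independence of the families belonging to different first coordinates. -/
theorem bernoulliExp_slices (G : E → (F → Bool) → ℝ) :
    bernoulliExp p (fun ω : E × F → Bool => ∏ i, G i fun x => ω (i, x)) =
      ∏ i, bernoulliExp p (G i) := by
  have h := Finset.prod_univ_sum (fun _ : E => (Finset.univ : Finset (F → Bool)))
    (fun i ω => bernoulliWeight p ω * G i ω)
  simp only [Fintype.piFinset_univ] at h
  simp only [bernoulliExp]
  rw [h, ← (Equiv.curry E F Bool).sum_comp]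
  refine Finset.sum_congr (by ext; simp) fun ω _ => ?_
  rw [Finset.prod_mul_distrib]
  congr 1
  simp only [bernoulliWeight]
  rw [Fintype.prod_prod_type]
  rfl

theorem bernoulliExp_comp_equiv (σ : E ≃ F) (X : (E → Bool) → ℝ) :
    bernoulliExp p (fun ω : F → Bool => X (ω ∘ σ)) = bernoulliExp p X := by
  simp only [bernoulliExp]
  rw [← (σ.arrowCongr (Equiv.refl Bool)).sum_comp]
  refine Finset.sum_congr rfl fun ω _ => ?_
  congr 1
  · simp only [bernoulliWeight]
    rw [← σ.prod_comp]
    simp [Equiv.arrowCongr]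
  · congr 1
    funext e
    simp [Equiv.arrowCongr]

theorem bernoulliExp_const (c : ℝ) : bernoulliExp p (fun _ : E → Bool => c) = c := by
  have h := bernoulliExp_prod (p := p) (fun (_ : E) _ => 1)
  simp only [Finset.prod_const_one, mul_one, add_sub_cancel] at h
  simp only [bernoulliExp, mul_one] at h ⊢
  rw [← Finset.sum_mul, h, one_mul]

theorem bernoulliExp_mono (h0 : 0 ≤ p) (h1 : p ≤ 1) {X Y : (E → Bool) → ℝ} (h : ∀ ω, X ω ≤ Y ω) :
    bernoulliExp p X ≤ bernoulliExp p Y :=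
  Finset.sum_le_sum fun ω _ => mul_le_mul_of_nonneg_left (h ω) (bernoulliWeight_nonneg h0 h1 ω)

theorem bernoulliExp_add (X Y : (E → Bool) → ℝ) :
    bernoulliExp p (fun ω => X ω + Y ω) = bernoulliExp p X + bernoulliExp p Y := by
  simp only [bernoulliExp, mul_add, Finset.sum_add_distrib]

theorem bernoulliExp_sum {κ : Type*} (s : Finset κ) (X : κ → (E → Bool) → ℝ) :
    bernoulliExp p (fun ω => ∑ t ∈ s, X t ω) = ∑ t ∈ s, bernoulliExp p (X t) := by
  simp only [bernoulliExp, Finset.mul_sum]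
  exact Finset.sum_comm

theorem bernoulliExp_const_mul (c : ℝ) (X : (E → Bool) → ℝ) :
    bernoulliExp p (fun ω => c * X ω) = c * bernoulliExp p X := by
  simp only [bernoulliExp, Finset.mul_sum]
  exact Finset.sum_congr rfl fun ω _ => by ring

theorem bernoulliProb_le_of_le (h0 : 0 ≤ p) (h1 : p ≤ 1) {Q : (E → Bool) → Prop}
    {X : (E → Bool) → ℝ} (hX : ∀ ω, 0 ≤ X ω) (h : ∀ ω, Q ω → 1 ≤ X ω) :
    bernoulliProb p Q ≤ bernoulliExp p X :=
  bernoulliExp_mono h0 h1 fun ω => by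
    split_ifs with hQ
    · exact h ω hQ
    · exact hX ω

theorem bernoulliProb_mono (h0 : 0 ≤ p) (h1 : p ≤ 1) {Q R : (E → Bool) → Prop}
    (h : ∀ ω, Q ω → R ω) : bernoulliProb p Q ≤ bernoulliProb p R :=
  bernoulliProb_le_of_le h0 h1 (fun ω => by split_ifs <;> norm_num) fun ω hQ => by
    rw [if_pos (h ω hQ)]

theorem bernoulliProb_le_one (h0 : 0 ≤ p) (h1 : p ≤ 1) (Q : (E → Bool) → Prop) :
    bernoulliProb p Q ≤ 1 :=
  (bernoulliProb_le_of_le h0 h1 (fun _ => zero_le_one) fun _ _ => le_rfl).trans_eq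
    (bernoulliExp_const 1)

theorem bernoulliProb_or_le (h0 : 0 ≤ p) (h1 : p ≤ 1) (Q R : (E → Bool) → Prop) :
    bernoulliProb p (fun ω => Q ω ∨ R ω) ≤ bernoulliProb p Q + bernoulliProb p R := by
  simp only [bernoulliProb]
  rw [← bernoulliExp_add]
  refine bernoulliExp_mono h0 h1 fun ω => ?_
  by_cases hQ : Q ω <;> by_cases hR : R ω <;> simp [hQ, hR]

theorem bernoulliProb_exists_le (h0 : 0 ≤ p) (h1 : p ≤ 1) {κ : Type*} [Fintype κ]
    (Q : κ → (E → Bool) → Prop) :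
    bernoulliProb p (fun ω => ∃ t, Q t ω) ≤ ∑ t, bernoulliProb p (Q t) := by
  simp only [bernoulliProb]
  rw [← bernoulliExp_sum]
  refine bernoulliExp_mono h0 h1 fun ω => ?_
  split_ifs with h
  · obtain ⟨t, ht⟩ := h
    have := Finset.single_le_sum (f := fun t => if Q t ω then (1 : ℝ) else 0)
      (fun t _ => by split_ifs <;> norm_num) (Finset.mem_univ t)
    simpa [ht] using this
  · exact Finset.sum_nonneg fun t _ => by split_ifs <;> norm_num

theorem bernoulliProb_exists_le_card_mul (h0 : 0 ≤ p) (h1 : p ≤ 1) {κ : Type*} [Fintype κ]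
    {Q : κ → (E → Bool) → Prop} {c : ℝ} (h : ∀ t, bernoulliProb p (Q t) ≤ c) :
    bernoulliProb p (fun ω => ∃ t, Q t ω) ≤ Fintype.card κ * c :=
  (bernoulliProb_exists_le h0 h1 Q).trans <| (Finset.sum_le_sum fun t _ => h t).trans_eq <| by
    rw [Finset.sum_const, nsmul_eq_mul, Finset.card_univ]

/-- The number of values `true` in a set. -/
def countTrue (S : Finset E) (ω : E → Bool) : ℕ := ∑ e ∈ S, (ω e).toNat

theorem exp_mul_countTrue (S : Finset E) (c : ℝ) (ω : E → Bool) :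
    Real.exp (c * countTrue S ω) =
      ∏ e, if e ∈ S then (if ω e then Real.exp c else 1) else 1 := by
  rw [countTrue, Nat.cast_sum, Finset.mul_sum, Real.exp_sum, Finset.prod_ite_mem,
    Finset.univ_inter]
  refine Finset.prod_congr rfl fun e _ => ?_
  cases ω e <;> simp

theorem bernoulliExp_exp_mul_countTrue_le (h0 : 0 ≤ p) (h1 : p ≤ 1) (S : Finset E) (c : ℝ) :
    bernoulliExp p (fun ω => Real.exp (c * countTrue S ω)) ≤
      Real.exp (p * S.card * (Real.exp c - 1)) := by
  simp only [exp_mul_countTrue]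
  rw [bernoulliExp_prod fun e b => if e ∈ S then (if b then Real.exp c else 1) else 1]
  have : ∀ e : E, (p * (if e ∈ S then (if true then Real.exp c else 1) else 1) +
      (1 - p) * if e ∈ S then (if false then Real.exp c else 1) else 1) =
        if e ∈ S then 1 + p * (Real.exp c - 1) else 1 := fun e => by
    split_ifs <;> simp_all
    ring
  rw [Finset.prod_congr rfl fun e _ => this e, Finset.prod_ite_mem, Finset.univ_inter,
    Finset.prod_const]
  calc (1 + p * (Real.exp c - 1)) ^ S.card ≤ (Real.exp (p * (Real.exp c - 1))) ^ S.card := by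
        refine pow_le_pow_left₀ ?_ (by rw [add_comm]; exact Real.add_one_le_exp _) _
        nlinarith [Real.exp_pos c]
    _ = _ := by rw [← Real.exp_nat_mul]; ring_nf

/-- Exponential Markov inequality with parameter 1; twice the mean absorbs e - 1 < 2. -/
theorem bernoulliProb_lt_countTrue_le (h0 : 0 ≤ p) (h1 : p ≤ 1) (S : Finset E) (s : ℝ) :
    bernoulliProb p (fun ω => 2 * (p * S.card) + s < countTrue S ω) ≤ Real.exp (-s) := by
  calc _ ≤ bernoulliExp p (fun ω => Real.exp (-(2 * (p * S.card) + s)) *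
        Real.exp (1 * countTrue S ω)) := by
        refine bernoulliProb_le_of_le h0 h1 (fun ω => by positivity) fun ω h => ?_
        rw [← Real.exp_add]
        exact Real.one_le_exp (by linarith)
    _ ≤ Real.exp (-(2 * (p * S.card) + s)) * Real.exp (p * S.card * (Real.exp 1 - 1)) := by
        rw [bernoulliExp_const_mul]
        gcongr
        exact bernoulliExp_exp_mul_countTrue_le h0 h1 S 1
    _ ≤ _ := by
        rw [← Real.exp_add]
        have : 0 ≤ p * S.card := by positivity
        have := Real.exp_one_lt_d9
        gcongr
        nlinarith

/-- Exponential Markov inequality with parameter -1; the constant 1/8 comes from exp(-1) < 3/8 and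
1/2 + 3/8 - 1 = -1/8. -/
theorem bernoulliProb_countTrue_lt_le (h0 : 0 ≤ p) (h1 : p ≤ 1) (S : Finset E) :
    bernoulliProb p (fun ω => (countTrue S ω : ℝ) < p * S.card / 2) ≤
      Real.exp (-(p * S.card / 8)) := by
  calc _ ≤ bernoulliExp p (fun ω => Real.exp (p * S.card / 2) *
        Real.exp (-1 * countTrue S ω)) := by
        refine bernoulliProb_le_of_le h0 h1 (fun ω => by positivity) fun ω h => ?_
        rw [← Real.exp_add]
        exact Real.one_le_exp (by linarith)
    _ ≤ Real.exp (p * S.card / 2) * Real.exp (p * S.card * (Real.exp (-1) - 1)) := by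
        rw [bernoulliExp_const_mul]
        gcongr
        exact bernoulliExp_exp_mul_countTrue_le h0 h1 S (-1)
    _ ≤ _ := by
        rw [← Real.exp_add]
        have : 0 ≤ p * S.card := by positivity
        have h3 : Real.exp (-1) < 3 / 8 := by
          rw [Real.exp_neg, inv_lt_comm₀ (Real.exp_pos _) (by norm_num)]
          have := Real.exp_one_gt_d9
          norm_num
          linarith
        gcongr
        nlinarith

theorem bernoulliExp_mul_of_ne {e e' : E} (h : e ≠ e') :
    bernoulliExp p (fun ω => ((ω e).toNat : ℝ) * (ω e').toNat) = p ^ 2 := by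
  have h1 := bernoulliExp_prod (p := p) fun x b =>
    if x ∈ ({e, e'} : Finset E) then ((b.toNat : ℕ) : ℝ) else 1
  have h2 : ∀ x : E, (p * (if x ∈ ({e, e'} : Finset E) then ((true.toNat : ℕ) : ℝ) else 1) +
      (1 - p) * if x ∈ ({e, e'} : Finset E) then ((false.toNat : ℕ) : ℝ) else 1) =
        if x ∈ ({e, e'} : Finset E) then p else 1 := fun x => by split_ifs <;> simp
  rw [Finset.prod_congr rfl fun x _ => h2 x] at h1
  simp only [Finset.prod_ite_mem, Finset.univ_inter, Finset.prod_pair h] at h1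
  rw [h1, sq]

/-- The number of pairs in `P` for which both values are `true`. -/
def countPairs (P : Finset (E × E)) (ω : E → Bool) : ℕ :=
  ∑ x ∈ P, (ω x.1).toNat * (ω x.2).toNat

theorem bernoulliExp_countPairs {P : Finset (E × E)} (hP : ∀ x ∈ P, x.1 ≠ x.2) :
    bernoulliExp p (fun ω => (countPairs P ω : ℝ)) = p ^ 2 * P.card := by
  simp only [countPairs, Nat.cast_sum, Nat.cast_mul]
  rw [bernoulliExp_sum, Finset.sum_congr rfl fun x hx => bernoulliExp_mul_of_ne (hP x hx),
    Finset.sum_const, nsmul_eq_mul, mul_comm]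

theorem exp_le_one_add_two_mul {y : ℝ} (h0 : 0 ≤ y) (h1 : y ≤ 1) : Real.exp y ≤ 1 + 2 * y := by
  have h := convexOn_exp.2 (Set.mem_univ 0) (Set.mem_univ 1) (sub_nonneg.2 h1) h0 (by ring)
  simp only [smul_eq_mul, mul_zero, mul_one, zero_add, Real.exp_zero] at h
  have := Real.exp_one_lt_d9
  nlinarith

/-- The slices are independent, and after truncation and division by M each term lies in [0,1].
There exp y ≤ 1 + 2y, so the exponential moment is controlled by the mean p²·|P|. Pair counts are
quadratic, and truncation is what makes this linear estimate available. -/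
theorem bernoulliProb_lt_sum_min_countPairs_le (h0 : 0 ≤ p) (h1 : p ≤ 1) {P : Finset (F × F)}
    (hP : ∀ x ∈ P, x.1 ≠ x.2) {M : ℝ} (hM : 0 < M) (s : ℝ) :
    bernoulliProb p (fun ω : E × F → Bool => 2 * (Fintype.card E * (p ^ 2 * P.card)) + M * s <
      ∑ i, min (countPairs P fun x => ω (i, x) : ℝ) M) ≤ Real.exp (-s) := by
  set c : ℝ := 2 * (Fintype.card E * (p ^ 2 * P.card)) with hc
  set Y : (F → Bool) → ℝ := fun ω => min (countPairs P ω : ℝ) M / M with hY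
  have hE : bernoulliExp p (fun ω => Real.exp (Y ω)) ≤ Real.exp (2 * (p ^ 2 * P.card / M)) := by
    calc _ ≤ bernoulliExp p (fun ω : F → Bool => 1 + 2 / M * (countPairs P ω : ℝ)) := by
          refine bernoulliExp_mono h0 h1 fun ω => ?_
          have hY0 : 0 ≤ Y ω := by simp only [hY]; positivity
          have hY1 : Y ω ≤ 1 := (div_le_one hM).2 (min_le_right _ _)
          refine (exp_le_one_add_two_mul hY0 hY1).trans ?_
          have : Y ω ≤ countPairs P ω / M := by
            simp only [hY]
            gcongr
            exact min_le_left _ _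
          calc 1 + 2 * Y ω ≤ 1 + 2 * (countPairs P ω / M) := by gcongr
            _ = _ := by ring
      _ = 1 + 2 / M * (p ^ 2 * P.card) := by
          rw [bernoulliExp_add, bernoulliExp_const, bernoulliExp_const_mul,
            bernoulliExp_countPairs hP]
      _ ≤ _ := by
          refine le_trans ?_ (Real.add_one_le_exp _)
          rw [add_comm]
          apply le_of_eq
          ring
  calc _ ≤ bernoulliExp p (fun ω : E × F → Bool => Real.exp (-(c / M + s)) *
        ∏ i, Real.exp (Y fun x => ω (i, x))) := by
        refine bernoulliProb_le_of_le h0 h1 (fun ω => by positivity) fun ω h => ?_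
        rw [← Real.exp_sum, ← Real.exp_add]
        refine Real.one_le_exp ?_
        simp only [hY]
        rw [← Finset.sum_div]
        have : c / M + s ≤ (∑ i, min (countPairs P fun x => ω (i, x) : ℝ) M) / M := by
          rw [le_div_iff₀ hM, add_mul, div_mul_cancel₀ _ hM.ne']
          linarith
        linarith
    _ = Real.exp (-(c / M + s)) * ∏ i : E, bernoulliExp p (fun ω => Real.exp (Y ω)) := by
        rw [bernoulliExp_const_mul, bernoulliExp_slices fun _ ω => Real.exp (Y ω)]
    _ ≤ Real.exp (-(c / M + s)) * Real.exp (2 * (p ^ 2 * P.card / M)) ^ Fintype.card E := by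
        rw [Finset.prod_const, Finset.card_univ]
        gcongr
        exact Finset.sum_nonneg fun ω _ => mul_nonneg (bernoulliWeight_nonneg h0 h1 ω) (by positivity)
    _ = Real.exp (-s) := by
        rw [← Real.exp_nat_mul, ← Real.exp_add]
        congr 1
        rw [hc]
        field_simp
        ring

end

/-- The measure on the finite set of constraint sets is a sum of point masses, whose weights are the
product weights. From here on everything is a finite sum. -/
theorem prob_eq {k n : ℕ} (p : unitInterval) (Q : Instance k n → Prop) :
    prob p Q = bernoulliProb (p : ℝ) fun ω : Constraint k n → Bool =>
      Q (Finset.univ.filter fun e => ω e = true).val := by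
  rw [prob]
  set A : Finset (Set (Constraint k n)) := Finset.univ.filter fun B => Q (Instance.ofSet B) with hA
  have h1 : {B : Set (Constraint k n) | Q (Instance.ofSet B)} = ⋃ B ∈ A, {B} := by
    ext B; simp [hA]
  rw [h1, MeasureTheory.measureReal_biUnion_finset (by simp [Set.PairwiseDisjoint, Set.Pairwise]) (by simp)]
  rw [Finset.sum_congr rfl fun B _ =>
    ProbabilityTheory.setBernoulli_real_singleton p (Set.subset_univ B) Set.finite_univ]
  rw [bernoulliProb, bernoulliExp, hA, Finset.sum_filter]
  set Φ : (Constraint k n → Bool) ≃ Set (Constraint k n) :=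
    { toFun := fun ω => {e | ω e = true}
      invFun := fun B e => decide (e ∈ B)
      left_inv := fun ω => by funext e; simp
      right_inv := fun B => by ext e; simp } with hΦ
  rw [← Φ.sum_comp]
  refine Finset.sum_congr (by ext; simp) fun ω _ => ?_
  have h2 : Instance.ofSet (Φ ω) = (Finset.univ.filter fun e => ω e = true).val := by
    rw [Instance.ofSet]
    congr 1
    ext e
    simp [hΦ]
  have h3 : bernoulliWeight (p : ℝ) ω =
      (p : ℝ) ^ (Φ ω).ncard * (1 - p : ℝ) ^ (Set.univ \ Φ ω).ncard := by
    rw [bernoulliWeight, Finset.prod_ite, Finset.prod_const, Finset.prod_const]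
    congr 2
    · rw [← Set.ncard_coe_finset]; congr 1; ext e; simp [hΦ]
    · rw [← Set.ncard_coe_finset]; congr 1; ext e; simp [hΦ]
  rw [h2, h3, mul_ite, mul_one, mul_zero]

end CSP

/-! ### Symmetrization and regular count arrays -/

namespace CSP

open Matrix

section
variable {ι α S : Type*} [Fintype ι] [Fintype α] [Fintype S] [DecidableEq ι] [DecidableEq α]
  [DecidableEq S]

/-- The number of elements of a random set with given first coordinates. -/
def cellCount (ω : ι × α × α × S → Bool) (i : ι) (a b : α) : ℕ := ∑ c, (ω (i, a, b, c)).toNat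

/-- The number of elements of a random set with given first coordinates, counted with signs. -/
def signedCount (χ : S → ℤˣ) (ω : ι × α × α × S → Bool) (i : ι) (a b : α) : ℤ :=
  ∑ c, if ω (i, a, b, c) then (χ c : ℤ) else 0

theorem abs_signedCount_le (χ : S → ℤˣ) (ω : ι × α × α × S → Bool) (i : ι) (a b : α) :
    |signedCount χ ω i a b| ≤ cellCount ω i a b := by
  rw [signedCount, cellCount, Nat.cast_sum]
  refine (Finset.abs_sum_le_sum_abs _ _).trans (Finset.sum_le_sum fun c _ => ?_)
  split_ifs with h
  · rw [Int.isUnit_iff_abs_eq.1 (Units.isUnit _), h]; rfl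
  · simp

theorem cellCount_le (ω : ι × α × α × S → Bool) (i : ι) (a b : α) :
    cellCount ω i a b ≤ Fintype.card S := by
  rw [cellCount, Fintype.card_eq_sum_ones]
  exact Finset.sum_le_sum fun c _ => Bool.toNat_le _

theorem signedCount_sq_le (χ : S → ℤˣ) (ω : ι × α × α × S → Bool) (i : ι) (a b : α) :
    (signedCount χ ω i a b : ℝ) ^ 2 ≤ Fintype.card S * cellCount ω i a b := by
  have h1 : |(signedCount χ ω i a b : ℝ)| ≤ cellCount ω i a b := by
    exact_mod_cast abs_signedCount_le χ ω i a b
  have h2 : (cellCount ω i a b : ℝ) ≤ Fintype.card S := by exact_mod_cast cellCount_le ω i a b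
  rw [← sq_abs, sq]
  exact mul_le_mul (h1.trans h2) h1 (abs_nonneg _) (by positivity)

/-- The permutation that applies `τ` to the last coordinate where the sign is `-1`. -/
def flipEquiv (τ : Equiv.Perm S) (ε : ι × α × α → ℤˣ) : Equiv.Perm (ι × α × α × S) where
  toFun x := (x.1, x.2.1, x.2.2.1, if ε (x.1, x.2.1, x.2.2.1) = 1 then x.2.2.2 else τ x.2.2.2)
  invFun x :=
    (x.1, x.2.1, x.2.2.1, if ε (x.1, x.2.1, x.2.2.1) = 1 then x.2.2.2 else τ.symm x.2.2.2)
  left_inv x := by dsimp only; split_ifs <;> simp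
  right_inv x := by dsimp only; split_ifs <;> simp

theorem cellCount_flip (τ : Equiv.Perm S) (ε : ι × α × α → ℤˣ) (ω : ι × α × α × S → Bool) :
    cellCount (ω ∘ flipEquiv τ ε) = cellCount ω := by
  funext i a b
  simp only [cellCount, flipEquiv, Function.comp_apply, Equiv.coe_fn_mk]
  split_ifs with h
  · rfl
  · exact Equiv.sum_comp τ fun c => (ω (i, a, b, c)).toNat

/-- Where ε is -1, every pattern is replaced by a partner of opposite character value: the signed
count changes sign there, while `cellCount` stays the same. -/
theorem signedCount_flip {χ : S → ℤˣ} {τ : Equiv.Perm S} (hτ : ∀ c, χ (τ c) = - χ c)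
    (ε : ι × α × α → ℤˣ) (ω : ι × α × α × S → Bool) :
    (fun i a b => (signedCount χ (ω ∘ flipEquiv τ ε) i a b : ℝ)) =
      applySigns ε fun i a b => (signedCount χ ω i a b : ℝ) := by
  funext i a b
  simp only [applySigns, signedCount, flipEquiv, Function.comp_apply, Equiv.coe_fn_mk]
  rcases Int.units_eq_one_or (ε (i, a, b)) with h | h
  · simp [h]
  · have := Equiv.sum_comp τ fun c => if ω (i, a, b, c) then -(χ c : ℤ) else 0
    simp only [hτ, Units.val_neg, neg_neg] at this
    simp only [h, show ¬ (-1 : ℤˣ) = 1 by decide, if_false]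
    rw [this]
    push_cast
    rw [Finset.mul_sum]
    refine Finset.sum_congr rfl fun c _ => ?_
    split_ifs <;> simp

-- Markov's inequality after symmetrization. The flips preserve the distribution and, as `Good`
-- depends on the counts only, the event `Good`; so the expectation can be averaged over ε before
-- the deterministic bound h is inserted.
open Classical in
theorem bernoulliProb_trace_le {p : ℝ} (h0 : 0 ≤ p) (h1 : p ≤ 1) {χ : S → ℤˣ} {τ : Equiv.Perm S}
    (hτ : ∀ c, χ (τ c) = - χ c) (Good : (ι → α → α → ℕ) → Prop) {tr : (ι → α → α → ℝ) → ℝ}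
    (htr : ∀ w, 0 ≤ tr w) {b θ : ℝ} (hb : 0 ≤ b) (hθ : 0 < θ)
    (h : ∀ ω : ι × α × α × S → Bool, Good (cellCount ω) →
      ∑ ε : ι × α × α → ℤˣ, tr (applySigns ε fun i a b => (signedCount χ ω i a b : ℝ)) ≤
        Fintype.card (ι × α × α → ℤˣ) * b) :
    bernoulliProb p (fun ω : ι × α × α × S → Bool => Good (cellCount ω) ∧
      θ < tr fun i a b => (signedCount χ ω i a b : ℝ)) ≤ b / θ := by
  set X : (ι × α × α × S → Bool) → ℝ := fun ω =>
    if Good (cellCount ω) then (tr fun i a b => (signedCount χ ω i a b : ℝ)) / θ else 0 with hX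
  have hX0 : ∀ ω, 0 ≤ X ω := fun ω => by
    simp only [hX]
    split_ifs
    · exact div_nonneg (htr _) hθ.le
    · exact le_rfl
  refine (bernoulliProb_le_of_le h0 h1 hX0 fun ω hω => ?_).trans
    (?_ : bernoulliExp p X ≤ b / θ)
  · simp only [hX, if_pos hω.1]
    rw [one_le_div hθ]
    exact hω.2.le
  have hc : (0 : ℝ) < Fintype.card (ι × α × α → ℤˣ) := by exact_mod_cast Fintype.card_pos
  refine le_of_mul_le_mul_left ?_ hc
  have e1 : (Fintype.card (ι × α × α → ℤˣ) : ℝ) * bernoulliExp p X =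
      bernoulliExp p fun ω => ∑ ε : ι × α × α → ℤˣ, X (ω ∘ flipEquiv τ ε) := by
    rw [bernoulliExp_sum, Finset.sum_congr rfl fun ε _ => bernoulliExp_comp_equiv (flipEquiv τ ε) X,
      Finset.sum_const, nsmul_eq_mul, Finset.card_univ]
  rw [e1, ← bernoulliExp_const (p := p) (E := ι × α × α × S)
    ((Fintype.card (ι × α × α → ℤˣ) : ℝ) * (b / θ))]
  refine bernoulliExp_mono h0 h1 fun ω => ?_
  simp only [hX, cellCount_flip, signedCount_flip hτ]
  split_ifs with hg
  · rw [← Finset.sum_div, ← mul_div_assoc]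
    exact div_le_div_of_nonneg_right (h ω hg) hθ.le
  · simp only [Finset.sum_const_zero]
    positivity

/-- The degrees are at most `D`, and the numbers of pairs at most `t`. -/
structure Regular (D t : ℝ) (c : ι → α → α → ℕ) : Prop where
  row : ∀ i a, ∑ b, (c i a b : ℝ) ≤ D
  col : ∀ i b, ∑ a, (c i a b : ℝ) ≤ D
  rows : ∀ a a', ∑ i, ∑ b, ∑ b', (if a = a' ∧ b = b' then 0 else (c i a b : ℝ) * c i a' b') ≤ t
  cols : ∀ b b', ∑ i, ∑ a, ∑ a', (if a = a' ∧ b = b' then 0 else (c i a b : ℝ) * c i a' b') ≤ t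

/-- A signed count is at most the count, which is at most card S. Its square is thus at most card S
times the count, and degree bounds for counts become bounds for sums of squares. -/
theorem Regular.sum_trace_le_of_degree {D t : ℝ} (χ : S → ℤˣ) {ω : ι × α × α × S → Bool} (hD : 0 ≤ D)
    (h : Regular D t (cellCount ω)) (L : ℕ) :
    ∑ ε : ι × α × α → ℤˣ, trace ((offDiag (applySigns ε fun i a b => (signedCount χ ω i a b : ℝ)) *
      (offDiag (applySigns ε fun i a b => (signedCount χ ω i a b : ℝ)))ᵀ) ^ 2 ^ L) ≤
      Fintype.card (ι × α × α → ℤˣ) * (4 * (Fintype.card α : ℝ) ^ 5 *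
        (4096 * Fintype.card ι * (2 ^ L) ^ 3 * (Fintype.card S * D) ^ 2) ^ 2 ^ L) := by
  refine (sum_trace_offDiag_le_of_degree (w := fun i a b => (signedCount χ ω i a b : ℝ))
    (D := Fintype.card S * D) (by positivity) (fun i a => ?_) (fun i b => ?_) L).trans_eq (by ring)
  · refine (Finset.sum_le_sum fun b _ => signedCount_sq_le χ ω i a b).trans ?_
    rw [← Finset.mul_sum]
    gcongr
    exact h.row i a
  · refine (Finset.sum_le_sum fun a _ => signedCount_sq_le χ ω i a b).trans ?_
    rw [← Finset.mul_sum]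
    gcongr
    exact h.col i b

/-- The signed counts are integers, so a nonzero one has square at least 1, as the sparse estimate
demands. -/
theorem Regular.sum_trace_le_of_sparse {D t : ℝ} (χ : S → ℤˣ) {ω : ι × α × α × S → Bool} (hD : 0 ≤ D)
    (ht : 0 ≤ t) (h : Regular D t (cellCount ω)) (L : ℕ) :
    ∑ ε : ι × α × α → ℤˣ, trace ((offDiag (applySigns ε fun i a b => (signedCount χ ω i a b : ℝ)) *
      (offDiag (applySigns ε fun i a b => (signedCount χ ω i a b : ℝ)))ᵀ) ^ 2 ^ L) ≤
      Fintype.card (ι × α × α → ℤˣ) * (2 * (Fintype.card α : ℝ) ^ 4 *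
        (64 * 2 ^ L * (Fintype.card S * D) ^ 2 * (Fintype.card S ^ 2 * t)) ^ 2 ^ L) := by
  have hterm : ∀ i a b a' b', (if a = a' ∧ b = b' then (0 : ℝ) else
      (signedCount χ ω i a b : ℝ) ^ 2 * (signedCount χ ω i a' b' : ℝ) ^ 2) ≤ Fintype.card S ^ 2 *
        (if a = a' ∧ b = b' then 0 else (cellCount ω i a b : ℝ) * cellCount ω i a' b') := by
    intro i a b a' b'
    split_ifs
    · simp
    · refine (mul_le_mul (signedCount_sq_le χ ω i a b) (signedCount_sq_le χ ω i a' b')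
        (sq_nonneg _) (by positivity)).trans_eq (by ring)
  refine (sum_trace_offDiag_le_of_sparse (w := fun i a b => (signedCount χ ω i a b : ℝ))
    (D := Fintype.card S * D) (K := Fintype.card S ^ 2 * t) (fun i a b => ?_) (by positivity)
    (fun i a => ?_) (fun i b => ?_) (by positivity) (fun b b' => ?_) (fun a a' => ?_) L).trans_eq
      (by ring)
  · rcases eq_or_ne (signedCount χ ω i a b) 0 with h0 | h0
    · left; simp [h0]
    · right
      have : 1 ≤ signedCount χ ω i a b ^ 2 := by
        have := sq_pos_of_ne_zero h0
        omega
      exact_mod_cast this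
  · refine (Finset.sum_le_sum fun b _ => signedCount_sq_le χ ω i a b).trans ?_
    rw [← Finset.mul_sum]
    gcongr
    exact h.row i a
  · refine (Finset.sum_le_sum fun a _ => signedCount_sq_le χ ω i a b).trans ?_
    rw [← Finset.mul_sum]
    gcongr
    exact h.col i b
  · refine (Finset.sum_le_sum fun i _ => Finset.sum_le_sum fun a _ => Finset.sum_le_sum fun a' _ =>
      hterm i a b a' b').trans ?_
    simp only [← Finset.mul_sum]
    gcongr
    exact h.cols b b'
  · refine (Finset.sum_le_sum fun i _ => Finset.sum_le_sum fun b _ => Finset.sum_le_sum fun b' _ =>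
      hterm i a b a' b').trans ?_
    simp only [← Finset.mul_sum]
    gcongr
    exact h.rows a a'

/-- The pairs of different positions in two rows. -/
def rowPairs (S : Type*) [Fintype S] (a a' : α) : Finset ((α × α × S) × (α × α × S)) :=
  (({a} ×ˢ Finset.univ) ×ˢ ({a'} ×ˢ Finset.univ)).filter fun x => ¬ (a = a' ∧ x.1.2.1 = x.2.2.1)

/-- The pairs of different positions in two columns. -/
def colPairs (S : Type*) [Fintype S] (b b' : α) : Finset ((α × α × S) × (α × α × S)) :=
  ((Finset.univ ×ˢ ({b} ×ˢ Finset.univ)) ×ˢ (Finset.univ ×ˢ ({b'} ×ˢ Finset.univ))).filter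
    fun x => ¬ (x.1.1 = x.2.1 ∧ b = b')

theorem ne_of_mem_rowPairs {a a' : α} (x) (hx : x ∈ rowPairs S a a') : x.1 ≠ x.2 := by
  simp only [rowPairs, Finset.mem_filter, Finset.mem_product, Finset.mem_singleton] at hx
  exact fun h => hx.2 ⟨by rw [← hx.1.1.1, ← hx.1.2.1, h], by rw [h]⟩

theorem ne_of_mem_colPairs {b b' : α} (x) (hx : x ∈ colPairs S b b') : x.1 ≠ x.2 := by
  simp only [colPairs, Finset.mem_filter, Finset.mem_product, Finset.mem_singleton] at hx
  exact fun h => hx.2 ⟨by rw [h], by rw [← hx.1.1.2.1, ← hx.1.2.2.1, h]⟩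

theorem card_rowPairs_le (a a' : α) :
    (rowPairs S a a').card ≤ (Fintype.card α * Fintype.card S) ^ 2 := by
  refine (Finset.card_filter_le _ _).trans_eq ?_
  simp [Finset.card_product, Fintype.card_prod, sq]

theorem card_colPairs_le (b b' : α) :
    (colPairs S b b').card ≤ (Fintype.card α * Fintype.card S) ^ 2 := by
  refine (Finset.card_filter_le _ _).trans_eq ?_
  simp [sq]

theorem countPairs_rowPairs (ω : ι × α × α × S → Bool) (i : ι) (a a' : α) :
    (countPairs (rowPairs S a a') fun x => ω (i, x)) =
      ∑ b, ∑ b', if a = a' ∧ b = b' then 0 else cellCount ω i a b * cellCount ω i a' b' := by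
  rw [countPairs, rowPairs, Finset.sum_filter, Finset.sum_product, Finset.sum_product,
    Finset.sum_singleton, Fintype.sum_prod_type]
  refine Finset.sum_congr rfl fun b _ => ?_
  simp only [Finset.sum_product, Finset.sum_singleton, Fintype.sum_prod_type]
  rw [Finset.sum_comm]
  refine Finset.sum_congr rfl fun b' _ => ?_
  split_ifs with h
  · simp
  · simp only [cellCount, Finset.sum_mul_sum]

theorem countPairs_colPairs (ω : ι × α × α × S → Bool) (i : ι) (b b' : α) :
    (countPairs (colPairs S b b') fun x => ω (i, x)) =
      ∑ a, ∑ a', if a = a' ∧ b = b' then 0 else cellCount ω i a b * cellCount ω i a' b' := by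
  rw [countPairs, colPairs, Finset.sum_filter, Finset.sum_product, Finset.sum_product]
  refine Finset.sum_congr rfl fun a _ => ?_
  simp only [Finset.sum_product, Finset.sum_singleton]
  rw [Finset.sum_comm]
  refine Finset.sum_congr rfl fun a' _ => ?_
  split_ifs with h
  · simp
  · simp only [cellCount, Finset.sum_mul_sum]

theorem countTrue_row (ω : ι × α × α × S → Bool) (i : ι) (a : α) :
    countTrue ({i} ×ˢ ({a} ×ˢ Finset.univ)) ω = ∑ b, cellCount ω i a b := by
  simp only [countTrue, Finset.sum_product, Finset.sum_singleton, Fintype.sum_prod_type, cellCount]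

theorem countTrue_col (ω : ι × α × α × S → Bool) (i : ι) (b : α) :
    countTrue ({i} ×ˢ (Finset.univ ×ˢ ({b} ×ˢ Finset.univ))) ω = ∑ a, cellCount ω i a b := by
  simp only [countTrue, Finset.sum_product, Finset.sum_singleton, cellCount]

theorem sum_min_eq {c : ι → ℝ} {M : ℝ} (h : ∀ i, c i ≤ M) : ∑ i, min (c i) M = ∑ i, c i :=
  Finset.sum_congr rfl fun i _ => min_eq_left (h i)

theorem sum_sum_ite_le {β : Type*} [Fintype β] {f g : β → ℝ} (hf : ∀ b, 0 ≤ f b) (hg : ∀ b, 0 ≤ g b)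
    {Q : β → β → Prop} [∀ b b', Decidable (Q b b')] {D : ℝ} (hD : 0 ≤ D) (h1 : ∑ b, f b ≤ D)
    (h2 : ∑ b, g b ≤ D) : ∑ b, ∑ b', (if Q b b' then 0 else f b * g b') ≤ D ^ 2 := by
  calc _ ≤ ∑ b, ∑ b', f b * g b' := by
        refine Finset.sum_le_sum fun b _ => Finset.sum_le_sum fun b' _ => ?_
        split_ifs
        · exact mul_nonneg (hf b) (hg b')
        · exact le_rfl
    _ = (∑ b, f b) * ∑ b, g b := by rw [Finset.sum_mul_sum]
    _ ≤ D * D := mul_le_mul h1 h2 (Finset.sum_nonneg fun b _ => hg b) hD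
    _ = D ^ 2 := (sq D).symm

/-- Union bound over the rows and columns of all slices, where μ is the expected degree, and over
pairs of rows and pairs of columns, where each slice has expected pair count at most μ². The
truncation level D² is never reached once the degrees are at most D. -/
theorem bernoulliProb_not_regular_le {p : ℝ} (h0 : 0 ≤ p) (h1 : p ≤ 1) {μ s D t : ℝ}
    (hμ : μ = p * (Fintype.card α * Fintype.card S)) (hs : 0 < s) (hD : D = 2 * μ + s)
    (ht : t = 2 * (Fintype.card ι * μ ^ 2) + D ^ 2 * s) :
    bernoulliProb p (fun ω : ι × α × α × S → Bool => ¬ Regular D t (cellCount ω)) ≤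
      2 * (Fintype.card ι * Fintype.card α + Fintype.card α ^ 2) * Real.exp (-s) := by
  have hμ0 : 0 ≤ μ := by rw [hμ]; positivity
  have hD0 : 0 < D := by linarith
  have hM : 0 < D ^ 2 := by positivity
  have b1 : bernoulliProb p (fun ω : ι × α × α × S → Bool => ∃ x : ι × α,
      D < countTrue ({x.1} ×ˢ ({x.2} ×ˢ Finset.univ)) ω) ≤
        Fintype.card (ι × α) * Real.exp (-s) := by
    refine bernoulliProb_exists_le_card_mul h0 h1 fun x => ?_
    convert bernoulliProb_lt_countTrue_le h0 h1
      (({x.1} ×ˢ ({x.2} ×ˢ Finset.univ) : Finset (ι × α × α × S))) s using 4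
    rw [hD, hμ]
    simp
  have b2 : bernoulliProb p (fun ω : ι × α × α × S → Bool => ∃ x : ι × α,
      D < countTrue ({x.1} ×ˢ (Finset.univ ×ˢ ({x.2} ×ˢ Finset.univ))) ω) ≤
        Fintype.card (ι × α) * Real.exp (-s) := by
    refine bernoulliProb_exists_le_card_mul h0 h1 fun x => ?_
    convert bernoulliProb_lt_countTrue_le h0 h1
      (({x.1} ×ˢ (Finset.univ ×ˢ ({x.2} ×ˢ Finset.univ)) : Finset (ι × α × α × S))) s using 4
    rw [hD, hμ]
    simp
  have hcard : ∀ P : Finset ((α × α × S) × (α × α × S)),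
      P.card ≤ (Fintype.card α * Fintype.card S) ^ 2 →
      2 * (Fintype.card ι * (p ^ 2 * P.card)) + D ^ 2 * s ≤ t := by
    intro P hP
    have hP' : (P.card : ℝ) ≤ (Fintype.card α * Fintype.card S) ^ 2 := by exact_mod_cast hP
    rw [ht, hμ, mul_pow]
    gcongr
  have b3 : bernoulliProb p (fun ω : ι × α × α × S → Bool => ∃ x : α × α,
      t < ∑ i, min (countPairs (rowPairs S x.1 x.2) fun y => ω (i, y) : ℝ) (D ^ 2)) ≤
        Fintype.card (α × α) * Real.exp (-s) := by
    refine bernoulliProb_exists_le_card_mul h0 h1 fun x => le_trans ?_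
      (bernoulliProb_lt_sum_min_countPairs_le (E := ι) h0 h1 (P := rowPairs S x.1 x.2)
        ne_of_mem_rowPairs hM s)
    exact bernoulliProb_mono h0 h1 fun ω hω => (hcard _ (card_rowPairs_le _ _)).trans_lt hω
  have b4 : bernoulliProb p (fun ω : ι × α × α × S → Bool => ∃ x : α × α,
      t < ∑ i, min (countPairs (colPairs S x.1 x.2) fun y => ω (i, y) : ℝ) (D ^ 2)) ≤
        Fintype.card (α × α) * Real.exp (-s) := by
    refine bernoulliProb_exists_le_card_mul h0 h1 fun x => le_trans ?_
      (bernoulliProb_lt_sum_min_countPairs_le (E := ι) h0 h1 (P := colPairs S x.1 x.2)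
        ne_of_mem_colPairs hM s)
    exact bernoulliProb_mono h0 h1 fun ω hω => (hcard _ (card_colPairs_le _ _)).trans_lt hω
  refine (bernoulliProb_mono h0 h1 fun ω hω => ?_).trans
    ((bernoulliProb_or_le h0 h1 _ _).trans (add_le_add ((bernoulliProb_or_le h0 h1 _ _).trans
      (add_le_add b1 b2)) ((bernoulliProb_or_le h0 h1 _ _).trans (add_le_add b3 b4)))) |>.trans_eq ?_
  · by_contra hc
    push Not at hc
    obtain ⟨⟨c1, c2⟩, c3, c4⟩ := hc
    have hrow : ∀ i a, ∑ b, (cellCount ω i a b : ℝ) ≤ D := fun i a => by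
      have := c1 (i, a)
      rwa [countTrue_row, Nat.cast_sum] at this
    have hcol : ∀ i b, ∑ a, (cellCount ω i a b : ℝ) ≤ D := fun i b => by
      have := c2 (i, b)
      rwa [countTrue_col, Nat.cast_sum] at this
    refine hω ⟨hrow, hcol, fun a a' => ?_, fun b b' => ?_⟩
    · have := c3 (a, a')
      -- The degree bounds just obtained make the truncation void.
      rw [sum_min_eq fun i => ?_] at this
      · simp only [countPairs_rowPairs] at this
        push_cast at this
        exact this
      · rw [countPairs_rowPairs]
        push_cast
        exact sum_sum_ite_le (fun _ => Nat.cast_nonneg _) (fun _ => Nat.cast_nonneg _) hD0.le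
          (hrow i a) (hrow i a')
    · have := c4 (b, b')
      rw [sum_min_eq fun i => ?_] at this
      · simp only [countPairs_colPairs] at this
        push_cast at this
        exact this
      · rw [countPairs_colPairs]
        push_cast
        exact sum_sum_ite_le (fun _ => Nat.cast_nonneg _) (fun _ => Nat.cast_nonneg _) hD0.le
          (hcol i b) (hcol i b')
  · rw [Fintype.card_prod, Fintype.card_prod]
    push_cast
    ring

end

end CSP

/-! ### From the random instance to the certificate -/

namespace CSP

section
variable {k n : ℕ}

/-- Constraints, indexed by the position of the scope and the negation pattern. -/
def constraintEquiv (k n : ℕ) : Constraint k n ≃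
    Fin (sliceCount k n) × Fin (rowCount k n) × Fin (rowCount k n) × (Fin k → ℤˣ) where
  toFun e := ((scopeEquiv k n e.2).1, (scopeEquiv k n e.2).2.1, (scopeEquiv k n e.2).2.2, e.1)
  invFun x := (x.2.2.2, (scopeEquiv k n).symm (x.1, x.2.1, x.2.2.1))
  left_inv e := by simp
  right_inv x := by simp

/-- The instance with a given set of constraints. -/
def instanceOf (ω : Fin (sliceCount k n) × Fin (rowCount k n) × Fin (rowCount k n) ×
    (Fin k → ℤˣ) → Bool) : Instance k n :=
  (Finset.univ.filter fun e => ω (constraintEquiv k n e) = true).val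

theorem prob_eq_bernoulliProb (p : unitInterval) (Q : Instance k n → Prop) :
    prob p Q = bernoulliProb (p : ℝ) fun ω => Q (instanceOf ω) := by
  classical
  rw [prob_eq]
  simp only [bernoulliProb]
  rw [← bernoulliExp_comp_equiv (constraintEquiv k n)]
  simp only [instanceOf]
  congr 1

variable (ω : Fin (sliceCount k n) × Fin (rowCount k n) × Fin (rowCount k n) ×
    (Fin k → ℤˣ) → Bool)

theorem sum_map_instanceOf {R : Type*} [AddCommMonoid R] (f : Constraint k n → R) :
    ((instanceOf ω).map f).sum =
      ∑ x, if ω x = true then f ((constraintEquiv k n).symm x) else 0 := by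
  rw [instanceOf]
  change ∑ e ∈ Finset.univ.filter (fun e => ω (constraintEquiv k n e) = true), f e = _
  rw [Finset.sum_filter, ← (constraintEquiv k n).sum_comp]
  simp

theorem card_instanceOf : Multiset.card (instanceOf ω) = countTrue Finset.univ ω := by
  have h := sum_map_instanceOf ω fun _ => 1
  rw [Multiset.map_const', Multiset.sum_replicate, smul_eq_mul, mul_one] at h
  rw [h, countTrue]
  refine Finset.sum_congr rfl fun x _ => ?_
  cases ω x <;> rfl

theorem coeffArray_instanceOf (T : Finset (Fin k)) (i : Fin (sliceCount k n))
    (a b : Fin (rowCount k n)) :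
    coeffArray T (instanceOf ω) i a b = signedCount (fun c => ∏ j ∈ T, c j) ω i a b := by
  rw [coeffArray_eq, sum_map_instanceOf, signedCount, Fintype.sum_prod_type,
    Finset.sum_eq_single i (fun i' _ h => ?_) (by simp), Fintype.sum_prod_type,
    Finset.sum_eq_single a (fun a' _ h => ?_) (by simp), Fintype.sum_prod_type,
    Finset.sum_eq_single b (fun b' _ h => ?_) (by simp)]
  · refine Finset.sum_congr rfl fun c _ => ?_
    simp [constraintEquiv]
  all_goals
    simp [constraintEquiv, h]

theorem sum_cellCount : ∑ i, ∑ a, ∑ b, cellCount ω i a b = countTrue Finset.univ ω := by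
  simp only [countTrue, Fintype.sum_prod_type, cellCount]

theorem sumSq_instanceOf_le (T : Finset (Fin k)) :
    (sumSq T (instanceOf ω) : ℝ) ≤ 2 ^ k * Multiset.card (instanceOf ω) := by
  rw [sumSq_eq, card_instanceOf, ← sum_cellCount]
  push_cast
  simp only [Finset.mul_sum, coeffArray_instanceOf]
  refine Finset.sum_le_sum fun i _ => Finset.sum_le_sum fun a _ => Finset.sum_le_sum fun b _ => ?_
  refine (signedCount_sq_le _ ω i a b).trans_eq ?_
  simp

theorem traceMoment_instanceOf (T : Finset (Fin k)) :
    (traceMoment T (instanceOf ω) : ℝ) = Matrix.trace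
      ((Matrix.offDiag (fun i a b => (signedCount (fun c => ∏ j ∈ T, c j) ω i a b : ℝ)) *
      (Matrix.offDiag (fun i a b => (signedCount (fun c => ∏ j ∈ T, c j) ω i a b : ℝ))).transpose) ^
        2 ^ squarings n) := by
  rw [cast_traceMoment]
  simp only [coeffArray_instanceOf]

/-- Flipping a coordinate inside T negates the character. This is where T has to be nonempty. -/
theorem prod_flipSign {T : Finset (Fin k)} {t : Fin k} (ht : t ∈ T) (c : Fin k → ℤˣ) :
    ∏ j ∈ T, Matrix.flipSign t c j = - ∏ j ∈ T, c j := by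
  rw [← Finset.mul_prod_erase _ _ ht, ← Finset.mul_prod_erase T c ht, Matrix.flipSign_same, neg_mul]
  congr 2
  exact Finset.prod_congr rfl fun j hj => Matrix.flipSign_of_ne (Finset.ne_of_mem_erase hj) _

/-- The budget γ²m² is divided into halves. As m ≥ M/2, the sum of squares uses at most one half by
`hslack`, and the norm part, scaled to γ²M²/8 by the choice of θ, fits into the other. -/
theorem certifier_eq_true {J : Instance k n} {γ : ℚ} (hγ : 0 < γ) {M : ℝ} (hM : 0 < M)
    (hnM : (n : ℝ) ≤ M / 2) (hm : M / 2 ≤ Multiset.card J)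
    (hslack : 4 * sliceCount k n * 8 ^ k ≤ (γ : ℝ) ^ 2 * M)
    (hsum : ∀ T : Finset (Fin k), (sumSq T J : ℝ) ≤ 2 ^ k * Multiset.card J) {θ : ℝ}
    (hθ : θ * (8 * 4 ^ k * (sliceCount k n * rowCount k n ^ 2)) = (γ : ℝ) ^ 2 * M ^ 2)
    (htr : ∀ T : Finset (Fin k), T.Nonempty →
      (traceMoment T J : ℝ) ≤ (θ ^ 2) ^ 2 ^ squarings n) : certifier n J γ = true := by
  classical
  have hm0 : (0 : ℝ) < Multiset.card J := by linarith
  simp only [certifier, decide_eq_true_eq]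
  refine ⟨hγ, by exact_mod_cast hnM.trans hm, by exact_mod_cast hm0, fun T hT => ?_⟩
  have hd : (0 : ℝ) < γ.den := by exact_mod_cast γ.den_pos
  have hγ' : (γ : ℝ) = γ.num / γ.den := by exact_mod_cast γ.num_div_den.symm
  have hnum : (γ.num : ℝ) = γ * γ.den := by rw [hγ']; field_simp
  have hs : (slack T J γ : ℝ) = (γ.den : ℝ) ^ 2 * ((γ : ℝ) ^ 2 * (Multiset.card J : ℝ) ^ 2 -
      sliceCount k n * 4 ^ k * sumSq T J) := by
    rw [slack]; push_cast; rw [hnum]; ring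
  have hsc : (scaling k n γ : ℝ) = (γ.den : ℝ) ^ 2 * (sliceCount k n * 4 ^ k * rowCount k n ^ 2) := by
    rw [scaling]; push_cast; ring
  have h84 : (8 : ℝ) ^ k = 4 ^ k * 2 ^ k := by rw [← mul_pow]; norm_num
  have hbound : scaling k n γ * θ ≤ slack T J γ := by
    rw [hs, hsc, mul_assoc]
    refine mul_le_mul_of_nonneg_left ?_ (by positivity)
    have e1 : sliceCount k n * 4 ^ k * rowCount k n ^ 2 * θ = (γ : ℝ) ^ 2 * M ^ 2 / 8 := by
      rw [← hθ]; ring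
    have e2 : (γ : ℝ) ^ 2 * M ^ 2 / 8 ≤ (γ : ℝ) ^ 2 * (Multiset.card J : ℝ) ^ 2 / 2 := by
      have : (M / 2) ^ 2 ≤ (Multiset.card J : ℝ) ^ 2 := pow_le_pow_left₀ (by positivity) hm 2
      have := mul_le_mul_of_nonneg_left this (sq_nonneg (γ : ℝ))
      linarith
    have e3 : sliceCount k n * 4 ^ k * (sumSq T J : ℝ) ≤
        (γ : ℝ) ^ 2 * (Multiset.card J : ℝ) ^ 2 / 2 := by
      calc sliceCount k n * 4 ^ k * (sumSq T J : ℝ)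
          ≤ sliceCount k n * 4 ^ k * (2 ^ k * Multiset.card J) := by gcongr; exact hsum T
        _ = (4 * sliceCount k n * 8 ^ k) * Multiset.card J / 4 := by rw [h84]; ring
        _ ≤ (γ ^ 2 * M) * Multiset.card J / 4 := by gcongr
        _ ≤ (γ ^ 2 * (2 * Multiset.card J)) * Multiset.card J / 4 := by gcongr; linarith
        _ = _ := by ring
    rw [e1]
    linarith
  have hsc0 : (0 : ℝ) ≤ scaling k n γ := by rw [hsc]; positivity
  have hN : (sliceCount k n * rowCount k n ^ 2 : ℝ) ≠ 0 := by
    intro h0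
    rw [h0, mul_zero, mul_zero] at hθ
    have : (0 : ℝ) < γ := by exact_mod_cast hγ
    have : 0 < (γ : ℝ) ^ 2 * M ^ 2 := by positivity
    linarith
  have hθ0 : 0 ≤ θ := by
    have h1 : 0 < 8 * 4 ^ k * (sliceCount k n * rowCount k n ^ 2 : ℝ) := by positivity
    refine nonneg_of_mul_nonneg_left ?_ h1
    rw [hθ]
    positivity
  have h0 : (0 : ℝ) ≤ slack T J γ := (mul_nonneg hsc0 hθ0).trans hbound
  refine ⟨by exact_mod_cast h0, ?_⟩
  have : ((scaling k n γ : ℝ) ^ 2) ^ 2 ^ squarings n * traceMoment T J ≤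
      ((slack T J γ : ℝ) ^ 2) ^ 2 ^ squarings n := by
    calc _ ≤ ((scaling k n γ : ℝ) ^ 2) ^ 2 ^ squarings n * (θ ^ 2) ^ 2 ^ squarings n := by
          gcongr; exact htr T hT
      _ = ((scaling k n γ * θ) ^ 2) ^ 2 ^ squarings n := by rw [← mul_pow, ← mul_pow]
      _ ≤ _ := by gcongr
  exact_mod_cast this

end

/-! ### Parameter estimates -/

theorem add_three_le_two_pow {k : ℕ} (hk : 2 ≤ k) : k + 3 ≤ 2 ^ (k + 1) := by
  induction k, hk using Nat.le_induction with
  | base => norm_num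
  | succ k _ ih => rw [pow_succ]; omega

section
variable {k : ℕ} {l lam q μ g D t : ℝ}

/-- For μ ≥ 1 the degree bound D is of order μ log n. The Khintchine base is then qμ² times five
logarithms, and one factor qμ² of θ² cancels; `hY` pays for the rest. The divisor 2^(3k+1) is
reserved for the dimension. -/
theorem dense_base_le (hk : 2 ≤ k) (hlam : 1 ≤ lam) (hl0 : 0 ≤ l) (hl : l ≤ 5 * lam) (hq : 0 ≤ q)
    (hμ : 1 ≤ μ) (hY : 2 ^ (40 * k) * lam ^ 10 ≤ g ^ 4 * (q * μ ^ 2))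
    (hD : D = 2 * μ + (k + 1) * lam) :
    4096 * q * l ^ 3 * (2 ^ k * D) ^ 2 ≤
      (g ^ 2 * (q * μ ^ 2) / (8 * 4 ^ k)) ^ 2 / 2 ^ (3 * k + 1) := by
  have hD1 : D ≤ 2 ^ (k + 1) * lam * μ := by
    have h3 : ((k : ℝ) + 3) ≤ 2 ^ (k + 1) := by exact_mod_cast add_three_le_two_pow hk
    calc D ≤ (k + 3) * lam * μ := by
          rw [hD]
          have h1 : μ ≤ lam * μ := le_mul_of_one_le_left (by linarith) hlam
          have h2 : (k + 1) * lam ≤ (k + 1) * lam * μ := le_mul_of_one_le_right (by positivity) hμ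
          linarith
      _ ≤ _ := by gcongr
  have hD0 : 0 ≤ D := by rw [hD]; positivity
  have hpow : (4096 * 125 * 4 * 128 : ℝ) ≤ 2 ^ (29 * k) := by
    calc (4096 * 125 * 4 * 128 : ℝ) ≤ 2 ^ 58 := by norm_num
      _ ≤ _ := pow_le_pow_right₀ (by norm_num) (by omega)
  rw [le_div_iff₀ (by positivity), div_pow, le_div_iff₀ (by positivity)]
  calc 4096 * q * l ^ 3 * (2 ^ k * D) ^ 2 * 2 ^ (3 * k + 1) * (8 * 4 ^ k) ^ 2
      ≤ 4096 * q * (5 * lam) ^ 3 * (2 ^ k * (2 ^ (k + 1) * lam * μ)) ^ 2 * 2 ^ (3 * k + 1) *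
        (8 * 4 ^ k) ^ 2 := by gcongr
    _ = (4096 * 125 * 4 * 128) * 2 ^ (11 * k) * lam ^ 5 * (q * μ ^ 2) := by
        rw [show (4 : ℝ) ^ k = 2 ^ (2 * k) by rw [pow_mul]; norm_num]
        ring
    _ ≤ 2 ^ (29 * k) * 2 ^ (11 * k) * lam ^ 10 * (q * μ ^ 2) := by
        gcongr
        norm_num
    _ = (2 ^ (40 * k) * lam ^ 10) * (q * μ ^ 2) := by ring
    _ ≤ (g ^ 4 * (q * μ ^ 2)) * (q * μ ^ 2) := by gcongr
    _ = _ := by ring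

/-- For μ ≤ 1 the degree bound is of order log n. By `hY` also log³ n ≤ qμ², so the fluctuation term
in t is dominated by qμ², and the base is qμ² times three logarithms. -/
theorem sparse_base_le (hk : 2 ≤ k) (hlam : 1 ≤ lam) (hl : l ≤ 5 * lam) (hq : 0 ≤ q)
    (hμ0 : 0 ≤ μ) (hμ : μ ≤ 1) (hg0 : 0 ≤ g) (hg : g ≤ 1)
    (hY : 2 ^ (40 * k) * lam ^ 10 ≤ g ^ 4 * (q * μ ^ 2))
    (hD : D = 2 * μ + (k + 1) * lam) (ht : t = 2 * (q * μ ^ 2) + D ^ 2 * ((k + 1) * lam)) :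
    64 * l * (2 ^ k * D) ^ 2 * ((2 ^ k) ^ 2 * t) ≤
      (g ^ 2 * (q * μ ^ 2) / (8 * 4 ^ k)) ^ 2 / 2 ^ (3 * k + 1) := by
  have h3 : ((k : ℝ) + 3) ≤ 2 ^ (k + 1) := by exact_mod_cast add_three_le_two_pow hk
  have hD1 : D ≤ 2 ^ (k + 1) * lam := by
    calc D ≤ (k + 3) * lam := by rw [hD]; nlinarith
      _ ≤ _ := by gcongr
  have hD0 : 0 ≤ D := by rw [hD]; positivity
  have hlam3 : lam ^ 3 ≤ q * μ ^ 2 := by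
    calc lam ^ 3 ≤ lam ^ 10 := pow_le_pow_right₀ hlam (by norm_num)
      _ ≤ 2 ^ (40 * k) * lam ^ 10 := le_mul_of_one_le_left (by positivity) (one_le_pow₀ (by norm_num))
      _ ≤ g ^ 4 * (q * μ ^ 2) := hY
      _ ≤ _ := mul_le_of_le_one_left (by positivity) (pow_le_one₀ hg0 hg)
  have ht1 : t ≤ 2 * (2 ^ (k + 1)) ^ 3 * (q * μ ^ 2) := by
    have e1 : D ^ 2 * ((k + 1) * lam) ≤ (2 ^ (k + 1) * lam) ^ 2 * (2 ^ (k + 1) * lam) := by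
      gcongr
      linarith
    have e2 : (2 ^ (k + 1) * lam) ^ 2 * (2 ^ (k + 1) * lam) ≤ (2 ^ (k + 1)) ^ 3 * (q * μ ^ 2) := by
      calc _ = (2 ^ (k + 1)) ^ 3 * lam ^ 3 := by ring
        _ ≤ _ := by gcongr
    have e3 : 2 * (q * μ ^ 2) ≤ (2 ^ (k + 1)) ^ 3 * (q * μ ^ 2) := by
      refine mul_le_mul_of_nonneg_right ?_ (by positivity)
      rw [← pow_mul]
      calc (2 : ℝ) = 2 ^ 1 := (pow_one 2).symm
        _ ≤ _ := pow_le_pow_right₀ (by norm_num) (by omega)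
    rw [ht]
    linarith
  have ht0 : 0 ≤ t := by rw [ht]; positivity
  have hpow : (64 * 5 * 64 * 128 : ℝ) ≤ 2 ^ (24 * k) := by
    calc (64 * 5 * 64 * 128 : ℝ) ≤ 2 ^ 48 := by norm_num
      _ ≤ _ := pow_le_pow_right₀ (by norm_num) (by omega)
  rw [le_div_iff₀ (by positivity), div_pow, le_div_iff₀ (by positivity)]
  calc 64 * l * (2 ^ k * D) ^ 2 * ((2 ^ k) ^ 2 * t) * 2 ^ (3 * k + 1) * (8 * 4 ^ k) ^ 2
      ≤ 64 * (5 * lam) * (2 ^ k * (2 ^ (k + 1) * lam)) ^ 2 *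
        ((2 ^ k) ^ 2 * (2 * (2 ^ (k + 1)) ^ 3 * (q * μ ^ 2))) * 2 ^ (3 * k + 1) *
        (8 * 4 ^ k) ^ 2 := by gcongr
    _ = (64 * 5 * 64 * 128) * 2 ^ (16 * k) * lam ^ 3 * (q * μ ^ 2) := by
        rw [show (4 : ℝ) ^ k = 2 ^ (2 * k) by rw [pow_mul]; norm_num]
        ring
    _ ≤ 2 ^ (24 * k) * 2 ^ (16 * k) * lam ^ 10 * (q * μ ^ 2) := by
        gcongr
        norm_num
    _ = (2 ^ (40 * k) * lam ^ 10) * (q * μ ^ 2) := by ring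
    _ ≤ (g ^ 4 * (q * μ ^ 2)) * (q * μ ^ 2) := by gcongr
    _ = _ := by ring

end

/-- The saving 2^(e+1) in the base becomes at least n^(e+1) after the power 2^L. This pays for the
dimension n^E and leaves a factor 1/n. -/
theorem mul_pow_div_le {n e E L : ℕ} (hn : 1 ≤ n) (hL : n ≤ 2 ^ 2 ^ L) (hE : E ≤ e) {c x θ : ℝ}
    (hc : 0 ≤ c) (hx0 : 0 ≤ x) (hx : x ≤ θ ^ 2 / 2 ^ (e + 1)) (hθ : 0 < θ) :
    c * (n : ℝ) ^ E * x ^ 2 ^ L / (θ ^ 2) ^ 2 ^ L ≤ c / n := by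
  have hn' : (1 : ℝ) ≤ n := by exact_mod_cast hn
  have hL' : (n : ℝ) ≤ 2 ^ 2 ^ L := by exact_mod_cast hL
  rw [div_le_div_iff₀ (by positivity) (by positivity)]
  have h1 : x ^ 2 ^ L * (n : ℝ) ^ (e + 1) ≤ (θ ^ 2) ^ 2 ^ L := by
    calc x ^ 2 ^ L * (n : ℝ) ^ (e + 1) ≤ (θ ^ 2 / 2 ^ (e + 1)) ^ 2 ^ L * (2 ^ 2 ^ L) ^ (e + 1) := by
          gcongr
      _ = (θ ^ 2) ^ 2 ^ L := by
          rw [div_pow, pow_right_comm (2 : ℝ) (2 ^ L) (e + 1)]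
          field_simp
  calc c * (n : ℝ) ^ E * x ^ 2 ^ L * n = c * (x ^ 2 ^ L * (n : ℝ) ^ (E + 1)) := by ring
    _ ≤ c * (x ^ 2 ^ L * (n : ℝ) ^ (e + 1)) := by
        gcongr
    _ ≤ _ := by gcongr

theorem two_pow_squarings_le_log {n : ℕ} (hn : 3 ≤ n) : (2 : ℝ) ^ squarings n ≤ 5 * Real.log n := by
  have hc1 : 2 ≤ Nat.clog 2 n := (Nat.lt_clog_iff_pow_lt one_lt_two).2 (by omega)
  have h1 := Nat.pow_pred_clog_lt_self one_lt_two (show 1 < Nat.clog 2 n by omega)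
  have h2 := Nat.pow_pred_clog_lt_self one_lt_two (show 1 < n by omega)
  have hp := Nat.clog_pos one_lt_two (show 1 < Nat.clog 2 n by omega)
  have h3 : 2 ^ squarings n ≤ 2 * (Nat.clog 2 n).pred + 1 := by
    rw [squarings]
    obtain ⟨j, hj⟩ := Nat.exists_eq_add_of_le' hp
    rw [hj] at h1 ⊢
    have h1' : 2 ^ j < Nat.clog 2 n := h1
    rw [pow_succ, Nat.pred_eq_sub_one]
    omega
  have h4 : ((Nat.clog 2 n).pred : ℝ) * Real.log 2 ≤ Real.log n := by
    rw [← Real.log_pow]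
    refine Real.log_le_log (by positivity) ?_
    exact_mod_cast h2.le
  have h5 : (2 : ℝ) ^ squarings n ≤ 2 * (Nat.clog 2 n).pred + 1 := by exact_mod_cast h3
  have h6 := Real.log_two_gt_d9
  have h7 : (1 : ℝ) ≤ (Nat.clog 2 n).pred := by
    have : 1 ≤ (Nat.clog 2 n).pred := by rw [Nat.pred_eq_sub_one]; omega
    exact_mod_cast this
  nlinarith

theorem one_le_log {n : ℕ} (hn : 3 ≤ n) : 1 ≤ Real.log n := by
  have h3 : (3 : ℝ) ≤ n := by exact_mod_cast hn
  rw [Real.le_log_iff_exp_le (by linarith)]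
  have := Real.exp_one_lt_d9
  linarith

end CSP

/-! ### Success probability -/

namespace CSP

section
variable {k n : ℕ}

/-- The dense estimate is used for μ ≥ 1, the sparse one otherwise. Their dimension factors are N^5
and N^4 with N = n^⌊k/2⌋, both at most n^(3k), as `mul_pow_div_le` requires. -/
theorem bernoulliProb_traceMoment_le (hk : 2 ≤ k) (hn : 3 ≤ n) {p g : ℝ} (h0 : 0 ≤ p) (h1 : p ≤ 1)
    (hg0 : 0 < g) (hg : g ≤ 1) {μ D t θ : ℝ} (hμ : μ = p * (rowCount k n * 2 ^ k))
    (hY : 2 ^ (40 * k) * Real.log n ^ 10 ≤ g ^ 4 * (sliceCount k n * μ ^ 2))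
    (hD : D = 2 * μ + (k + 1) * Real.log n)
    (ht : t = 2 * (sliceCount k n * μ ^ 2) + D ^ 2 * ((k + 1) * Real.log n))
    (hθ : θ = g ^ 2 * (sliceCount k n * μ ^ 2) / (8 * 4 ^ k)) {T : Finset (Fin k)}
    (hT : T.Nonempty) :
    bernoulliProb p (fun ω : Fin (sliceCount k n) × Fin (rowCount k n) × Fin (rowCount k n) ×
      (Fin k → ℤˣ) → Bool => Regular D t (cellCount ω) ∧
        (θ ^ 2) ^ 2 ^ squarings n < traceMoment T (instanceOf ω)) ≤ 4 / n := by
  obtain ⟨j, hj⟩ := hT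
  have hlam := one_le_log hn
  have hμ0 : 0 ≤ μ := by rw [hμ]; positivity
  have hD0 : 0 ≤ D := by rw [hD]; positivity
  have ht0 : 0 ≤ t := by rw [ht]; positivity
  have hpos : 0 < sliceCount k n * μ ^ 2 := by
    have : 0 < g ^ 4 * (sliceCount k n * μ ^ 2) := lt_of_lt_of_le (by positivity) hY
    exact pos_of_mul_pos_right this (by positivity)
  have hθ0 : 0 < θ := by rw [hθ]; positivity
  have hl := two_pow_squarings_le_log hn
  have hN : ((rowCount k n : ℕ) : ℝ) = (n : ℝ) ^ (k / 2) := by rw [rowCount]; push_cast; rfl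
  simp only [traceMoment_instanceOf]
  by_cases hμ1 : 1 ≤ μ
  · have hx := dense_base_le hk hlam (by positivity) hl (Nat.cast_nonneg (sliceCount k n)) hμ1 hY hD
    rw [← hθ] at hx
    refine (bernoulliProb_trace_le h0 h1 (τ := Matrix.flipSign j) (fun c => prod_flipSign hj c)
      (Regular D t) (tr := fun w => Matrix.trace
        ((Matrix.offDiag w * (Matrix.offDiag w).transpose) ^ 2 ^ squarings n))
      (fun w => Matrix.trace_mul_transpose_pow_nonneg _ _) (b := 4 * (rowCount k n : ℝ) ^ 5 *
        (4096 * sliceCount k n * (2 ^ squarings n) ^ 3 * (2 ^ k * D) ^ 2) ^ 2 ^ squarings n)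
      (by positivity) (by positivity) (fun ω hω => ?_)).trans ?_
    · convert hω.sum_trace_le_of_degree (fun c : Fin k → ℤˣ => ∏ j ∈ T, c j) hD0 (squarings n)
        using 4 <;> simp
    · rw [hN, ← pow_mul]
      exact mul_pow_div_le (by omega) (RAM.le_two_pow_squarings n) (by omega) (by norm_num)
        (by positivity) hx hθ0
  · have hx := sparse_base_le hk hlam hl (Nat.cast_nonneg (sliceCount k n)) hμ0
      (not_le.1 hμ1).le hg0.le hg hY hD ht
    rw [← hθ] at hx
    refine (bernoulliProb_trace_le h0 h1 (τ := Matrix.flipSign j) (fun c => prod_flipSign hj c)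
      (Regular D t) (tr := fun w => Matrix.trace
        ((Matrix.offDiag w * (Matrix.offDiag w).transpose) ^ 2 ^ squarings n))
      (fun w => Matrix.trace_mul_transpose_pow_nonneg _ _) (b := 4 * (rowCount k n : ℝ) ^ 4 *
        (64 * 2 ^ squarings n * (2 ^ k * D) ^ 2 * ((2 ^ k) ^ 2 * t)) ^ 2 ^ squarings n)
      (by positivity) (by positivity) (fun ω hω => ?_)).trans ?_
    · refine (hω.sum_trace_le_of_sparse (fun c : Fin k → ℤˣ => ∏ j ∈ T, c j) hD0 ht0
        (squarings n)).trans ?_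
      simp only [Fintype.card_fin, Fintype.card_fun, Fintype.card_units_int, Nat.cast_pow,
        Nat.cast_ofNat]
      gcongr
      norm_num
    · rw [hN, ← pow_mul]
      exact mul_pow_div_le (by omega) (RAM.le_two_pow_squarings n) (by omega) (by norm_num)
        (by positivity) hx hθ0

theorem two_mul_add_mul_le {x q N : ℝ} (hx : 0 < x) (hq : 1 ≤ q) (hN : 1 ≤ N)
    (h : q * N ^ 2 = x ^ k) : 2 * (q * N + N ^ 2) * (1 / x ^ (k + 1)) ≤ 4 / x := by
  have h1 : q * N ≤ q * N ^ 2 :=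
    mul_le_mul_of_nonneg_left (le_self_pow₀ hN (by norm_num)) (by linarith)
  have h2 : N ^ 2 ≤ q * N ^ 2 := le_mul_of_one_le_left (by positivity) hq
  calc 2 * (q * N + N ^ 2) * (1 / x ^ (k + 1)) ≤ 2 * (2 * x ^ k) * (1 / x ^ (k + 1)) := by
        refine mul_le_mul_of_nonneg_right ?_ (by positivity)
        linarith
    _ = 4 / x := by
        rw [pow_succ]
        field_simp
        norm_num

theorem prob_certifier_eq_false_le (hk : 2 ≤ k) (hn : 3 ≤ n) (p : unitInterval) {γ : ℚ}
    (hγ0 : 0 < γ) (hγ1 : γ ≤ 1)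
    (h : (2 : ℝ) ^ ((20 : ℝ) * k) * (n : ℝ) ^ ((k : ℝ) / 2) * Real.log n ^ 5 / (γ : ℝ) ^ 2 ≤
      expectedNumConstraints k n p) :
    prob p (fun J : Instance k n => certifier n J γ = false) ≤ (5 + 4 * 2 ^ k) / n := by
  have h0 : (0 : ℝ) ≤ p := p.2.1
  have h1 : (p : ℝ) ≤ 1 := p.2.2
  have hg0 : (0 : ℝ) < γ := by exact_mod_cast hγ0
  have hg1 : (γ : ℝ) ≤ 1 := by exact_mod_cast hγ1
  have hn3 : (3 : ℝ) ≤ n := by exact_mod_cast hn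
  have hn0 : (0 : ℝ) < n := by linarith
  have hlam := one_le_log hn
  set lam := Real.log n with hlamdef
  set q : ℝ := (sliceCount k n : ℝ) with hq
  set N : ℝ := (rowCount k n : ℝ) with hN
  set μ : ℝ := p * (N * 2 ^ k) with hμ
  set M : ℝ := expectedNumConstraints k n p with hM
  set Z : ℝ := (n : ℝ) ^ ((k : ℝ) / 2) with hZ
  have hqN : q * N ^ 2 = (n : ℝ) ^ k := by
    rw [hq, hN, sq]; exact_mod_cast sliceCount_mul k n
  have hMμ : M = q * N * μ := by
    rw [hM, expectedNumConstraints, ← hqN, hμ]; ring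
  have hZ2 : Z ^ 2 = (n : ℝ) ^ k := by
    rw [hZ, ← Real.rpow_natCast, ← Real.rpow_mul hn0.le, ← Real.rpow_natCast]
    congr 1
    push_cast
    ring
  have hZn : (n : ℝ) ≤ Z := by
    rw [hZ]
    conv_lhs => rw [← Real.rpow_one (n : ℝ)]
    refine Real.rpow_le_rpow_of_exponent_le (by linarith) ?_
    have : (2 : ℝ) ≤ k := by exact_mod_cast hk
    linarith
  have hZ0 : 0 < Z := by linarith
  have hH : 2 ^ (20 * k) * Z * lam ^ 5 ≤ (γ : ℝ) ^ 2 * M := by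
    rw [div_le_iff₀ (by positivity)] at h
    have e : (2 : ℝ) ^ ((20 : ℝ) * k) = 2 ^ (20 * k) := by
      rw [← Real.rpow_natCast]; push_cast; rfl
    rw [e] at h
    linarith
  have hM0 : 0 < M := by
    have : 0 < (γ : ℝ) ^ 2 * M := lt_of_lt_of_le (by positivity) hH
    exact pos_of_mul_pos_right this (by positivity)
  have hgM : (γ : ℝ) ^ 2 * M ≤ M := mul_le_of_le_one_left hM0.le (pow_le_one₀ hg0.le hg1)
  have hlam5 : lam ≤ lam ^ 5 := le_self_pow₀ hlam (by norm_num)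
  -- The squared hypothesis, divided by n^k = qN²; since M = qNμ, the quotient M²/n^k is qμ².
  have hY : 2 ^ (40 * k) * lam ^ 10 ≤ (γ : ℝ) ^ 4 * (q * μ ^ 2) := by
    have e1 := pow_le_pow_left₀ (by positivity) hH 2
    refine le_of_mul_le_mul_left ?_ (by positivity : 0 < (n : ℝ) ^ k)
    calc (n : ℝ) ^ k * (2 ^ (40 * k) * lam ^ 10) = (2 ^ (20 * k) * Z * lam ^ 5) ^ 2 := by
          rw [← hZ2]; ring
      _ ≤ _ := e1
      _ = (n : ℝ) ^ k * ((γ : ℝ) ^ 4 * (q * μ ^ 2)) := by rw [hMμ, ← hqN]; ring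
  have hP : (8 : ℝ) ≤ 2 ^ (20 * k) := by
    calc (8 : ℝ) = 2 ^ 3 := by norm_num
      _ ≤ _ := pow_le_pow_right₀ (by norm_num) (by omega)
  have hbase : 2 ^ (20 * k) * n ≤ (γ : ℝ) ^ 2 * M := by
    refine le_trans ?_ hH
    rw [mul_assoc]
    refine mul_le_mul_of_nonneg_left ?_ (by positivity)
    calc (n : ℝ) ≤ Z := hZn
      _ ≤ Z * lam ^ 5 := le_mul_of_one_le_right hZ0.le (one_le_pow₀ hlam)
  have hnM : (n : ℝ) ≤ M / 2 := by nlinarith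
  have hlamM : lam ≤ M / 8 := by
    have : 8 * lam ≤ M := by
      calc 8 * lam ≤ 8 * (Z * lam ^ 5) := by
            have : lam ^ 5 ≤ Z * lam ^ 5 := le_mul_of_one_le_left (by positivity) (by linarith)
            linarith
        _ ≤ 2 ^ (20 * k) * (Z * lam ^ 5) := by gcongr
        _ = 2 ^ (20 * k) * Z * lam ^ 5 := by ring
        _ ≤ _ := hH.trans hgM
    linarith
  have hslack : 4 * q * 8 ^ k ≤ (γ : ℝ) ^ 2 * M := by
    refine le_trans ?_ hbase
    have e1 : q ≤ n := by
      rw [hq, sliceCount]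
      push_cast
      calc (n : ℝ) ^ (k % 2) ≤ (n : ℝ) ^ 1 := pow_le_pow_right₀ (by linarith) (by omega)
        _ = n := pow_one _
    have e2 : (4 * 8 ^ k : ℝ) ≤ 2 ^ (20 * k) := by
      calc (4 * 8 ^ k : ℝ) = 2 ^ (2 + 3 * k) := by rw [pow_add, pow_mul]; norm_num
        _ ≤ _ := pow_le_pow_right₀ (by norm_num) (by omega)
    calc 4 * q * 8 ^ k = (4 * 8 ^ k) * q := by ring
      _ ≤ _ := by gcongr
  set s : ℝ := (k + 1) * lam with hs
  set D : ℝ := 2 * μ + s with hD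
  set t : ℝ := 2 * (q * μ ^ 2) + D ^ 2 * s with ht
  set θ : ℝ := (γ : ℝ) ^ 2 * (q * μ ^ 2) / (8 * 4 ^ k) with hθ
  have hs0 : 0 < s := by positivity
  -- The choice s = (k + 1) log n makes each tail n^(-(k+1)), against a union bound of order n^k.
  have hexp : Real.exp (-s) = 1 / (n : ℝ) ^ (k + 1) := by
    rw [Real.exp_neg, hs, one_div]
    congr 1
    rw [show ((k : ℝ) + 1) * lam = ((k + 1 : ℕ) : ℝ) * lam by push_cast; ring, Real.exp_nat_mul,
      hlamdef, Real.exp_log hn0]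
  rw [prob_eq_bernoulliProb]
  have hE1 := bernoulliProb_countTrue_lt_le (E := Fin (sliceCount k n) × Fin (rowCount k n) ×
    Fin (rowCount k n) × (Fin k → ℤˣ)) h0 h1 Finset.univ
  have hcard : (p : ℝ) * (Finset.univ : Finset (Fin (sliceCount k n) × Fin (rowCount k n) ×
      Fin (rowCount k n) × (Fin k → ℤˣ))).card = M := by
    rw [hMμ, hμ, hq, hN]
    simp
    ring
  rw [hcard] at hE1
  have hE2 := bernoulliProb_not_regular_le (ι := Fin (sliceCount k n)) (α := Fin (rowCount k n))
    (S := Fin k → ℤˣ) h0 h1 (μ := μ) (s := s) (D := D) (t := t) (by simp [hμ, hN]) hs0 hD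
    (by simp [ht, hq])
  have hE3 : ∀ T : Finset (Fin k), bernoulliProb (p : ℝ) (fun ω : Fin (sliceCount k n) ×
      Fin (rowCount k n) × Fin (rowCount k n) × (Fin k → ℤˣ) → Bool => T.Nonempty ∧
        Regular D t (cellCount ω) ∧ (θ ^ 2) ^ 2 ^ squarings n < traceMoment T (instanceOf ω)) ≤
        4 / n := by
    intro T
    by_cases hT : T.Nonempty
    · simp only [hT, true_and]
      exact bernoulliProb_traceMoment_le hk hn h0 h1 hg0 hg1 hμ hY hD ht hθ hT
    · simp only [hT, false_and, bernoulliProb, if_false]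
      rw [bernoulliExp_const]
      positivity
  have hE4 := bernoulliProb_exists_le_card_mul h0 h1 hE3
  refine (bernoulliProb_mono h0 h1 (R := fun ω => ((countTrue Finset.univ ω : ℝ) < M / 2 ∨
    ¬ Regular D t (cellCount ω)) ∨ ∃ T : Finset (Fin k), T.Nonempty ∧
      Regular D t (cellCount ω) ∧ (θ ^ 2) ^ 2 ^ squarings n < traceMoment T (instanceOf ω))
    fun ω hω => ?_).trans ((bernoulliProb_or_le h0 h1 _ _).trans
      ((add_le_add ((bernoulliProb_or_le h0 h1 _ _).trans (add_le_add hE1 hE2)) hE4).trans ?_))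
  · by_contra hc
    push Not at hc
    obtain ⟨⟨c1, c2⟩, c3⟩ := hc
    rw [← card_instanceOf] at c1
    have := certifier_eq_true hγ0 hM0 hnM c1 hslack (sumSq_instanceOf_le ω) (θ := θ) (by
      rw [← hq, ← hN, hMμ, hθ]
      field_simp) (fun T hT => c3 T hT c2)
    rw [this] at hω
    exact absurd hω (by decide)
  · have e1 : Real.exp (-(M / 8)) ≤ 1 / n := by
      calc Real.exp (-(M / 8)) ≤ Real.exp (-lam) := by gcongr
        _ = 1 / n := by rw [Real.exp_neg, hlamdef, Real.exp_log hn0, one_div]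
    have e2 : 2 * ((Fintype.card (Fin (sliceCount k n)) : ℝ) * Fintype.card (Fin (rowCount k n)) +
        (Fintype.card (Fin (rowCount k n)) : ℝ) ^ 2) * Real.exp (-s) ≤ 4 / n := by
      rw [Fintype.card_fin, Fintype.card_fin, ← hq, ← hN, hexp]
      have hq1 : 1 ≤ q := by
        rw [hq, sliceCount]; push_cast; exact one_le_pow₀ (by linarith)
      have hN1 : 1 ≤ N := by
        rw [hN, rowCount]; push_cast; exact one_le_pow₀ (by linarith)
      exact two_mul_add_mul_le hn0 hq1 hN1 hqN
    have e4 : (Fintype.card (Finset (Fin k)) : ℝ) * (4 / n) = 4 * 2 ^ k / n := by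
      simp
      ring
    rw [e4]
    calc _ ≤ 1 / (n : ℝ) + 4 / n + 4 * 2 ^ k / n := by gcongr
      _ = _ := by ring

theorem prob_le_one (p : unitInterval) (Q : Instance k n → Prop) : prob p Q ≤ 1 := by
  rw [prob_eq_bernoulliProb]
  exact bernoulliProb_le_one p.2.1 p.2.2 _

end

end CSP

theorem mainTheorem4 :
    ∃ C : ℝ, ∀ k : ℕ, 2 ≤ k →
      ∃ A : (n : ℕ) → CSP.Instance k n → ℚ → Bool,
        CSP.IsEfficient A ∧
        (∀ (n : ℕ) (J : CSP.Instance k n) (γ : ℚ), A n J γ = true → CSP.IsQuasirandom (γ : ℝ) J) ∧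
        ∃ δ : ℕ → ℝ, Filter.Tendsto δ Filter.atTop (nhds 0) ∧
          ∀ (n : ℕ) (p : unitInterval) (γ : ℚ), 0 < γ → γ ≤ 1 →
            (2 : ℝ) ^ (C * k) * (n : ℝ) ^ ((k : ℝ) / 2) * Real.log n ^ 5 / (γ : ℝ) ^ 2 ≤
              CSP.expectedNumConstraints k n p →
            CSP.prob p (fun J : CSP.Instance k n => A n J γ = false) ≤ δ n := by
  -- For n < 3 the estimate log n ≥ 1 is not available, and the trivial bound 1 is used.
  refine ⟨20, fun k hk => ⟨CSP.certifier, RAM.isEfficient_certifier (by omega),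
    fun n J γ h => CSP.isQuasirandom_of_certifier h,
    fun n => if 3 ≤ n then (5 + 4 * 2 ^ k) / n else 1, ?_, fun n p γ h0 h1 h => ?_⟩⟩
  · refine (tendsto_const_div_atTop_nhds_zero_nat (5 + 4 * 2 ^ k)).congr' ?_
    filter_upwards [Filter.eventually_ge_atTop 3] with n hn
    rw [if_pos hn]
  · dsimp only
    split_ifs with hn
    · exact CSP.prob_certifier_eq_false_le hk hn p h0 h1 h
    · exact CSP.prob_le_one p _
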